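/- **Theorem (Universality).** Fix $M\ge 2$ and let $\mathbb P=\{0,\dots,M\}$. *Open parity games.* An object is a pair $m=(m^{+},m^{-})$ of natural numbers (numbers of left-to-right and of right-to-left wires). An open parity game $A:m\to n$ consists of a finite set $V$ of internal positions, a subset $V_0\subseteq V$ (Player $0$'s positions; $V_1=V\setminus V_0$ are Player $1$'s), a priority function $\Omega:V\to\mathbb P$, and a relation $E\subseteq(\mathrm{Ent}+V)\times(V+\mathrm{Exit})$, where $\mathrm{Ent}$ consists of the $m^{+}$ left-to-right wires of the domain and the $n^{-}$ right-to-left wires of the codomain, and $\mathrm{Exit}$ of the $m^{-}$ right-to-left wires of the domain and the $n^{+}$ left-to-right wires of the codomain; there is exactly one edge out of each entry and exactly one edge into each exit. *Equivalence.* A play starts at an entry and follows edges until it reaches an exit or a position without successor, or forever; the owner of an internal position chooses the next position, by a strategy that may depend on the history and must choose a successor whenever there is one. A play ending at exit $o$ denotes $(o,k)$, where $k$ is the largest priority met ($k=0$ if no internal position is met). A play ending at an internal position without successor is lost by the owner of that position. An infinite play is won by Player $0$ if the largest priority occurring infinitely often is even, and by Player $1$ otherwise. The semantics of $A$ is the set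 of pairs $(T,i)$, with $T\subseteq\mathrm{Exit}\times\mathbb P$ and $i\in\mathrm{Ent}$, such that Player $0$ has a strategy against which no strategy of Player $1$ makes Player $0$ lose the play from $i$, and such that every $(o,k)$ denoted by a play from $i$ consistent with it lies in $T$. Two games $A,B:m\to n$ are equivalent, $A\simeq B$, if they have the same semantics. *Operations.* For $A:m\to n$ and $B:n\to o$, the composite $A;B:m\to o$ has the disjoint union of the internal positions; the wires of $n$ (exits of one game identified with entries of the other) are hidden, and there is an edge from $s$ to $t$ iff there is a path from $s$ to $t$ in the union of the two graphs all of whose intermediate nodes are hidden wires. The product $A\otimes B$ is juxtaposition. The identity and swap games have no internal positions and join each entry to the corresponding exit. *Diagrams.* Let $d$ range over the morphisms $v\to w$ ($v,w$ words over $\{\blacktriangleright,\blacktriangleleft\}$) of the free two-coloured prop on the finite set of generators $$\text{player-}0,\ \text{player-}1:\blacktriangleright\to\blacktriangleright\blacktriangleright,\quad \text{lose-}0,\ \text{lose-}1:\blacktriangleright\to\varepsilon,\quad \text{merge}:\blacktriangleright\blacktriangleright\to\blacktriangleright,\quad \text{start}:\varepsilon\to\blacktriangleright,$$ $$\text{priority}_p:\blacktriangleright\to\blacktriangleright\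 (p\in\mathbb P),\quad \text{cap}:\blacktriangleleft\blacktriangleright\to\varepsilon,\quad \text{cup}:\varepsilon\to\blacktriangleright\blacktriangleleft .$$ The interpretation $[\![\cdot]\!]$ sends $\blacktriangleright$ to $(1,0)$, $\blacktriangleleft$ to $(0,1)$, concatenation of words to componentwise addition, and composition, product, identities and symmetries of diagrams to those of games. Each generator other than cup and cap is sent to the game with one internal position $x$, an edge from every entry to $x$ and an edge from $x$ to every exit; $x$ belongs to Player $0$ for player-$0$ and lose-$0$ and to Player $1$ otherwise, and has priority $p$ for $\text{priority}_p$ and $0$ otherwise. Cup and cap are sent to the game without internal positions whose single entry is joined to its single exit. *Claim.* For every open parity game $A:m\to n$ and all words $v,w$ with $[\![v]\!]=m$ and $[\![w]\!]=n$ there is a diagram $d:v\to w$ such that $[\![d]\!]\simeq A$. In particular, every open parity game $A:(m,0)\to(n,0)$, with $m,n\in\mathbb N$, is equivalent to the interpretation of a diagram $\blacktriangleright^m\to\blacktriangleright^n$. -/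

import Mathlib

universe u v

namespace ParityGames

/-! ## Open parity games -/

/-- An object is a pair of natural numbers: the number of wires going from left to right and the
number of wires going from right to left. -/
abbrev Obj : Type := ℕ × ℕ

/-- The entry positions of a game `m → n`: the left-to-right wires of its domain, followed by the
right-to-left wires of its codomain. -/
abbrev Entries (m n : Obj) : Type := Fin m.1 ⊕ Fin n.2

/-- The exit positions of a game `m → n`: the right-to-left wires of its domain, followed by the
left-to-right wires of its codomain. -/
abbrev Exits (m n : Obj) : Type := Fin m.2 ⊕ Fin n.1

/-- An open parity game `m → n` with priorities in `{0, …, M}`. -/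
structure OpenParityGame (M : ℕ) (m n : Obj) : Type (u + 1) where
  /-- internal positions -/
  V : Type u
  finite : Finite V
  /-- the internal positions of Player 0; all others belong to Player 1 -/
  V₀ : Set V
  /-- edges -/
  E : Entries m n ⊕ V → V ⊕ Exits m n → Prop
  entry_unique : ∀ e : Entries m n, ∃! t, E (Sum.inl e) t
  exit_unique : ∀ o : Exits m n, ∃! s, E s (Sum.inr o)
  /-- priorities -/
  prio : V → Fin (M + 1)

/-! ### Feedback of a relation along hidden nodes -/

/-- `feedback R s t`: there is an `R`-path from `s` to `t` all of whose intermediate nodes are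
hidden, that is, lie in `H`. -/
def feedback {S T H : Type*} (R : S ⊕ H → T ⊕ H → Prop) (s : S) (t : T) : Prop :=
  R (Sum.inl s) (Sum.inl t) ∨
    ∃ h h' : H, R (Sum.inl s) (Sum.inr h) ∧
      Relation.ReflTransGen (fun a b : H => R (Sum.inr a) (Sum.inr b)) h h' ∧
      R (Sum.inr h') (Sum.inl t)

theorem feedback_flip {S T H : Type*} (R : S ⊕ H → T ⊕ H → Prop) (s : S) (t : T) :
    feedback (fun x y => R y x) t s ↔ feedback R s t := by
  unfold feedback
  refine or_congr Iff.rfl ⟨?_, ?_⟩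
  · rintro ⟨h, h', h1, h2, h3⟩
    exact ⟨h', h, h3, Relation.reflTransGen_swap.1 h2, h1⟩
  · rintro ⟨h, h', h1, h2, h3⟩
    exact ⟨h', h, h3, Relation.reflTransGen_swap.1 h2, h1⟩

theorem feedback_existsUnique {S T H : Type*} [Finite H] (R : S ⊕ H → T ⊕ H → Prop) (s : S)
    (hs : ∃! x, R (Sum.inl s) x) (hout : ∀ h, ∃! x, R (Sum.inr h) x)
    (hin : ∀ h, ∃! x, R x (Sum.inr h)) : ∃! t, feedback R s t := by
  have key : ∀ h h₁ h₂ : H, ∀ t₁ t₂ : T,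
      Relation.ReflTransGen (fun a b : H => R (Sum.inr a) (Sum.inr b)) h h₁ →
      Relation.ReflTransGen (fun a b : H => R (Sum.inr a) (Sum.inr b)) h h₂ →
      R (Sum.inr h₁) (Sum.inl t₁) → R (Sum.inr h₂) (Sum.inl t₂) → t₁ = t₂ := by
    intro h h₁ h₂ t₁ t₂ p₁ p₂ e₁ e₂
    induction p₁ using Relation.ReflTransGen.head_induction_on with
    | refl =>
      rcases Relation.ReflTransGen.cases_head p₂ with rfl | ⟨c, hc, -⟩
      · exact Sum.inl.inj ((hout _).unique e₁ e₂)
      · exact absurd ((hout _).unique e₁ hc) (by simp)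
    | head hab hbc ih =>
      rcases Relation.ReflTransGen.cases_head p₂ with rfl | ⟨c, hc, hc₂⟩
      · exact absurd ((hout _).unique e₂ hab) (by simp)
      · have := Sum.inr.inj ((hout _).unique hab hc)
        subst this
        exact ih hc₂
  have ex : ∃ t, feedback R s t := by
    by_contra hno
    obtain ⟨x, hx, -⟩ := hs
    rcases x with t | h₀
    · exact hno ⟨t, Or.inl hx⟩
    · have nxt : ∀ h : {h : H // Relation.ReflTransGen
          (fun a b : H => R (Sum.inr a) (Sum.inr b)) h₀ h},
          ∃ k : {h : H // Relation.ReflTransGen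
          (fun a b : H => R (Sum.inr a) (Sum.inr b)) h₀ h}, R (Sum.inr h.1) (Sum.inr k.1) := by
        rintro ⟨h, hh⟩
        obtain ⟨y, hy, -⟩ := hout h
        rcases y with t | k
        · exact absurd ⟨t, Or.inr ⟨h₀, h, hx, hh, hy⟩⟩ hno
        · exact ⟨⟨k, hh.tail hy⟩, hy⟩
      choose f hf using nxt
      let q : ℕ → {h : H // Relation.ReflTransGen
          (fun a b : H => R (Sum.inr a) (Sum.inr b)) h₀ h} :=
        fun n => f^[n] ⟨h₀, .refl⟩
      have hq : ∀ n, R (Sum.inr (q n).1) (Sum.inr (q (n + 1)).1) := by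
        intro n
        have := hf (q n)
        rwa [show q (n + 1) = f (q n) from Function.iterate_succ_apply' f n _]
      have inj : ∀ a b, a < b → (q a).1 ≠ (q b).1 := by
        intro a
        induction a with
        | zero =>
          intro b hb heq
          obtain ⟨c, rfl⟩ : ∃ c, b = c + 1 := ⟨b - 1, by omega⟩
          have h1 := hq c
          rw [← heq] at h1
          exact absurd ((hin _).unique hx h1) (by simp)
        | succ a ih =>
          intro b hb heq
          obtain ⟨c, rfl⟩ : ∃ c, b = c + 1 := ⟨b - 1, by omega⟩
          have h1 := hq c
          rw [← heq] at h1
          exact ih c (by omega) (Sum.inr.inj ((hin _).unique (hq a) h1))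
      refine not_injective_infinite_finite (fun n => (q n).1) fun a b hab => ?_
      rcases lt_trichotomy a b with h | h | h
      · exact absurd hab (inj a b h)
      · exact h
      · exact absurd hab.symm (inj b a h)
  obtain ⟨t, ht⟩ := ex
  refine ⟨t, ht, fun t' ht' => ?_⟩
  rcases ht with ht | ⟨h, k, a, b, c⟩ <;> rcases ht' with ht' | ⟨h', k', a', b', c'⟩
  · exact Sum.inl.inj (hs.unique ht' ht)
  · exact absurd (hs.unique ht a') (by simp)
  · exact absurd (hs.unique ht' a) (by simp)
  · have := Sum.inr.inj (hs.unique a a')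
    subst this
    exact key _ _ _ _ _ b' b c' c

namespace OpenParityGame

variable {M : ℕ}

/-- Transport along equalities of objects. -/
def cast {m m' n n' : Obj} (hm : m = m') (hn : n = n') (A : OpenParityGame.{u} M m n) :
    OpenParityGame.{u} M m' n' :=
  hm ▸ hn ▸ A

/-! ### Composition

The wires of the common interface are hidden. They are `Fin n.1 ⊕ Fin n.2`: the left-to-right
ones (exits of the first game, entries of the second) and the right-to-left ones (exits of the
second game, entries of the first). -/

section comp

variable {m n o : Obj} (A : OpenParityGame.{u} M m n) (B : OpenParityGame.{u} M n o)

def compSrcLeft : Entries m n ⊕ A.V → (Entries m o ⊕ (A.V ⊕ B.V)) ⊕ (Fin n.1 ⊕ Fin n.2)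
  | Sum.inl (Sum.inl i) => Sum.inl (Sum.inl (Sum.inl i))
  | Sum.inl (Sum.inr j) => Sum.inr (Sum.inr j)
  | Sum.inr x => Sum.inl (Sum.inr (Sum.inl x))

def compSrcRight : Entries n o ⊕ B.V → (Entries m o ⊕ (A.V ⊕ B.V)) ⊕ (Fin n.1 ⊕ Fin n.2)
  | Sum.inl (Sum.inl i) => Sum.inr (Sum.inl i)
  | Sum.inl (Sum.inr j) => Sum.inl (Sum.inl (Sum.inr j))
  | Sum.inr x => Sum.inl (Sum.inr (Sum.inr x))

def compTgtLeft : A.V ⊕ Exits m n → ((A.V ⊕ B.V) ⊕ Exits m o) ⊕ (Fin n.1 ⊕ Fin n.2)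
  | Sum.inl x => Sum.inl (Sum.inl (Sum.inl x))
  | Sum.inr (Sum.inl j) => Sum.inl (Sum.inr (Sum.inl j))
  | Sum.inr (Sum.inr i) => Sum.inr (Sum.inl i)

def compTgtRight : B.V ⊕ Exits n o → ((A.V ⊕ B.V) ⊕ Exits m o) ⊕ (Fin n.1 ⊕ Fin n.2)
  | Sum.inl x => Sum.inl (Sum.inl (Sum.inr x))
  | Sum.inr (Sum.inl j) => Sum.inr (Sum.inr j)
  | Sum.inr (Sum.inr i) => Sum.inl (Sum.inr (Sum.inr i))

/-- The union of the two edge relations, in which the hidden wires are still nodes. -/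
def compEdge (s : (Entries m o ⊕ (A.V ⊕ B.V)) ⊕ (Fin n.1 ⊕ Fin n.2))
    (t : ((A.V ⊕ B.V) ⊕ Exits m o) ⊕ (Fin n.1 ⊕ Fin n.2)) : Prop :=
  (∃ a b, A.E a b ∧ compSrcLeft A B a = s ∧ compTgtLeft A B b = t) ∨
    (∃ a b, B.E a b ∧ compSrcRight A B a = s ∧ compTgtRight A B b = t)

theorem compSrcLeft_injective : Function.Injective (compSrcLeft A B) := by
  rintro ((a | a) | a) ((b | b) | b) h <;> simp_all [compSrcLeft]

theorem compSrcRight_injective : Function.Injective (compSrcRight A B) := by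
  rintro ((a | a) | a) ((b | b) | b) h <;> simp_all [compSrcRight]

theorem compTgtLeft_injective : Function.Injective (compTgtLeft A B) := by
  rintro (a | (a | a)) (b | (b | b)) h <;> simp_all [compTgtLeft]

theorem compTgtRight_injective : Function.Injective (compTgtRight A B) := by
  rintro (a | (a | a)) (b | (b | b)) h <;> simp_all [compTgtRight]

theorem compSrc_ne (a b) : compSrcLeft A B a ≠ compSrcRight A B b := by
  rcases a with (a | a) | a <;> rcases b with (b | b) | b <;> simp [compSrcLeft, compSrcRight]

theorem compTgt_ne (a b) : compTgtLeft A B a ≠ compTgtRight A B b := by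
  rcases a with a | (a | a) <;> rcases b with b | (b | b) <;> simp [compTgtLeft, compTgtRight]

theorem compEdge_srcLeft (e) : ∃! t, compEdge A B (compSrcLeft A B (Sum.inl e)) t := by
  obtain ⟨t, ht, hu⟩ := A.entry_unique e
  refine ⟨compTgtLeft A B t, Or.inl ⟨_, _, ht, rfl, rfl⟩, ?_⟩
  rintro _ (⟨a, b, hab, h1, rfl⟩ | ⟨a, b, hab, h1, rfl⟩)
  · rw [compSrcLeft_injective A B h1] at hab
    rw [hu b hab]
  · exact absurd h1.symm (compSrc_ne A B _ _)

theorem compEdge_srcRight (e) : ∃! t, compEdge A B (compSrcRight A B (Sum.inl e)) t := by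
  obtain ⟨t, ht, hu⟩ := B.entry_unique e
  refine ⟨compTgtRight A B t, Or.inr ⟨_, _, ht, rfl, rfl⟩, ?_⟩
  rintro _ (⟨a, b, hab, h1, rfl⟩ | ⟨a, b, hab, h1, rfl⟩)
  · exact absurd h1 (compSrc_ne A B _ _)
  · rw [compSrcRight_injective A B h1] at hab
    rw [hu b hab]

theorem compEdge_tgtLeft (e) : ∃! s, compEdge A B s (compTgtLeft A B (Sum.inr e)) := by
  obtain ⟨t, ht, hu⟩ := A.exit_unique e
  refine ⟨compSrcLeft A B t, Or.inl ⟨_, _, ht, rfl, rfl⟩, ?_⟩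
  rintro _ (⟨a, b, hab, rfl, h1⟩ | ⟨a, b, hab, rfl, h1⟩)
  · rw [compTgtLeft_injective A B h1] at hab
    rw [hu a hab]
  · exact absurd h1.symm (compTgt_ne A B _ _)

theorem compEdge_tgtRight (e) : ∃! s, compEdge A B s (compTgtRight A B (Sum.inr e)) := by
  obtain ⟨t, ht, hu⟩ := B.exit_unique e
  refine ⟨compSrcRight A B t, Or.inr ⟨_, _, ht, rfl, rfl⟩, ?_⟩
  rintro _ (⟨a, b, hab, rfl, h1⟩ | ⟨a, b, hab, rfl, h1⟩)
  · exact absurd h1 (compTgt_ne A B _ _)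
  · rw [compTgtRight_injective A B h1] at hab
    rw [hu a hab]

theorem compEdge_hidden_out (h : Fin n.1 ⊕ Fin n.2) : ∃! t, compEdge A B (Sum.inr h) t := by
  rcases h with i | j
  · exact compEdge_srcRight A B (Sum.inl i)
  · exact compEdge_srcLeft A B (Sum.inr j)

theorem compEdge_hidden_in (h : Fin n.1 ⊕ Fin n.2) : ∃! s, compEdge A B s (Sum.inr h) := by
  rcases h with i | j
  · exact compEdge_tgtLeft A B (Sum.inr i)
  · exact compEdge_tgtRight A B (Sum.inl j)

/-- The composite of two games: their internal positions are juxtaposed, and a maximal chain of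
edges through hidden wires becomes a single edge. -/
def comp : OpenParityGame.{u} M m o where
  V := A.V ⊕ B.V
  finite := by
    have := A.finite
    have := B.finite
    infer_instance
  V₀ := {x | Sum.elim (· ∈ A.V₀) (· ∈ B.V₀) x}
  E := feedback (compEdge A B)
  entry_unique := by
    rintro (i | j)
    · exact feedback_existsUnique _ _ (compEdge_srcLeft A B (Sum.inl i))
        (compEdge_hidden_out A B) (compEdge_hidden_in A B)
    · exact feedback_existsUnique _ _ (compEdge_srcRight A B (Sum.inr j))
        (compEdge_hidden_out A B) (compEdge_hidden_in A B)
  exit_unique := by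
    intro x
    have key : ∃! s, feedback (fun p q => compEdge A B q p) (Sum.inr x) s := by
      rcases x with j | i
      · exact feedback_existsUnique _ _ (compEdge_tgtLeft A B (Sum.inl j))
          (compEdge_hidden_in A B) (compEdge_hidden_out A B)
      · exact feedback_existsUnique _ _ (compEdge_tgtRight A B (Sum.inr i))
          (compEdge_hidden_in A B) (compEdge_hidden_out A B)
    simpa only [feedback_flip] using key
  prio := Sum.elim A.prio B.prio

end comp

/-! ### Monoidal product -/

section tensor

variable {m₁ n₁ m₂ n₂ : Obj} (A : OpenParityGame.{u} M m₁ n₁) (B : OpenParityGame.{u} M m₂ n₂)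

def tensorSrcLeft : Entries m₁ n₁ ⊕ A.V → Entries (m₁ + m₂) (n₁ + n₂) ⊕ (A.V ⊕ B.V)
  | Sum.inl (Sum.inl i) => Sum.inl (Sum.inl (Fin.castAdd m₂.1 i))
  | Sum.inl (Sum.inr j) => Sum.inl (Sum.inr (Fin.castAdd n₂.2 j))
  | Sum.inr x => Sum.inr (Sum.inl x)

def tensorSrcRight : Entries m₂ n₂ ⊕ B.V → Entries (m₁ + m₂) (n₁ + n₂) ⊕ (A.V ⊕ B.V)
  | Sum.inl (Sum.inl i) => Sum.inl (Sum.inl (Fin.natAdd m₁.1 i))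
  | Sum.inl (Sum.inr j) => Sum.inl (Sum.inr (Fin.natAdd n₁.2 j))
  | Sum.inr x => Sum.inr (Sum.inr x)

def tensorTgtLeft : A.V ⊕ Exits m₁ n₁ → (A.V ⊕ B.V) ⊕ Exits (m₁ + m₂) (n₁ + n₂)
  | Sum.inl x => Sum.inl (Sum.inl x)
  | Sum.inr (Sum.inl j) => Sum.inr (Sum.inl (Fin.castAdd m₂.2 j))
  | Sum.inr (Sum.inr i) => Sum.inr (Sum.inr (Fin.castAdd n₂.1 i))

def tensorTgtRight : B.V ⊕ Exits m₂ n₂ → (A.V ⊕ B.V) ⊕ Exits (m₁ + m₂) (n₁ + n₂)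
  | Sum.inl x => Sum.inl (Sum.inr x)
  | Sum.inr (Sum.inl j) => Sum.inr (Sum.inl (Fin.natAdd m₁.2 j))
  | Sum.inr (Sum.inr i) => Sum.inr (Sum.inr (Fin.natAdd n₁.1 i))

/-- The disjoint union of the two edge relations. -/
def tensorEdge (s : Entries (m₁ + m₂) (n₁ + n₂) ⊕ (A.V ⊕ B.V))
    (t : (A.V ⊕ B.V) ⊕ Exits (m₁ + m₂) (n₁ + n₂)) : Prop :=
  (∃ a b, A.E a b ∧ tensorSrcLeft A B a = s ∧ tensorTgtLeft A B b = t) ∨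
    (∃ a b, B.E a b ∧ tensorSrcRight A B a = s ∧ tensorTgtRight A B b = t)

theorem castAdd_ne_natAdd {a b : ℕ} (i : Fin a) (j : Fin b) :
    Fin.castAdd b i ≠ Fin.natAdd a j := by
  intro h
  have := congrArg Fin.val h
  simp at this
  omega

theorem tensorSrcLeft_injective : Function.Injective (tensorSrcLeft A B) := by
  rintro ((a | a) | a) ((b | b) | b) h <;>
    simp only [tensorSrcLeft, Sum.inl.injEq, Sum.inr.injEq, reduceCtorEq] at h ⊢
  · exact Fin.castAdd_injective _ _ h
  · exact Fin.castAdd_injective _ _ h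
  · exact h

theorem tensorSrcRight_injective : Function.Injective (tensorSrcRight A B) := by
  rintro ((a | a) | a) ((b | b) | b) h <;>
    simp only [tensorSrcRight, Sum.inl.injEq, Sum.inr.injEq, reduceCtorEq] at h ⊢
  · exact Fin.natAdd_injective _ _ h
  · exact Fin.natAdd_injective _ _ h
  · exact h

theorem tensorTgtLeft_injective : Function.Injective (tensorTgtLeft A B) := by
  rintro (a | (a | a)) (b | (b | b)) h <;>
    simp only [tensorTgtLeft, Sum.inl.injEq, Sum.inr.injEq, reduceCtorEq] at h ⊢
  · exact h
  · exact Fin.castAdd_injective _ _ h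
  · exact Fin.castAdd_injective _ _ h

theorem tensorTgtRight_injective : Function.Injective (tensorTgtRight A B) := by
  rintro (a | (a | a)) (b | (b | b)) h <;>
    simp only [tensorTgtRight, Sum.inl.injEq, Sum.inr.injEq, reduceCtorEq] at h ⊢
  · exact h
  · exact Fin.natAdd_injective _ _ h
  · exact Fin.natAdd_injective _ _ h

theorem tensorSrc_ne (a b) : tensorSrcLeft A B a ≠ tensorSrcRight A B b := by
  intro h
  rcases a with (a | a) | a <;> rcases b with (b | b) | b <;>
    simp only [tensorSrcLeft, tensorSrcRight, Sum.inl.injEq, Sum.inr.injEq, reduceCtorEq] at h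
  · exact castAdd_ne_natAdd _ _ h
  · exact castAdd_ne_natAdd _ _ h

theorem tensorTgt_ne (a b) : tensorTgtLeft A B a ≠ tensorTgtRight A B b := by
  intro h
  rcases a with a | (a | a) <;> rcases b with b | (b | b) <;>
    simp only [tensorTgtLeft, tensorTgtRight, Sum.inl.injEq, Sum.inr.injEq, reduceCtorEq] at h
  · exact castAdd_ne_natAdd _ _ h
  · exact castAdd_ne_natAdd _ _ h

theorem tensorEdge_srcLeft (e) : ∃! t, tensorEdge A B (tensorSrcLeft A B (Sum.inl e)) t := by
  obtain ⟨t, ht, hu⟩ := A.entry_unique e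
  refine ⟨tensorTgtLeft A B t, Or.inl ⟨_, _, ht, rfl, rfl⟩, ?_⟩
  rintro _ (⟨a, b, hab, h1, rfl⟩ | ⟨a, b, hab, h1, rfl⟩)
  · rw [tensorSrcLeft_injective A B h1] at hab
    rw [hu b hab]
  · exact absurd h1.symm (tensorSrc_ne A B _ _)

theorem tensorEdge_srcRight (e) : ∃! t, tensorEdge A B (tensorSrcRight A B (Sum.inl e)) t := by
  obtain ⟨t, ht, hu⟩ := B.entry_unique e
  refine ⟨tensorTgtRight A B t, Or.inr ⟨_, _, ht, rfl, rfl⟩, ?_⟩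
  rintro _ (⟨a, b, hab, h1, rfl⟩ | ⟨a, b, hab, h1, rfl⟩)
  · exact absurd h1 (tensorSrc_ne A B _ _)
  · rw [tensorSrcRight_injective A B h1] at hab
    rw [hu b hab]

theorem tensorEdge_tgtLeft (e) : ∃! s, tensorEdge A B s (tensorTgtLeft A B (Sum.inr e)) := by
  obtain ⟨t, ht, hu⟩ := A.exit_unique e
  refine ⟨tensorSrcLeft A B t, Or.inl ⟨_, _, ht, rfl, rfl⟩, ?_⟩
  rintro _ (⟨a, b, hab, rfl, h1⟩ | ⟨a, b, hab, rfl, h1⟩)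
  · rw [tensorTgtLeft_injective A B h1] at hab
    rw [hu a hab]
  · exact absurd h1.symm (tensorTgt_ne A B _ _)

theorem tensorEdge_tgtRight (e) : ∃! s, tensorEdge A B s (tensorTgtRight A B (Sum.inr e)) := by
  obtain ⟨t, ht, hu⟩ := B.exit_unique e
  refine ⟨tensorSrcRight A B t, Or.inr ⟨_, _, ht, rfl, rfl⟩, ?_⟩
  rintro _ (⟨a, b, hab, rfl, h1⟩ | ⟨a, b, hab, rfl, h1⟩)
  · exact absurd h1 (tensorTgt_ne A B _ _)
  · rw [tensorTgtRight_injective A B h1] at hab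
    rw [hu a hab]

/-- The monoidal product of two games: juxtaposition, the wires of the second game being numbered
after those of the first game in each of the four groups of wires. -/
def tensor : OpenParityGame.{u} M (m₁ + m₂) (n₁ + n₂) where
  V := A.V ⊕ B.V
  finite := by
    have := A.finite
    have := B.finite
    infer_instance
  V₀ := {x | Sum.elim (· ∈ A.V₀) (· ∈ B.V₀) x}
  E := tensorEdge A B
  entry_unique := by
    rintro (i | j)
    · refine Fin.addCases (m := m₁.1) (n := m₂.1) (fun i => ?_) (fun i => ?_) i
      · exact tensorEdge_srcLeft A B (Sum.inl i)
      · exact tensorEdge_srcRight A B (Sum.inl i)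
    · refine Fin.addCases (m := n₁.2) (n := n₂.2) (fun j => ?_) (fun j => ?_) j
      · exact tensorEdge_srcLeft A B (Sum.inr j)
      · exact tensorEdge_srcRight A B (Sum.inr j)
  exit_unique := by
    rintro (j | i)
    · refine Fin.addCases (m := m₁.2) (n := m₂.2) (fun j => ?_) (fun j => ?_) j
      · exact tensorEdge_tgtLeft A B (Sum.inl j)
      · exact tensorEdge_tgtRight A B (Sum.inl j)
    · refine Fin.addCases (m := n₁.1) (n := n₂.1) (fun i => ?_) (fun i => ?_) i
      · exact tensorEdge_tgtLeft A B (Sum.inr i)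
      · exact tensorEdge_tgtRight A B (Sum.inr i)
  prio := Sum.elim A.prio B.prio

end tensor

/-! ### Elementary games -/

/-- The game without internal positions in which entry `e` is joined to exit `f e`. -/
def wiring (M : ℕ) {m n : Obj} (f : Entries m n ≃ Exits m n) : OpenParityGame.{0} M m n where
  V := Empty
  finite := inferInstance
  V₀ := ∅
  E := fun s t =>
    match s, t with
    | Sum.inl e, Sum.inr o => f e = o
    | _, _ => False
  entry_unique := fun e => ⟨Sum.inr (f e), rfl, by
    rintro (t | t) h
    · exact t.elim
    · exact congrArg Sum.inr (Eq.symm h)⟩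
  exit_unique := fun o => ⟨Sum.inl (f.symm o), f.apply_symm_apply o, by
    rintro (s | s) h
    · exact congrArg Sum.inl ((Equiv.eq_symm_apply f).2 h)
    · exact s.elim⟩
  prio := Empty.elim

/-- The identity game. -/
def idGame (M : ℕ) (m : Obj) : OpenParityGame.{0} M m m :=
  wiring M (Equiv.sumComm (Fin m.1) (Fin m.2))

/-- The swap game. `finAddFlip : Fin (a + b) ≃ Fin (b + a)` exchanges the first `a` and the last
`b` elements, preserving the order inside each of the two blocks. -/
def swapGame (M : ℕ) (m n : Obj) : OpenParityGame.{0} M (m + n) (n + m) :=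
  wiring M (((finAddFlip (m := m.1) (n := n.1)).sumCongr
    (finAddFlip (m := n.2) (n := m.2))).trans (Equiv.sumComm _ _))

/-- The game with one internal position `v`, of priority `p`, with an edge from each of its `a`
entry positions to `v` and an edge from `v` to each of its `b` exit positions. -/
def node {M : ℕ} (owner : Set Unit) (p : Fin (M + 1)) (a b : ℕ) :
    OpenParityGame.{0} M (a, 0) (b, 0) where
  V := Unit
  finite := inferInstance
  V₀ := owner
  E := fun s t =>
    match s, t with
    | Sum.inl _, Sum.inl _ => True
    | Sum.inr _, Sum.inr _ => True
    | _, _ => False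
  entry_unique := fun e => ⟨Sum.inl (), trivial, by
    rintro (t | t) h
    · rfl
    · exact h.elim⟩
  exit_unique := fun o => ⟨Sum.inr (), trivial, by
    rintro (t | t) h
    · exact h.elim
    · rfl⟩
  prio := fun _ => p

/-! ## Semantics of open parity games -/

section semantics

variable {m n : Obj} (A : OpenParityGame.{u} M m n)

/-- All positions of a game: entry, internal and exit positions. -/
abbrev Position : Type u := (Entries m n ⊕ A.V) ⊕ Exits m n

/-- The end point of an edge, as a position. -/
def toPosition : A.V ⊕ Exits m n → A.Position
  | Sum.inl x => Sum.inl (Sum.inr x)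
  | Sum.inr o => Sum.inr o

/-- A (history-dependent) strategy for the player owning the internal positions in `P`. Here
`move h x` is the move after the positions in the list `h` have been visited, in this order,
followed by `x`. Only its values at positions `x ∈ P` which have a successor matter. -/
structure Strategy (P : Set A.V) where
  move : List (Entries m n ⊕ A.V) → A.V → A.V ⊕ Exits m n
  legal : ∀ h, ∀ x ∈ P, (∃ t, A.E (Sum.inr x) t) → A.E (Sum.inr x) (move h x)

/-- The target of the unique edge out of an entry position. -/
noncomputable def entryTarget (e : Entries m n) : A.V ⊕ Exits m n :=
  (A.entry_unique e).choose

theorem entryTarget_eq_iff (e : Entries m n) (t : A.V ⊕ Exits m n) :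
    A.entryTarget e = t ↔ A.E (Sum.inl e) t :=
  ⟨fun h => h ▸ (A.entry_unique e).choose_spec.1,
    fun h => (A.entry_unique e).unique (A.entry_unique e).choose_spec.1 h⟩

variable {A}

open Classical in
/-- The successor of the last position of `h ++ [s]`, if there is one: the unique successor of
an entry position, and the choice of its owner for an internal position. -/
noncomputable def nextMove (σ₀ : A.Strategy A.V₀) (σ₁ : A.Strategy A.V₀ᶜ)
    (h : List (Entries m n ⊕ A.V)) : Entries m n ⊕ A.V → Option (A.V ⊕ Exits m n)
  | Sum.inl e => some (A.entryTarget e)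
  | Sum.inr x =>
    if ∃ t, A.E (Sum.inr x) t then
      some (if x ∈ A.V₀ then σ₀.move h x else σ₁.move h x)
    else none

/-- The play induced by two strategies from entry `i`: the value at `k` is the `k`-th position
(counted from 0) together with the list of all earlier positions, or `none` if the play has ended
before. -/
noncomputable def playWithHistory (σ₀ : A.Strategy A.V₀) (σ₁ : A.Strategy A.V₀ᶜ)
    (i : Entries m n) : ℕ → Option (List (Entries m n ⊕ A.V) × A.Position)
  | 0 => some ([], Sum.inl (Sum.inl i))
  | k + 1 =>
    (playWithHistory σ₀ σ₁ i k).bind fun hp =>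
      match hp with
      | (_, Sum.inr _) => none
      | (h, Sum.inl s) => (nextMove σ₀ σ₁ h s).map fun t => (h ++ [s], A.toPosition t)

/-- The sequence of positions of the play induced by two strategies from entry `i`. -/
noncomputable def play (σ₀ : A.Strategy A.V₀) (σ₁ : A.Strategy A.V₀ᶜ) (i : Entries m n)
    (k : ℕ) : Option A.Position :=
  (playWithHistory σ₀ σ₁ i k).map Prod.snd

/-- The possible outcomes of a play. -/
inductive Outcome (M : ℕ) (m n : Obj) : Type
  | exit (o : Exits m n) (k : Fin (M + 1))
  | win
  | lose

/-- The `j`-th position of `p` is an internal position of priority `c`. -/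
def HasPriorityAt (p : ℕ → Option A.Position) (j : ℕ) (c : Fin (M + 1)) : Prop :=
  ∃ x : A.V, p j = some (Sum.inl (Sum.inr x)) ∧ A.prio x = c

/-- `p` is infinite, and `c` is the maximal priority that occurs infinitely often. -/
def IsInfiniteWithLimsup (p : ℕ → Option A.Position) (c : Fin (M + 1)) : Prop :=
  (∀ j, p j ≠ none) ∧
    IsGreatest {c' : Fin (M + 1) | ∃ᶠ j in Filter.atTop, HasPriorityAt p j c'} c

/-- `p` is finite and ends at position `q`. -/
def EndsAt (p : ℕ → Option A.Position) (q : A.Position) : Prop :=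
  ∃ j, p j = some q ∧ p (j + 1) = none

/-- The denotation of a play. A play ending at exit `o` denotes `o` and the maximal priority met
(`0` if it meets no internal position). All other plays are won or lost by Player 0: by the
parity condition if they are infinite, and because the owner of the last position is stuck if they
are finite. -/
def Denotes (p : ℕ → Option A.Position) : Outcome M m n → Prop
  | Outcome.exit o k =>
    EndsAt p (Sum.inr o) ∧ IsLUB {c : Fin (M + 1) | ∃ j, HasPriorityAt p j c} k
  | Outcome.win =>
    (∃ x, x ∉ A.V₀ ∧ EndsAt p (Sum.inl (Sum.inr x))) ∨
      ∃ c, IsInfiniteWithLimsup p c ∧ Even (c : ℕ)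
  | Outcome.lose =>
    (∃ x, x ∈ A.V₀ ∧ EndsAt p (Sum.inl (Sum.inr x))) ∨
      ∃ c, IsInfiniteWithLimsup p c ∧ Odd (c : ℕ)

/-- Some strategy of Player 1 beats the strategy `σ₀` from entry `i`. -/
def Loses (i : Entries m n) (σ₀ : A.Strategy A.V₀) : Prop :=
  ∃ σ₁ : A.Strategy A.V₀ᶜ, Denotes (play σ₀ σ₁ i) Outcome.lose

/-- The pairs (exit, maximal priority) which Player 1 can reach against `σ₀` from entry `i`. -/
def denotation (i : Entries m n) (σ₀ : A.Strategy A.V₀) : Set (Exits m n × Fin (M + 1)) :=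
  {ok | ∃ σ₁ : A.Strategy A.V₀ᶜ, Denotes (play σ₀ σ₁ i) (Outcome.exit ok.1 ok.2)}

variable (A)

/-- The semantics of an open parity game. -/
def semantics : Set (Set (Exits m n × Fin (M + 1)) × Entries m n) :=
  {Ti | ∃ σ₀ : A.Strategy A.V₀, ¬ Loses Ti.2 σ₀ ∧ denotation Ti.2 σ₀ ⊆ Ti.1}

variable {A}

/-- Two games with the same domain and codomain are equivalent if they have the same semantics. -/
def Equivalent (A : OpenParityGame.{u} M m n) (B : OpenParityGame.{v} M m n) : Prop :=
  A.semantics = B.semantics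

end semantics

end OpenParityGame

/-! ## Diagrams -/

/-- The two generating objects `▶` and `◀`. -/
inductive Dir : Type
  | right
  | left

/-- The interpretation of a generating object. -/
def Dir.obj : Dir → Obj
  | Dir.right => (1, 0)
  | Dir.left => (0, 1)

/-- The interpretation of a word of generating objects. -/
def interp : List Dir → Obj
  | [] => 0
  | d :: w => d.obj + interp w

theorem interp_append (w w' : List Dir) : interp (w ++ w') = interp w + interp w' := by
  induction w with
  | nil => simp [interp]
  | cons d w ih => simp [interp, ih, add_assoc]

/-- Every object is the interpretation of some word, and `▶ⁿ` is interpreted as `(n, 0)`. -/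
theorem interp_replicate (a b : ℕ) :
    interp (List.replicate a Dir.right ++ List.replicate b Dir.left) = (a, b) := by
  have h1 : ∀ a, interp (List.replicate a Dir.right) = (a, 0) := by
    intro a
    induction a with
    | zero => rfl
    | succ a ih => simp [List.replicate_succ, interp, ih, Dir.obj, add_comm]
  have h2 : ∀ a, interp (List.replicate a Dir.left) = (0, a) := by
    intro a
    induction a with
    | zero => rfl
    | succ a ih => simp [List.replicate_succ, interp, ih, Dir.obj, add_comm]
  simp [interp_append, h1, h2]

/-- The generating morphisms. -/
inductive Generator (M : ℕ) : List Dir → List Dir → Type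
  | player0 : Generator M [Dir.right] [Dir.right, Dir.right]
  | lose0 : Generator M [Dir.right] []
  | player1 : Generator M [Dir.right] [Dir.right, Dir.right]
  | lose1 : Generator M [Dir.right] []
  | merge : Generator M [Dir.right, Dir.right] [Dir.right]
  | start : Generator M [] [Dir.right]
  | priority (p : Fin (M + 1)) : Generator M [Dir.right] [Dir.right]
  | cap : Generator M [Dir.left, Dir.right] []
  | cup : Generator M [] [Dir.right, Dir.left]

/-- Diagrams, as terms for the morphisms of the free prop on the generators. -/
inductive Diagram (M : ℕ) : List Dir → List Dir → Type
  | gen {v w : List Dir} (g : Generator M v w) : Diagram M v w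
  | id (w : List Dir) : Diagram M w w
  | swap (v w : List Dir) : Diagram M (v ++ w) (w ++ v)
  | comp {u v w : List Dir} (c : Diagram M u v) (d : Diagram M v w) : Diagram M u w
  | tensor {v₁ w₁ v₂ w₂ : List Dir} (c : Diagram M v₁ w₁) (d : Diagram M v₂ w₂) :
      Diagram M (v₁ ++ v₂) (w₁ ++ w₂)

open OpenParityGame in
/-- The interpretation of the generators. -/
def Generator.sem {M : ℕ} : {v w : List Dir} → Generator M v w →
    OpenParityGame.{0} M (interp v) (interp w)
  | _, _, player0 => node Set.univ 0 1 2
  | _, _, lose0 => node Set.univ 0 1 0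
  | _, _, player1 => node ∅ 0 1 2
  | _, _, lose1 => node ∅ 0 1 0
  | _, _, merge => node ∅ 0 2 1
  | _, _, start => node ∅ 0 0 1
  | _, _, priority p => node ∅ p 1 1
  | _, _, cap => wiring M (m := (1, 1)) (n := (0, 0)) (Equiv.refl (Fin 1 ⊕ Fin 0))
  | _, _, cup => wiring M (m := (0, 0)) (n := (1, 1)) (Equiv.refl (Fin 0 ⊕ Fin 1))

/-- The interpretation of a diagram as an open parity game. -/
def Diagram.sem {M : ℕ} : {v w : List Dir} → Diagram M v w →
    OpenParityGame.{0} M (interp v) (interp w)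
  | _, _, gen g => g.sem
  | _, _, id w => OpenParityGame.idGame M (interp w)
  | _, _, swap v w =>
    (OpenParityGame.swapGame M (interp v) (interp w)).cast
      (interp_append v w).symm (interp_append w v).symm
  | _, _, comp c d => c.sem.comp d.sem
  | _, _, @tensor _ v₁ w₁ v₂ w₂ c d =>
    (c.sem.tensor d.sem).cast (interp_append v₁ v₂).symm (interp_append w₁ w₂).symm

end ParityGames

open ParityGames

/-!
Every internal position can be replaced by a chain of positions of the shapes of the generators: a
start, one binary merge per incoming edge, a position carrying the priority, one binary choice per
outgoing edge and a losing position. The new positions have priority `0` and a chain is left after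
finitely many steps, so they change neither the largest priority of a play nor the largest priority
occurring infinitely often; a player who declines every choice of a chain loses, as one who has no
successor does. To compare the semantics of two games it suffices to transform winning strategies,
presented as graphs lying over the game.

After the replacement every port of every position carries exactly one edge, so the game is a net:
a bijection between the ports of its positions and of its interface. A cup or a cap turns wires of
the codomain into wires of the domain, hence all generators and the whole game may be assumed to
have all their wires on one side. Positions are then pulled out of the net one at a time, until
only a perfect matching of wires of opposite directions is left, which swaps and caps realize.
-/

universe w

namespace ParityGames

/-! ### Strategy graphs -/

section ParityCondition

variable {N : Type*} {M : ℕ} (step : N → N → Prop) (prio : N → Fin (M + 1))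

/-- A step out of a node of priority at most `k`. -/
def StepLE (k : Fin (M + 1)) (a b : N) : Prop :=
  step a b ∧ prio a ≤ k

/-- A nonempty path between two nodes of priority `k` along which `k` is the largest priority. -/
def Descends (k : Fin (M + 1)) (a b : N) : Prop :=
  prio a = k ∧ prio b = k ∧ Relation.TransGen (StepLE step prio k) a b

/-- The parity condition on a graph with priorities: the largest priority occurring infinitely
often on an infinite path is even. It is encoded by well-foundedness, so that strategies can be
compared without mentioning infinite paths. -/
def SatisfiesParity : Prop :=
  ∀ k : Fin (M + 1), Odd (k : ℕ) → WellFounded (flip (Descends step prio k))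

variable {step prio}

theorem SatisfiesParity.of_descends {N' : Type*} {step' : N' → N' → Prop}
    {prio' : N' → Fin (M + 1)} (h : SatisfiesParity step prio) (f : N' → N)
    (hf : ∀ k : Fin (M + 1), Odd (k : ℕ) → ∀ a b,
      Descends step' prio' k a b → Descends step prio k (f a) (f b)) :
    SatisfiesParity step' prio' := fun k hk =>
  Subrelation.wf (fun {a b} hab => hf k hk b a hab) (InvImage.wf f (h k hk))

theorem SatisfiesParity.not_frequently {c : ℕ → N} (h : SatisfiesParity step prio)
    (hc : ∀ j, step (c j) (c (j + 1))) {k : Fin (M + 1)} (hk : Odd (k : ℕ))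
    (hle : ∀ᶠ j in Filter.atTop, prio (c j) ≤ k) :
    ¬ ∃ᶠ j in Filter.atTop, prio (c j) = k := by
  intro hfreq
  obtain ⟨K, hK⟩ := Filter.eventually_atTop.1 hle
  obtain ⟨j₀, hj₀, hprio₀⟩ := Filter.frequently_atTop.1 hfreq K
  obtain ⟨_, ⟨j, hj, hprio, rfl⟩, hmin⟩ :=
    (h k hk).has_min {a | ∃ j, K ≤ j ∧ prio (c j) = k ∧ c j = a} ⟨_, j₀, hj₀, hprio₀, rfl⟩
  obtain ⟨j', hj', hprio'⟩ := Filter.frequently_atTop.1 hfreq (j + 1)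
  refine hmin _ ⟨j', by lia, hprio', rfl⟩ ⟨hprio, hprio', ?_⟩
  exact Nat.rel_of_forall_rel_succ_of_le_of_lt _
    (fun l hl => .single ⟨hc l, hK l hl⟩) hj (Nat.lt_of_succ_le hj')

end ParityCondition

namespace OpenParityGame

variable {M : ℕ} {m n : Obj} (A : OpenParityGame.{u} M m n)

/-- The priority of a position; entries and exits get the neutral value `0`. -/
def posPrio : A.Position → Fin (M + 1)
  | Sum.inl (Sum.inr x) => A.prio x
  | _ => 0

/-- The edge relation, on positions. -/
def Move (p q : A.Position) : Prop :=
  ∃ s t, A.E s t ∧ p = Sum.inl s ∧ q = A.toPosition t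

/-- The positions of Player 0. -/
def zeroPositions : Set A.Position :=
  (fun x => Sum.inl (Sum.inr x)) '' A.V₀

variable {A}

theorem toPosition_injective : Function.Injective A.toPosition := by
  rintro (x | o) (y | o') h <;> simp_all [toPosition]

theorem toPosition_ne_entry (t : A.V ⊕ Exits m n) (e : Entries m n) :
    A.toPosition t ≠ Sum.inl (Sum.inl e) := by
  cases t <;> simp [toPosition]

theorem move_inl_toPosition {s : Entries m n ⊕ A.V} {t : A.V ⊕ Exits m n} :
    A.Move (Sum.inl s) (A.toPosition t) ↔ A.E s t := by
  refine ⟨?_, fun h => ⟨s, t, h, rfl, rfl⟩⟩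
  rintro ⟨s', t', h, hs, ht⟩
  rwa [Sum.inl.inj hs, toPosition_injective ht]

/-! ### Outcomes of plays -/

section Outcomes

variable {p : ℕ → Option A.Position} {ρ : ℕ → A.Position}

theorem hasPriorityAt_iff {j : ℕ} {q : A.Position} (hq : p j = some q) {c : Fin (M + 1)}
    (hc : c ≠ 0) : HasPriorityAt p j c ↔ A.posPrio q = c := by
  rcases q with (e | x) | o <;> simp [HasPriorityAt, hq, posPrio, hc.symm]

theorem HasPriorityAt.posPrio_eq {j : ℕ} {q : A.Position} (hq : p j = some q) {c : Fin (M + 1)}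
    (h : HasPriorityAt p j c) : A.posPrio q = c := by
  obtain ⟨x, hx, rfl⟩ := h
  cases hq.symm.trans hx
  rfl

theorem isInfiniteWithLimsup_iff (hp : ∀ j, p j = some (ρ j)) {k : Fin (M + 1)} (hk : k ≠ 0) :
    IsInfiniteWithLimsup p k ↔ (∀ᶠ j in Filter.atTop, A.posPrio (ρ j) ≤ k) ∧
      ∃ᶠ j in Filter.atTop, A.posPrio (ρ j) = k := by
  have hfreq : (∃ᶠ j in Filter.atTop, HasPriorityAt p j k) ↔
      ∃ᶠ j in Filter.atTop, A.posPrio (ρ j) = k := by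
    simp only [hasPriorityAt_iff (hp _) hk]
  refine ⟨fun ⟨_, hmem, hub⟩ => ⟨?_, hfreq.1 hmem⟩, fun ⟨hle, hmem⟩ =>
    ⟨fun j => by simp [hp], hfreq.2 hmem, fun c hc => ?_⟩⟩
  · have hne : ∀ c > k, ∀ᶠ j in Filter.atTop, A.posPrio (ρ j) ≠ c := fun c hc => by
      have hc0 : c ≠ 0 := ((Fin.zero_le _).trans_lt hc).ne'
      have hnot : ∀ᶠ j in Filter.atTop, ¬ HasPriorityAt p j c :=
        Filter.not_frequently.1 fun h => (hub h).not_gt hc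
      simpa only [hasPriorityAt_iff (hp _) hc0] using hnot
    filter_upwards [Filter.eventually_all.2 fun c => Filter.eventually_all.2 (hne c)] with j hj
    exact not_lt.1 fun hlt => hj _ hlt rfl
  · obtain ⟨j, hj, hjle⟩ := (hc.and_eventually hle).exists
    exact hj.posPrio_eq (hp j) ▸ hjle

theorem isLUB_priorities_iff {K : ℕ} {o : Exits m n} (hp : ∀ j ≤ K, p j = some (ρ j))
    (hρ : ρ K = Sum.inr o) (hnone : ∀ j, K < j → p j = none) {k : Fin (M + 1)} :
    IsLUB {c : Fin (M + 1) | ∃ j, HasPriorityAt p j c} k ↔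
      k = (Finset.range K).sup fun j => A.posPrio (ρ j) := by
  have hlub : IsLUB {c : Fin (M + 1) | ∃ j, HasPriorityAt p j c}
      ((Finset.range K).sup fun j => A.posPrio (ρ j)) := by
    constructor
    · rintro c ⟨j, hj⟩
      rcases lt_trichotomy j K with hlt | rfl | hgt
      · exact hj.posPrio_eq (hp j hlt.le) ▸
          Finset.le_sup (f := fun j => A.posPrio (ρ j)) (Finset.mem_range.2 hlt)
      · rw [← hj.posPrio_eq (hp j le_rfl), hρ]
        exact Fin.zero_le _
      · obtain ⟨x, hx, -⟩ := hj
        simp [hnone j hgt] at hx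
    · intro b hb
      refine Finset.sup_le fun j hj => ?_
      by_cases h0 : A.posPrio (ρ j) = 0
      · rw [h0]
        exact Fin.zero_le _
      · exact hb ⟨j, (hasPriorityAt_iff (hp j (Finset.mem_range.1 hj).le) h0).2 rfl⟩
  exact ⟨fun h => h.unique hlub, fun h => h ▸ hlub⟩

end Outcomes

/-! ### Plays -/

section Plays

variable {σ₀ : A.Strategy A.V₀} {σ₁ : A.Strategy A.V₀ᶜ} {i : Entries m n}

theorem playWithHistory_succ {k : ℕ} {h : List (Entries m n ⊕ A.V)} {s : Entries m n ⊕ A.V}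
    (hk : playWithHistory σ₀ σ₁ i k = some (h, Sum.inl s)) :
    playWithHistory σ₀ σ₁ i (k + 1) =
      (nextMove σ₀ σ₁ h s).map fun t => (h ++ [s], A.toPosition t) := by
  simp [playWithHistory, hk]

theorem playWithHistory_succ_eq_some {k : ℕ} {h' : List (Entries m n ⊕ A.V)} {q : A.Position}
    (hk : playWithHistory σ₀ σ₁ i (k + 1) = some (h', q)) :
    ∃ h s t, playWithHistory σ₀ σ₁ i k = some (h, Sum.inl s) ∧ nextMove σ₀ σ₁ h s = some t ∧
      h' = h ++ [s] ∧ q = A.toPosition t := by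
  obtain ⟨⟨h, s | o⟩, hh, ht⟩ := Option.bind_eq_some_iff.1 hk
  · obtain ⟨t, ht, heq⟩ := Option.map_eq_some_iff.1 ht
    exact ⟨h, s, t, hh, ht, (congrArg Prod.fst heq).symm, (congrArg Prod.snd heq).symm⟩
  · cases ht

theorem edge_of_nextMove_eq_some {h : List (Entries m n ⊕ A.V)} {s : Entries m n ⊕ A.V}
    {t : A.V ⊕ Exits m n} (hs : nextMove σ₀ σ₁ h s = some t) : A.E s t := by
  rcases s with e | x
  · exact (A.entryTarget_eq_iff e t).1 (Option.some.inj hs)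
  · simp only [nextMove, Option.ite_none_right_eq_some, Option.some.injEq] at hs
    obtain ⟨hx, rfl⟩ := hs
    split_ifs with hx₀
    · exact σ₀.legal h x hx₀ hx
    · exact σ₁.legal h x hx₀ hx

theorem nextMove_ne_none {h : List (Entries m n ⊕ A.V)} {s : Entries m n ⊕ A.V}
    {t : A.V ⊕ Exits m n} (hs : A.E s t) : nextMove σ₀ σ₁ h s ≠ none := by
  rcases s with e | x
  · simp [nextMove]
  · simp [nextMove, show ∃ t, A.E (Sum.inr x) t from ⟨t, hs⟩]

theorem play_succ_ne_none {k : ℕ} {p q : A.Position} (hp : play σ₀ σ₁ i k = some p)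
    (hpq : A.Move p q) : play σ₀ σ₁ i (k + 1) ≠ none := by
  obtain ⟨s, t, hst, rfl, rfl⟩ := hpq
  obtain ⟨⟨h, _⟩, hk, rfl⟩ := Option.map_eq_some_iff.1 hp
  simpa [play, playWithHistory_succ hk] using nextMove_ne_none hst

theorem play_eq_none_of_le {k l : ℕ} (hkl : k ≤ l) (hk : play σ₀ σ₁ i k = none) :
    play σ₀ σ₁ i l = none := by
  induction l, hkl using Nat.le_induction with
  | base => exact hk
  | succ l _ ih =>
    rw [play, Option.map_eq_none_iff] at ih ⊢
    simp [playWithHistory, ih]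

theorem exists_play_eq_some {K : ℕ} (hK : play σ₀ σ₁ i K ≠ none) :
    ∃ ρ : ℕ → A.Position, ∀ j ≤ K, play σ₀ σ₁ i j = some (ρ j) := by
  refine ⟨fun j => (play σ₀ σ₁ i j).getD (Sum.inl (Sum.inl i)), fun j hj => ?_⟩
  obtain ⟨q, hq⟩ := Option.ne_none_iff_exists'.1 fun h => hK (play_eq_none_of_le hj h)
  simp [hq]

end Plays

/-- A nondeterministic winning strategy of Player 0 from entry `i` with exits in `T`, presented as
a graph lying over the game, with memory. The number `acc c` is the largest priority met strictly
before the node `c`. A pair `(T, i)` belongs to the semantics iff there is such a graph. -/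
structure StrategyGraph (A : OpenParityGame.{u} M m n) (T : Set (Exits m n × Fin (M + 1)))
    (i : Entries m n) where
  Node : Type w
  root : Node
  pos : Node → A.Position
  acc : Node → Fin (M + 1)
  step : Node → Node → Prop
  pos_root : pos root = Sum.inl (Sum.inl i)
  acc_root : acc root = 0
  move_of_step {c c' : Node} : step c c' → A.Move (pos c) (pos c')
  acc_of_step {c c' : Node} : step c c' → acc c' = acc c ⊔ A.posPrio (pos c)
  exists_step_of_zero {c : Node} : pos c ∈ A.zeroPositions → ∃ c', step c c'
  exists_step_of_move {c : Node} {q : A.Position} :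
    pos c ∉ A.zeroPositions → A.Move (pos c) q → ∃ c', step c c' ∧ pos c' = q
  mem_of_exit {c : Node} {o : Exits m n} : pos c = Sum.inr o → (o, acc c) ∈ T
  parity : SatisfiesParity step fun c => A.posPrio (pos c)

namespace StrategyGraph

variable {T : Set (Exits m n × Fin (M + 1))} {i : Entries m n}
  (S : StrategyGraph.{u, w} A T i)

theorem acc_eq_sup {c : ℕ → S.Node} (h0 : c 0 = S.root) {K : ℕ}
    (hc : ∀ j < K, S.step (c j) (c (j + 1))) :
    S.acc (c K) = (Finset.range K).sup fun j => A.posPrio (S.pos (c j)) := by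
  induction K with
  | zero => simp [h0, S.acc_root, bot_eq_zero]
  | succ K ih =>
    rw [S.acc_of_step (hc K K.lt_succ_self), ih fun j hj => hc j (hj.trans K.lt_succ_self),
      Finset.range_add_one, Finset.sup_insert, sup_comm]

/-! Soundness: a strategy graph is determinised along the history of the play. -/

open Classical in
/-- A successor of `c` at position `q`, or `c` itself if there is none. -/
noncomputable def next (c : S.Node) (q : A.Position) : S.Node :=
  if h : ∃ c', S.step c c' ∧ S.pos c' = q then h.choose else c

/-- The node reached from the root by following a list of positions. The first position of a play
is an entry, on which the root stays put. -/
noncomputable def nodeAfter (l : List A.Position) : S.Node :=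
  l.foldl S.next S.root

variable {S}

theorem next_spec {c : S.Node} {q : A.Position} (h : ∃ c', S.step c c' ∧ S.pos c' = q) :
    S.step c (S.next c q) ∧ S.pos (S.next c q) = q := by
  rw [next, dif_pos h]
  exact h.choose_spec

theorem nodeAfter_concat (l : List A.Position) (q : A.Position) :
    S.nodeAfter (l ++ [q]) = S.next (S.nodeAfter l) q := by
  simp [nodeAfter]

theorem nodeAfter_entry : S.nodeAfter [Sum.inl (Sum.inl i)] = S.root := by
  refine dif_neg ?_
  rintro ⟨c, hc, hpos⟩
  obtain ⟨s, t, -, -, ht⟩ := S.move_of_step hc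
  exact toPosition_ne_entry t i (ht.symm.trans hpos)

variable (S) in
/-- The strategy `σ₀` moves along the steps of `S`, the node being determined by the history. -/
def Induces (σ₀ : A.Strategy A.V₀) : Prop :=
  ∀ (h : List (Entries m n ⊕ A.V)), ∀ x ∈ A.V₀,
    let c := S.nodeAfter ((h ++ [Sum.inr x]).map Sum.inl)
    S.pos c = Sum.inl (Sum.inr x) → ∃ c', S.step c c' ∧ S.pos c' = A.toPosition (σ₀.move h x)

variable (S) in
theorem exists_induces : ∃ σ₀ : A.Strategy A.V₀, S.Induces σ₀ := by
  have hmove : ∀ (h : List (Entries m n ⊕ A.V)) (x : A.V), ∃ t : A.V ⊕ Exits m n,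
      ((∃ t', A.E (Sum.inr x) t') → A.E (Sum.inr x) t) ∧
      (x ∈ A.V₀ → let c := S.nodeAfter ((h ++ [Sum.inr x]).map Sum.inl)
        S.pos c = Sum.inl (Sum.inr x) → ∃ c', S.step c c' ∧ S.pos c' = A.toPosition t) := by
    intro h x
    set c := S.nodeAfter ((h ++ [Sum.inr x]).map Sum.inl)
    by_cases hx : x ∈ A.V₀ ∧ S.pos c = Sum.inl (Sum.inr x)
    · obtain ⟨c', hc'⟩ := S.exists_step_of_zero (c := c) ⟨x, hx.1, hx.2.symm⟩
      obtain ⟨s, t, hst, hs, ht⟩ := S.move_of_step hc'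
      obtain rfl : Sum.inr x = s := Sum.inl.inj (hx.2.symm.trans hs)
      exact ⟨t, fun _ => hst, fun _ _ => ⟨c', hc', ht⟩⟩
    · by_cases hsucc : ∃ t', A.E (Sum.inr x) t'
      · exact ⟨hsucc.choose, fun _ => hsucc.choose_spec, fun hx₀ hpos => absurd ⟨hx₀, hpos⟩ hx⟩
      · exact ⟨Sum.inl x, fun h => absurd h hsucc, fun hx₀ hpos => absurd ⟨hx₀, hpos⟩ hx⟩
  choose move hlegal hstep using hmove
  exact ⟨⟨move, fun h x _ => hlegal h x⟩, hstep⟩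

section Outcomes

variable {σ₀ : A.Strategy A.V₀} {σ₁ : A.Strategy A.V₀ᶜ} {c : ℕ → S.Node}

theorem Induces.next_spec_of_nextMove (hσ₀ : S.Induces σ₀) {h : List (Entries m n ⊕ A.V)}
    {s : Entries m n ⊕ A.V} {t : A.V ⊕ Exits m n} (ht : nextMove σ₀ σ₁ h s = some t)
    {c : S.Node} (hc : c = S.nodeAfter ((h ++ [s]).map Sum.inl)) (hpos : S.pos c = Sum.inl s) :
    S.step c (S.next c (A.toPosition t)) ∧
      S.pos (S.next c (A.toPosition t)) = A.toPosition t := by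
  apply next_spec
  by_cases h₀ : S.pos c ∈ A.zeroPositions
  · obtain ⟨x, hx, hxs⟩ := h₀
    obtain rfl : Sum.inr x = s := Sum.inl.inj (hxs.trans hpos)
    simp only [nextMove, hx, if_true, Option.ite_none_right_eq_some, Option.some.injEq] at ht
    obtain ⟨-, rfl⟩ := ht
    subst hc
    exact hσ₀ h x hx hpos
  · exact S.exists_step_of_move h₀ (hpos ▸ move_inl_toPosition.2 (edge_of_nextMove_eq_some ht))

theorem Induces.exists_trace (hσ₀ : S.Induces σ₀) (σ₁ : A.Strategy A.V₀ᶜ) :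
    ∃ c : ℕ → S.Node, c 0 = S.root ∧ (∀ k q, play σ₀ σ₁ i k = some q → S.pos (c k) = q) ∧
      ∀ k, play σ₀ σ₁ i (k + 1) ≠ none → S.step (c k) (c (k + 1)) := by
  let c (k : ℕ) : S.Node :=
    (playWithHistory σ₀ σ₁ i k).elim S.root fun hq => S.nodeAfter (hq.1.map Sum.inl ++ [hq.2])
  have hstep : ∀ {k h s t}, playWithHistory σ₀ σ₁ i k = some (h, Sum.inl s) →
      nextMove σ₀ σ₁ h s = some t → S.pos (c k) = Sum.inl s →
      S.step (c k) (c (k + 1)) ∧ S.pos (c (k + 1)) = A.toPosition t := by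
    intro k h s t hk ht hpos
    have hck : c k = S.nodeAfter ((h ++ [s]).map Sum.inl) := by simp [c, hk]
    have hck' : c (k + 1) = S.next (c k) (A.toPosition t) := by
      rw [hck, ← nodeAfter_concat]
      simp [c, playWithHistory_succ hk, ht]
    exact hck' ▸ hσ₀.next_spec_of_nextMove ht hck hpos
  have hpos : ∀ k h q, playWithHistory σ₀ σ₁ i k = some (h, q) → S.pos (c k) = q := by
    intro k
    induction k with
    | zero =>
      rintro h q hk
      cases hk
      exact (congrArg S.pos nodeAfter_entry).trans S.pos_root
    | succ k ih =>
      intro h q hk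
      obtain ⟨h', s, t, hk', ht, -, rfl⟩ := playWithHistory_succ_eq_some hk
      exact (hstep hk' ht (ih _ _ hk')).2
  refine ⟨c, nodeAfter_entry, fun k q hq => ?_, fun k hk => ?_⟩
  · obtain ⟨⟨h, _⟩, hk, rfl⟩ := Option.map_eq_some_iff.1 hq
    exact hpos k h _ hk
  · rw [play, Ne, Option.map_eq_none_iff] at hk
    obtain ⟨⟨h, q⟩, hk⟩ := Option.ne_none_iff_exists'.1 hk
    obtain ⟨h', s, t, hk', ht, -, -⟩ := playWithHistory_succ_eq_some hk
    exact (hstep hk' ht (hpos k _ _ hk')).1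

theorem not_denotes_lose (hpos : ∀ k q, play σ₀ σ₁ i k = some q → S.pos (c k) = q)
    (hstep : ∀ k, play σ₀ σ₁ i (k + 1) ≠ none → S.step (c k) (c (k + 1))) :
    ¬ Denotes (play σ₀ σ₁ i) Outcome.lose := by
  rintro (⟨x, hx, j, hj, hend⟩ | ⟨k, hlim, hodd⟩)
  · obtain ⟨c', hc'⟩ := S.exists_step_of_zero (c := c j) ⟨x, hx, (hpos j _ hj).symm⟩
    exact play_succ_ne_none hj (hpos j _ hj ▸ S.move_of_step hc') hend
  · have hplay : ∀ j, play σ₀ σ₁ i j = some (S.pos (c j)) := fun j => by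
      obtain ⟨q, hq⟩ := Option.ne_none_iff_exists'.1 (hlim.1 j)
      rw [hq, hpos j q hq]
    have hk : k ≠ 0 := by
      rintro rfl
      simp at hodd
    obtain ⟨hle, hfreq⟩ := (isInfiniteWithLimsup_iff hplay hk).1 hlim
    exact S.parity.not_frequently (fun j => hstep j (hlim.1 _)) hodd hle hfreq

theorem mem_of_denotes_exit (h0 : c 0 = S.root)
    (hpos : ∀ k q, play σ₀ σ₁ i k = some q → S.pos (c k) = q)
    (hstep : ∀ k, play σ₀ σ₁ i (k + 1) ≠ none → S.step (c k) (c (k + 1)))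
    {o : Exits m n} {k : Fin (M + 1)} (h : Denotes (play σ₀ σ₁ i) (Outcome.exit o k)) :
    (o, k) ∈ T := by
  obtain ⟨⟨K, hK, hend⟩, hlub⟩ := h
  obtain ⟨ρ, hρ⟩ := exists_play_eq_some (hK ▸ Option.some_ne_none _ : play σ₀ σ₁ i K ≠ none)
  have hplay : ∀ j ≤ K, play σ₀ σ₁ i j = some (S.pos (c j)) := fun j hj => by
    rw [hρ j hj, hpos j _ (hρ j hj)]
  have hsteps : ∀ j < K, S.step (c j) (c (j + 1)) := fun j hj =>
    hstep j (hplay (j + 1) hj ▸ Option.some_ne_none _)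
  have hexit := hpos K _ hK
  rw [isLUB_priorities_iff (ρ := fun j => S.pos (c j)) hplay hexit
    (fun j hj => play_eq_none_of_le hj hend), ← S.acc_eq_sup h0 hsteps] at hlub
  exact hlub ▸ S.mem_of_exit hexit

end Outcomes

theorem mem_semantics (S : StrategyGraph.{u, w} A T i) : (T, i) ∈ A.semantics := by
  obtain ⟨σ₀, hσ₀⟩ := S.exists_induces
  refine ⟨σ₀, ?_, ?_⟩
  · rintro ⟨σ₁, hlose⟩
    obtain ⟨c, -, hpos, hstep⟩ := hσ₀.exists_trace σ₁
    exact not_denotes_lose hpos hstep hlose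
  · rintro ⟨o, k⟩ ⟨σ₁, hexit⟩
    obtain ⟨c, h0, hpos, hstep⟩ := hσ₀.exists_trace σ₁
    exact mem_of_denotes_exit h0 hpos hstep hexit

end StrategyGraph

/-! Completeness: the finite plays consistent with a winning strategy form a strategy graph. -/

/-- The first `k` positions of `ρ`, in the format in which strategies read the history. -/
def history (ρ : ℕ → A.Position) (k : ℕ) : List (Entries m n ⊕ A.V) :=
  (List.range k).filterMap fun j => (ρ j).getLeft?

theorem history_succ {ρ : ℕ → A.Position} {k : ℕ} {s : Entries m n ⊕ A.V}
    (hk : ρ k = Sum.inl s) : history ρ (k + 1) = history ρ k ++ [s] := by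
  simp [history, List.range_succ, hk]

theorem history_congr {ρ ρ' : ℕ → A.Position} {k : ℕ} (h : ∀ j < k, ρ j = ρ' j) :
    history ρ k = history ρ' k :=
  List.filterMap_congr fun j hj => by rw [h j (List.mem_range.1 hj)]

/-- The first `K` moves of `ρ` form a play from entry `i` in which Player 0 follows `σ₀`. -/
structure IsPlay (σ₀ : A.Strategy A.V₀) (i : Entries m n) (ρ : ℕ → A.Position) (K : ℕ) :
    Prop where
  start : ρ 0 = Sum.inl (Sum.inl i)
  move : ∀ j < K, A.Move (ρ j) (ρ (j + 1))
  consistent : ∀ j < K, ∀ x ∈ A.V₀, ρ j = Sum.inl (Sum.inr x) →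
    ρ (j + 1) = A.toPosition (σ₀.move (history ρ j) x)

namespace IsPlay

variable {σ₀ : A.Strategy A.V₀} {i : Entries m n} {ρ ρ' : ℕ → A.Position} {K : ℕ}

theorem mono (h : IsPlay σ₀ i ρ K) {L : ℕ} (hL : L ≤ K) : IsPlay σ₀ i ρ L :=
  ⟨h.start, fun j hj => h.move j (hj.trans_le hL), fun j hj => h.consistent j (hj.trans_le hL)⟩

theorem congr (h : IsPlay σ₀ i ρ K) (heq : ∀ j ≤ K, ρ j = ρ' j) : IsPlay σ₀ i ρ' K where
  start := heq 0 K.zero_le ▸ h.start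
  move j hj := heq j hj.le ▸ heq (j + 1) hj ▸ h.move j hj
  consistent j hj x hx hjx := by
    rw [← heq (j + 1) hj, ← history_congr fun l hl => heq l (hl.le.trans hj.le)]
    exact h.consistent j hj x hx (heq j hj.le ▸ hjx)

theorem length_history (h : IsPlay σ₀ i ρ K) : (history ρ K).length = K := by
  induction K with
  | zero => rfl
  | succ K ih =>
    obtain ⟨s, -, -, hs, -⟩ := h.move K K.lt_succ_self
    simp [history_succ hs, ih (h.mono K.le_succ)]

theorem update (h : IsPlay σ₀ i ρ K) {q : A.Position} (hq : A.Move (ρ K) q)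
    (hcons : ∀ x ∈ A.V₀, ρ K = Sum.inl (Sum.inr x) →
      q = A.toPosition (σ₀.move (history ρ K) x)) :
    IsPlay σ₀ i (Function.update ρ (K + 1) q) (K + 1) := by
  have hne : ∀ {j}, j ≤ K → Function.update ρ (K + 1) q j = ρ j := fun hj =>
    Function.update_of_ne (by lia) _ _
  have hK := h.congr fun j hj => (hne hj).symm
  have hlast : Function.update ρ (K + 1) q (K + 1) = q := Function.update_self ..
  refine ⟨hK.start, fun j hj => ?_, fun j hj x hx hjx => ?_⟩
  · rcases Nat.lt_succ_iff_lt_or_eq.1 hj with hj | rfl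
    · exact hK.move j hj
    · rwa [hlast, hne le_rfl]
  · rcases Nat.lt_succ_iff_lt_or_eq.1 hj with hj | rfl
    · exact hK.consistent j hj x hx hjx
    · rw [hlast, history_congr fun l hl => hne (Nat.le_of_lt hl)]
      exact hcons x hx (hne le_rfl ▸ hjx)

end IsPlay

theorem exists_strategy_following (P : Set A.V) (ρ : ℕ → A.Position) :
    ∃ σ : A.Strategy P, ∀ h x t, A.E (Sum.inr x) t → A.toPosition t = ρ (h.length + 1) →
      σ.move h x = t := by
  have hmove : ∀ (h : List (Entries m n ⊕ A.V)) (x : A.V), ∃ t : A.V ⊕ Exits m n,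
      ((∃ t', A.E (Sum.inr x) t') → A.E (Sum.inr x) t) ∧
      ∀ t', A.E (Sum.inr x) t' → A.toPosition t' = ρ (h.length + 1) → t = t' := by
    intro h x
    by_cases hfollow : ∃ t, A.E (Sum.inr x) t ∧ A.toPosition t = ρ (h.length + 1)
    · obtain ⟨t, ht, heq⟩ := hfollow
      exact ⟨t, fun _ => ht, fun t' _ heq' => toPosition_injective (heq.trans heq'.symm)⟩
    · by_cases hsucc : ∃ t', A.E (Sum.inr x) t'
      · exact ⟨hsucc.choose, fun _ => hsucc.choose_spec,
          fun t' ht' heq => absurd ⟨t', ht', heq⟩ hfollow⟩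
      · exact ⟨Sum.inl x, fun h => absurd h hsucc, fun t' ht' _ => absurd ⟨t', ht'⟩ hsucc⟩
  choose move hlegal hfollow using hmove
  exact ⟨⟨move, fun h x _ => hlegal h x⟩, hfollow⟩

section Completeness

variable {σ₀ : A.Strategy A.V₀} {i : Entries m n}

theorem exists_playWithHistory_eq (σ₀ : A.Strategy A.V₀) (i : Entries m n)
    (ρ : ℕ → A.Position) : ∃ σ₁ : A.Strategy A.V₀ᶜ, ∀ K, IsPlay σ₀ i ρ K →
      playWithHistory σ₀ σ₁ i K = some (history ρ K, ρ K) := by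
  obtain ⟨σ₁, hσ₁⟩ := exists_strategy_following A.V₀ᶜ ρ
  refine ⟨σ₁, fun K h => ?_⟩
  induction K with
  | zero => exact congrArg some (Prod.ext rfl h.start.symm)
  | succ K ih =>
    have hK := h.mono K.le_succ
    obtain ⟨s, t, hst, hs, ht⟩ := h.move K K.lt_succ_self
    have hnext : nextMove σ₀ σ₁ (history ρ K) s = some t := by
      rcases s with e | x
      · exact congrArg some ((A.entryTarget_eq_iff e t).2 hst)
      · rw [nextMove, if_pos ⟨t, hst⟩]
        split_ifs with hx
        · exact congrArg some (toPosition_injective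
            ((h.consistent K K.lt_succ_self x hx hs).symm.trans ht))
        · exact congrArg some (hσ₁ _ x t hst (by rw [hK.length_history, ht]))
    rw [playWithHistory_succ (hs ▸ ih hK), hnext, Option.map_some, history_succ hs, ht]

theorem IsPlay.exists_play_eq {ρ : ℕ → A.Position} {K : ℕ} {o : Exits m n}
    (h : IsPlay σ₀ i ρ K) (ho : ρ K = Sum.inr o) :
    ∃ σ₁ : A.Strategy A.V₀ᶜ, (∀ j ≤ K, play σ₀ σ₁ i j = some (ρ j)) ∧
      ∀ j, K < j → play σ₀ σ₁ i j = none := by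
  obtain ⟨σ₁, hσ₁⟩ := exists_playWithHistory_eq σ₀ i ρ
  refine ⟨σ₁, fun j hj => by simp [play, hσ₁ j (h.mono hj)], fun j hj =>
    play_eq_none_of_le (Nat.succ_le_of_lt hj) ?_⟩
  simp [play, playWithHistory, hσ₁ K h, ho]

theorem IsPlay.mem_denotation {ρ : ℕ → A.Position} {K : ℕ} {o : Exits m n}
    (h : IsPlay σ₀ i ρ K) (ho : ρ K = Sum.inr o) :
    (o, (Finset.range K).sup fun j => A.posPrio (ρ j)) ∈ denotation i σ₀ := by
  obtain ⟨σ₁, hplay, hnone⟩ := h.exists_play_eq ho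
  exact ⟨σ₁, ⟨K, (hplay K le_rfl).trans (congrArg some ho), hnone _ K.lt_succ_self⟩,
    (isLUB_priorities_iff hplay ho hnone).2 rfl⟩

theorem loses_of_stuck {ρ : ℕ → A.Position} {K : ℕ} {x : A.V} (h : IsPlay σ₀ i ρ K)
    (hx : x ∈ A.V₀) (hρ : ρ K = Sum.inl (Sum.inr x)) (hstuck : ∀ t, ¬ A.E (Sum.inr x) t) :
    Loses i σ₀ := by
  obtain ⟨σ₁, hσ₁⟩ := exists_playWithHistory_eq σ₀ i ρ
  have hK := hρ ▸ hσ₁ K h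
  refine ⟨σ₁, Or.inl ⟨x, hx, K, ?_, ?_⟩⟩
  · rw [play, hK, Option.map_some]
  · rw [play, playWithHistory_succ hK, nextMove, if_neg (not_exists.2 hstuck), Option.map_none,
      Option.map_none]

theorem loses_of_infinite {ρ : ℕ → A.Position} (h : ∀ K, IsPlay σ₀ i ρ K) {k : Fin (M + 1)}
    (hk : Odd (k : ℕ)) (hle : ∀ᶠ j in Filter.atTop, A.posPrio (ρ j) ≤ k)
    (hfreq : ∃ᶠ j in Filter.atTop, A.posPrio (ρ j) = k) : Loses i σ₀ := by
  obtain ⟨σ₁, hσ₁⟩ := exists_playWithHistory_eq σ₀ i ρ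
  have hk0 : k ≠ 0 := by
    rintro rfl
    simp at hk
  exact ⟨σ₁, Or.inr ⟨k, (isInfiniteWithLimsup_iff
    (fun j => by simp [play, hσ₁ j (h j)]) hk0).2 ⟨hle, hfreq⟩, hk⟩⟩

variable (σ₀ i) in
/-- A finite play from entry `i` consistent with `σ₀`; the values of `path` after `length` are
irrelevant. -/
structure FinitePlay : Type u where
  path : ℕ → A.Position
  length : ℕ
  isPlay : IsPlay σ₀ i path length

namespace FinitePlay

/-- The last position. -/
def last (a : FinitePlay σ₀ i) : A.Position := a.path a.length

/-- The play `b` continues the play `a`. -/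
def IsPrefix (a b : FinitePlay σ₀ i) : Prop :=
  a.length < b.length ∧ ∀ j ≤ a.length, b.path j = a.path j

/-- The play `b` continues the play `a` by one move. -/
def Step (a b : FinitePlay σ₀ i) : Prop :=
  b.length = a.length + 1 ∧ ∀ j ≤ a.length, b.path j = a.path j

theorem exists_step (a : FinitePlay σ₀ i) {q : A.Position} (hq : A.Move a.last q)
    (hcons : ∀ x ∈ A.V₀, a.last = Sum.inl (Sum.inr x) →
      q = A.toPosition (σ₀.move (history a.path a.length) x)) :
    ∃ b : FinitePlay σ₀ i, Step a b ∧ b.last = q :=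
  ⟨⟨_, _, a.isPlay.update hq hcons⟩,
    ⟨rfl, fun _ hj => Function.update_of_ne (by lia) _ _⟩, Function.update_self ..⟩

theorem exists_step_of_zero (hσ₀ : ¬ Loses i σ₀) {a : FinitePlay σ₀ i}
    (ha : a.last ∈ A.zeroPositions) : ∃ b : FinitePlay σ₀ i, Step a b := by
  obtain ⟨x, hx, hax⟩ := ha
  have hsucc : ∃ t, A.E (Sum.inr x) t := by
    by_contra hstuck
    exact hσ₀ (loses_of_stuck a.isPlay hx hax.symm (not_exists.1 hstuck))
  have hmove : A.Move a.last (A.toPosition (σ₀.move (history a.path a.length) x)) :=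
    hax ▸ move_inl_toPosition.2 (σ₀.legal _ x hx hsucc)
  obtain ⟨b, hb, -⟩ := a.exists_step hmove fun y _ hy => by
    rw [← hax] at hy
    rw [Sum.inr.inj (Sum.inl.inj hy)]
  exact ⟨b, hb⟩

theorem isPrefix_of_transGen {k : Fin (M + 1)} {a b : FinitePlay σ₀ i}
    (h : Relation.TransGen (StepLE Step (fun a => A.posPrio a.last) k) a b) :
    IsPrefix a b ∧ ∀ j, a.length ≤ j → j < b.length → A.posPrio (b.path j) ≤ k := by
  induction h with
  | single hab =>
    obtain ⟨⟨hlen, hpath⟩, hk⟩ := hab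
    refine ⟨⟨by lia, hpath⟩, fun j haj hjb => ?_⟩
    obtain rfl : j = a.length := by lia
    exact hpath _ le_rfl ▸ hk
  | @tail b c _ hbc ih =>
    obtain ⟨⟨hlen, hpath⟩, hk⟩ := hbc
    obtain ⟨⟨hlt, hpath'⟩, hle⟩ := ih
    refine ⟨⟨by lia, fun j hj => (hpath j (by lia)).trans (hpath' j hj)⟩, fun j haj hjc => ?_⟩
    rw [hpath j (by lia)]
    rcases Nat.lt_or_ge j b.length with hjb | hjb
    · exact hle j haj hjb
    · obtain rfl : j = b.length := by lia
      exact hk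

theorem path_eq_path {f : ℕ → FinitePlay σ₀ i} (hf : ∀ l, IsPrefix (f l) (f (l + 1))) {l l' j : ℕ}
    (hl : j ≤ (f l).length) (hl' : j ≤ (f l').length) : (f l).path j = (f l').path j := by
  wlog hle : l ≤ l' generalizing l l'
  · exact (this hl' hl (le_of_not_ge hle)).symm
  have hmono : StrictMono fun l => (f l).length := strictMono_nat_of_lt_succ fun l => (hf l).1
  clear hl'
  induction l', hle using Nat.le_induction with
  | base => rfl
  | succ l' hll' ih => exact ih.trans ((hf l').2 j (hl.trans (hmono.monotone hll'))).symm

theorem satisfiesParity (hσ₀ : ¬ Loses i σ₀) :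
    SatisfiesParity Step fun a : FinitePlay σ₀ i => A.posPrio a.last := by
  intro k hk
  by_contra hwf
  rw [wellFounded_iff_isEmpty_descending_chain, not_isEmpty_iff] at hwf
  obtain ⟨f, hf⟩ := hwf
  have hpre := fun l => isPrefix_of_transGen (hf l).2.2
  have hmono : StrictMono fun l => (f l).length :=
    strictMono_nat_of_lt_succ fun l => (hpre l).1.1
  have hdiag : ∀ l, ∀ j ≤ (f l).length, (f l).path j = (f j).path j := fun l j hj =>
    path_eq_path (fun l => (hpre l).1) hj (hmono.le_apply)
  refine hσ₀ (loses_of_infinite (ρ := fun j => (f j).path j) (k := k) (fun K => ?_) hk ?_ ?_)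
  · exact ((f K).isPlay.congr (hdiag K)).mono hmono.le_apply
  · refine Filter.eventually_atTop.2 ⟨(f 0).length, fun j hj => ?_⟩
    obtain ⟨l, hl, hl'⟩ :=
      hmono.exists_between_of_tendsto_atTop hmono.tendsto_atTop (Nat.lt_succ_of_le hj)
    rw [← hdiag (l + 1) j (Nat.le_of_lt hl')]
    exact (hpre l).2 j (Nat.le_of_lt_succ hl) hl'
  · refine Filter.frequently_atTop.2 fun K => ⟨(f K).length, hmono.le_apply, ?_⟩
    rw [← hdiag K _ le_rfl]
    exact (hf K).1

variable (i) in
/-- The play that consists of entry `i` only. -/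
def init (σ₀ : A.Strategy A.V₀) : FinitePlay σ₀ i :=
  ⟨fun _ => Sum.inl (Sum.inl i), 0, rfl, by simp, by simp⟩

end FinitePlay

/-- The strategy graph of the finite plays consistent with a winning strategy. -/
noncomputable def StrategyGraph.ofStrategy {T : Set (Exits m n × Fin (M + 1))} (hσ₀ : ¬ Loses i σ₀)
    (hT : denotation i σ₀ ⊆ T) : StrategyGraph.{u, u} A T i where
  Node := FinitePlay σ₀ i
  root := .init i σ₀
  pos := FinitePlay.last
  acc a := (Finset.range a.length).sup fun j => A.posPrio (a.path j)
  step := FinitePlay.Step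
  pos_root := rfl
  acc_root := by simp [FinitePlay.init, bot_eq_zero]
  move_of_step {a b} hab := by
    have hmove := b.isPlay.move a.length (hab.1 ▸ Nat.lt_succ_self _)
    rwa [hab.2 _ le_rfl, ← hab.1] at hmove
  acc_of_step {a b} hab := by
    rw [hab.1, Finset.range_add_one, Finset.sup_insert, hab.2 _ le_rfl, sup_comm]
    congr 1
    exact Finset.sup_congr rfl fun j hj => by rw [hab.2 j (Finset.mem_range.1 hj).le]
  exists_step_of_zero := FinitePlay.exists_step_of_zero hσ₀
  exists_step_of_move {a q} ha hq :=
    a.exists_step hq fun x hx hax => absurd ⟨x, hx, hax.symm⟩ ha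
  mem_of_exit {a o} ho := hT (a.isPlay.mem_denotation ho)
  parity := FinitePlay.satisfiesParity hσ₀

end Completeness

theorem mem_semantics_iff {T : Set (Exits m n × Fin (M + 1))} {i : Entries m n} :
    (T, i) ∈ A.semantics ↔ Nonempty (StrategyGraph.{u, u} A T i) :=
  ⟨fun ⟨_, hσ₀, hT⟩ => ⟨.ofStrategy hσ₀ hT⟩, fun ⟨S⟩ => S.mem_semantics⟩

section Iso

variable {B : OpenParityGame.{v} M m n}

/-- An isomorphism of open parity games: a renaming of the internal positions. -/
structure Iso (A : OpenParityGame.{u} M m n) (B : OpenParityGame.{v} M m n) where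
  equiv : A.V ≃ B.V
  mem_V₀_iff (x : A.V) : equiv x ∈ B.V₀ ↔ x ∈ A.V₀
  prio_apply (x : A.V) : B.prio (equiv x) = A.prio x
  edge_iff (s : Entries m n ⊕ A.V) (t : A.V ⊕ Exits m n) :
    B.E (Sum.map id equiv s) (Sum.map equiv id t) ↔ A.E s t

namespace Iso

/-- The inverse isomorphism. -/
def symm (φ : Iso A B) : Iso B A where
  equiv := φ.equiv.symm
  mem_V₀_iff x := by simp [← φ.mem_V₀_iff]
  prio_apply x := by simp [← φ.prio_apply]
  edge_iff s t := by simp [← φ.edge_iff]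

/-- The induced bijection between positions. -/
def position (φ : Iso A B) : A.Position ≃ B.Position :=
  ((Equiv.refl _).sumCongr φ.equiv).sumCongr (Equiv.refl _)

theorem position_toPosition (φ : Iso A B) (t : A.V ⊕ Exits m n) :
    φ.position (A.toPosition t) = B.toPosition (Sum.map φ.equiv id t) := by
  cases t <;> rfl

theorem posPrio_position (φ : Iso A B) (p : A.Position) :
    B.posPrio (φ.position p) = A.posPrio p := by
  rcases p with (e | x) | o
  exacts [rfl, φ.prio_apply x, rfl]

theorem position_mem_zeroPositions (φ : Iso A B) {p : A.Position} :
    φ.position p ∈ B.zeroPositions ↔ p ∈ A.zeroPositions := by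
  rcases p with (e | x) | o <;> simp [position, zeroPositions, φ.mem_V₀_iff]

theorem move_position (φ : Iso A B) {p q : A.Position} (h : A.Move p q) :
    B.Move (φ.position p) (φ.position q) := by
  obtain ⟨s, t, hst, rfl, rfl⟩ := h
  exact ⟨_, _, (φ.edge_iff s t).2 hst, rfl, φ.position_toPosition t⟩

end Iso

variable {T : Set (Exits m n × Fin (M + 1))} {i : Entries m n}

/-- Transport of a strategy graph along an isomorphism. -/
def StrategyGraph.map (S : StrategyGraph.{u, w} A T i) (φ : Iso A B) :
    StrategyGraph.{v, w} B T i where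
  Node := S.Node
  root := S.root
  pos c := φ.position (S.pos c)
  acc := S.acc
  step := S.step
  pos_root := congrArg φ.position S.pos_root
  acc_root := S.acc_root
  move_of_step h := φ.move_position (S.move_of_step h)
  acc_of_step h := by rw [S.acc_of_step h, φ.posPrio_position]
  exists_step_of_zero h := S.exists_step_of_zero (φ.position_mem_zeroPositions.1 h)
  exists_step_of_move {c q} h hq := by
    have hmove : A.Move (S.pos c) (φ.position.symm q) := by
      have hq' : A.Move (φ.position.symm (φ.position (S.pos c))) (φ.position.symm q) :=
        φ.symm.move_position hq
      rwa [Equiv.symm_apply_apply] at hq'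
    obtain ⟨c', hc', hpos⟩ :=
      S.exists_step_of_move (mt φ.position_mem_zeroPositions.2 h) hmove
    exact ⟨c', hc', (Equiv.eq_symm_apply _).1 hpos⟩
  mem_of_exit {c o} h := S.mem_of_exit (φ.position.injective h)
  parity := by simpa only [φ.posPrio_position] using S.parity

theorem Iso.semantics_subset (φ : Iso A B) : A.semantics ⊆ B.semantics := fun _ h =>
  let ⟨S⟩ := mem_semantics_iff.1 h
  (S.map φ).mem_semantics

theorem Iso.equivalent (φ : Iso A B) : Equivalent A B :=
  φ.semantics_subset.antisymm φ.symm.semantics_subset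

end Iso

/-! ### Expansion into elementary positions -/

/-- The edges given by a bijection `φ` between ports: the inputs `I` of the interface and the
output ports of the vertices are joined to the outputs `O` of the interface and the input ports of
the vertices. -/
def netEdge {I O V : Type*} {out inn : V → Type*}
    (φ : I ⊕ (Σ x, out x) ≃ O ⊕ (Σ x, inn x)) (s : I ⊕ V) (t : V ⊕ O) : Prop :=
  ∃ p, Sum.map id Sigma.fst p = s ∧ Sum.elim Sum.inr (Sum.inl ∘ Sigma.fst) (φ p) = t

/-- The game whose edges are given by a bijection between ports. -/
abbrev netGame {V : Type u} [hV : Finite V] (out inn : V → Type)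
    (φ : Entries m n ⊕ (Σ x, out x) ≃ Exits m n ⊕ (Σ x, inn x)) (own : Set V)
    (pr : V → Fin (M + 1)) : OpenParityGame.{u} M m n where
  V := V
  finite := hV
  V₀ := own
  E := netEdge φ
  entry_unique e := by
    refine ⟨_, ⟨Sum.inl e, rfl, rfl⟩, ?_⟩
    rintro t ⟨p | p, hp, rfl⟩
    · cases hp
      rfl
    · cases hp
  exit_unique o := by
    refine ⟨_, ⟨φ.symm (Sum.inl o), rfl, by simp⟩, ?_⟩
    rintro s ⟨p, rfl, hp⟩
    rcases hq : φ p with q | q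
    · rw [hq] at hp
      cases hp
      rw [← hq, Equiv.symm_apply_apply]
    · rw [hq] at hp
      cases hp
  prio := pr

variable (A)

instance finite_entries_sum : Finite (Entries m n ⊕ A.V) :=
  have := A.finite
  inferInstance

instance finite_sum_exits : Finite (A.V ⊕ Exits m n) :=
  have := A.finite
  inferInstance

/-- The number of edges into an internal position. -/
noncomputable def inDegree (x : A.V) : ℕ := Nat.card {s // A.E s (Sum.inl x)}

/-- The number of edges out of an internal position. -/
noncomputable def outDegree (x : A.V) : ℕ := Nat.card {t // A.E (Sum.inr x) t}

/-- An enumeration of the edges into an internal position. -/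
noncomputable def inEdge (x : A.V) : {s // A.E s (Sum.inl x)} ≃ Fin (A.inDegree x) :=
  Finite.equivFin _

/-- An enumeration of the edges out of an internal position. -/
noncomputable def outEdge (x : A.V) : {t // A.E (Sum.inr x) t} ≃ Fin (A.outDegree x) :=
  Finite.equivFin _

/-- The positions of the expansion of `A`. Every internal position of `A` is replaced by a chain:
a start position, one merging position per incoming edge, a position carrying the priority, one
binary choice per outgoing edge, and a losing position. -/
inductive ChainNode : Type u
  | start (x : A.V)
  | merge (x : A.V) (j : Fin (A.inDegree x))
  | prio (x : A.V)
  | player (x : A.V) (j : Fin (A.outDegree x))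
  | lose (x : A.V)

namespace ChainNode

variable {A}

instance : Finite (ChainNode A) := by
  have := A.finite
  refine Finite.of_injective
    (β := (A.V ⊕ (Σ x : A.V, Fin (A.inDegree x))) ⊕ (A.V ⊕ (Σ x : A.V, Fin (A.outDegree x))) ⊕ A.V)
    (fun y => match y with
      | start x => Sum.inl (Sum.inl x)
      | merge x j => Sum.inl (Sum.inr ⟨x, j⟩)
      | prio x => Sum.inr (Sum.inl (Sum.inl x))
      | player x j => Sum.inr (Sum.inl (Sum.inr ⟨x, j⟩))
      | lose x => Sum.inr (Sum.inr x)) ?_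
  rintro (x | ⟨x, j⟩ | x | ⟨x, j⟩ | x) (y | ⟨y, k⟩ | y | ⟨y, k⟩ | y) h <;> simp_all

/-- The positions of Player 0: the choices and losing positions of its chains. The owner of the
other positions is the one prescribed by the generators. -/
def IsZero : ChainNode A → Prop
  | player x _ | lose x => x ∈ A.V₀
  | _ => False

/-- The priority of a position of the expansion. -/
def priority : ChainNode A → Fin (M + 1)
  | prio x => A.prio x
  | _ => 0

/-- The `k`-th position of the incoming half of a chain. -/
noncomputable def chainIn (x : A.V) (k : Fin (A.inDegree x + 1)) : ChainNode A :=
  Fin.lastCases (prio x) (merge x) k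

/-- The `k`-th position of the outgoing half of a chain. -/
noncomputable def chainOut (x : A.V) (k : Fin (A.outDegree x + 1)) : ChainNode A :=
  Fin.lastCases (lose x) (player x) k

@[simp] theorem chainIn_last (x : A.V) : chainIn x (Fin.last _) = prio x :=
  Fin.lastCases_last

@[simp] theorem chainIn_castSucc (x : A.V) (j) : chainIn x (Fin.castSucc j) = merge x j :=
  Fin.lastCases_castSucc _

@[simp] theorem chainOut_last (x : A.V) : chainOut x (Fin.last _) = lose x :=
  Fin.lastCases_last

@[simp] theorem chainOut_castSucc (x : A.V) (j) : chainOut x (Fin.castSucc j) = player x j :=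
  Fin.lastCases_castSucc _

/-- The output ports of a position of the expansion. The port `true` of a choice is the edge of `A`
it offers, and the port `false` leads on along the chain. -/
def Out : ChainNode A → Type
  | start _ | merge _ _ | prio _ => Unit
  | player _ _ => Bool
  | lose _ => Empty

/-- The input ports of a position of the expansion. The port `true` of a merging position is its
edge of `A`, and the port `false` comes from the preceding position of the chain. -/
def In : ChainNode A → Type
  | start _ => Empty
  | merge _ _ => Bool
  | prio _ | player _ _ | lose _ => Unit

variable (A) in
/-- The edges of the expansion: those of `A` and those of the two halves of the chains. -/
abbrev Edge : Type u :=
  {st : (Entries m n ⊕ A.V) × (A.V ⊕ Exits m n) // A.E st.1 st.2} ⊕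
    ((Σ x : A.V, Fin (A.inDegree x + 1)) ⊕ (Σ x : A.V, Fin (A.outDegree x + 1)))

/-- The port at which an edge starts. -/
noncomputable def edgeSource : Edge A → Entries m n ⊕ (Σ y : ChainNode A, y.Out)
  | Sum.inl ⟨(Sum.inl e, _), _⟩ => Sum.inl e
  | Sum.inl ⟨(Sum.inr x, t), h⟩ => Sum.inr ⟨player x (A.outEdge x ⟨t, h⟩), true⟩
  | Sum.inr (Sum.inl ⟨x, k⟩) => Sum.inr (Fin.cases (motive := fun _ => Σ y : ChainNode A, y.Out)
      ⟨start x, ()⟩ (fun j => ⟨merge x j, ()⟩) k)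
  | Sum.inr (Sum.inr ⟨x, k⟩) => Sum.inr (Fin.cases (motive := fun _ => Σ y : ChainNode A, y.Out)
      ⟨prio x, ()⟩ (fun j => ⟨player x j, false⟩) k)

/-- The port at which an edge ends. -/
noncomputable def edgeTarget : Edge A → Exits m n ⊕ (Σ y : ChainNode A, y.In)
  | Sum.inl ⟨(_, Sum.inr o), _⟩ => Sum.inl o
  | Sum.inl ⟨(s, Sum.inl x), h⟩ => Sum.inr ⟨merge x (A.inEdge x ⟨s, h⟩), true⟩
  | Sum.inr (Sum.inl ⟨x, k⟩) => Sum.inr (Fin.lastCases (motive := fun _ => Σ y : ChainNode A, y.In)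
      ⟨prio x, ()⟩ (fun j => ⟨merge x j, false⟩) k)
  | Sum.inr (Sum.inr ⟨x, k⟩) => Sum.inr (Fin.lastCases (motive := fun _ => Σ y : ChainNode A, y.In)
      ⟨lose x, ()⟩ (fun j => ⟨player x j, ()⟩) k)

/-- The edge that starts at a given port. -/
noncomputable def edgeOfSource : Entries m n ⊕ (Σ y : ChainNode A, y.Out) → Edge A
  | Sum.inl e => Sum.inl ⟨(Sum.inl e, A.entryTarget e), (A.entryTarget_eq_iff e _).1 rfl⟩
  | Sum.inr ⟨start x, _⟩ => Sum.inr (Sum.inl ⟨x, 0⟩)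
  | Sum.inr ⟨merge x j, _⟩ => Sum.inr (Sum.inl ⟨x, j.succ⟩)
  | Sum.inr ⟨prio x, _⟩ => Sum.inr (Sum.inr ⟨x, 0⟩)
  | Sum.inr ⟨player x j, true⟩ =>
    Sum.inl ⟨(Sum.inr x, ((A.outEdge x).symm j).1), ((A.outEdge x).symm j).2⟩
  | Sum.inr ⟨player x j, false⟩ => Sum.inr (Sum.inr ⟨x, j.succ⟩)

/-- The edge that ends at a given port. -/
noncomputable def edgeOfTarget : Exits m n ⊕ (Σ y : ChainNode A, y.In) → Edge A
  | Sum.inl o => Sum.inl ⟨((A.exit_unique o).choose, Sum.inr o), (A.exit_unique o).choose_spec.1⟩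
  | Sum.inr ⟨merge x j, true⟩ =>
    Sum.inl ⟨(((A.inEdge x).symm j).1, Sum.inl x), ((A.inEdge x).symm j).2⟩
  | Sum.inr ⟨merge x j, false⟩ => Sum.inr (Sum.inl ⟨x, j.castSucc⟩)
  | Sum.inr ⟨prio x, _⟩ => Sum.inr (Sum.inl ⟨x, Fin.last _⟩)
  | Sum.inr ⟨player x j, _⟩ => Sum.inr (Sum.inr ⟨x, j.castSucc⟩)
  | Sum.inr ⟨lose x, _⟩ => Sum.inr (Sum.inr ⟨x, Fin.last _⟩)

/-- Every edge starts at exactly one port. -/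
noncomputable def sourceEquiv : Edge A ≃ Entries m n ⊕ (Σ y : ChainNode A, y.Out) where
  toFun := edgeSource
  invFun := edgeOfSource
  left_inv := by
    rintro (⟨⟨e | x, t⟩, h⟩ | ⟨x, k⟩ | ⟨x, k⟩)
    · obtain rfl := (A.entryTarget_eq_iff e t).2 h
      rfl
    · simp [edgeSource, edgeOfSource]
    · refine Fin.cases ?_ (fun j => ?_) k <;> simp [edgeSource, edgeOfSource]
    · refine Fin.cases ?_ (fun j => ?_) k <;> simp [edgeSource, edgeOfSource]
  right_inv := by
    rintro (e | ⟨x | ⟨x, j⟩ | x | ⟨x, j⟩ | x, p⟩)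
    case inr.player =>
      rcases p with _ | _
      · rfl
      · exact congrArg
          (fun k => (Sum.inr ⟨player x k, true⟩ : Entries m n ⊕ (Σ y : ChainNode A, y.Out)))
          ((A.outEdge x).apply_symm_apply j)
    case inr.lose => exact p.elim
    all_goals rfl

/-- Every edge ends at exactly one port. -/
noncomputable def targetEquiv : Edge A ≃ Exits m n ⊕ (Σ y : ChainNode A, y.In) where
  toFun := edgeTarget
  invFun := edgeOfTarget
  left_inv := by
    rintro (⟨⟨s, x | o⟩, h⟩ | ⟨x, k⟩ | ⟨x, k⟩)
    · simp [edgeTarget, edgeOfTarget]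
    · obtain rfl := (A.exit_unique o).choose_spec.2 s h
      rfl
    · refine Fin.lastCases ?_ (fun j => ?_) k <;> simp [edgeTarget, edgeOfTarget]
    · refine Fin.lastCases ?_ (fun j => ?_) k <;> simp [edgeTarget, edgeOfTarget]
  right_inv := by
    rintro (o | ⟨x | ⟨x, j⟩ | x | ⟨x, j⟩ | x, p⟩)
    case inl => rfl
    case inr.start => exact p.elim
    case inr.merge =>
      rcases p with _ | _
      · simp [edgeTarget, edgeOfTarget]
      · exact congrArg
          (fun k => (Sum.inr ⟨merge x k, true⟩ : Exits m n ⊕ (Σ y : ChainNode A, y.In)))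
          ((A.inEdge x).apply_symm_apply j)
    all_goals
      cases p
      simp [edgeTarget, edgeOfTarget]

end ChainNode

open ChainNode

/-- The expansion of a game into a net of positions that generators can realise. -/
noncomputable abbrev expansion : OpenParityGame.{u} M m n :=
  netGame Out In (sourceEquiv.symm.trans targetEquiv) {y : ChainNode A | y.IsZero} priority

namespace ChainNode

variable {A}

/-- The edges inside the chains. -/
inductive ChainStep : ChainNode A → ChainNode A → Prop
  | start (x : A.V) : ChainStep (start x) (chainIn x 0)
  | merge (x : A.V) (j : Fin (A.inDegree x)) : ChainStep (merge x j) (chainIn x j.succ)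
  | prio (x : A.V) : ChainStep (prio x) (chainOut x 0)
  | player (x : A.V) (j : Fin (A.outDegree x)) : ChainStep (player x j) (chainOut x j.succ)

/-- The source, in the expansion, of an edge of `A`. -/
noncomputable def departure :
    (s : Entries m n ⊕ A.V) → (t : A.V ⊕ Exits m n) → A.E s t → Entries m n ⊕ ChainNode A
  | Sum.inl e, _, _ => Sum.inl e
  | Sum.inr x, t, h => Sum.inr (player x (A.outEdge x ⟨t, h⟩))

/-- The target, in the expansion, of an edge of `A`. -/
noncomputable def arrival :
    (s : Entries m n ⊕ A.V) → (t : A.V ⊕ Exits m n) → A.E s t → ChainNode A ⊕ Exits m n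
  | s, Sum.inl y, h => Sum.inl (merge y (A.inEdge y ⟨s, h⟩))
  | _, Sum.inr o, _ => Sum.inr o

/-- The position or exit at which an edge of the expansion ends. -/
noncomputable def targetNode (e : Edge A) : ChainNode A ⊕ Exits m n :=
  Sum.elim Sum.inr (Sum.inl ∘ Sigma.fst) (edgeTarget e)

theorem targetNode_chainIn (x : A.V) (k : Fin (A.inDegree x + 1)) :
    targetNode (Sum.inr (Sum.inl ⟨x, k⟩)) = Sum.inl (chainIn x k) := by
  refine Fin.lastCases ?_ (fun j => ?_) k <;> simp [targetNode, edgeTarget]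

theorem targetNode_chainOut (x : A.V) (k : Fin (A.outDegree x + 1)) :
    targetNode (Sum.inr (Sum.inr ⟨x, k⟩)) = Sum.inl (chainOut x k) := by
  refine Fin.lastCases ?_ (fun j => ?_) k <;> simp [targetNode, edgeTarget]

theorem edge_expansion_iff_exists {s : Entries m n ⊕ ChainNode A} {t : ChainNode A ⊕ Exits m n} :
    A.expansion.E s t ↔
      ∃ e : Edge A, Sum.map id Sigma.fst (edgeSource e) = s ∧ targetNode e = t := by
  refine ⟨fun ⟨p, hs, ht⟩ => ⟨sourceEquiv.symm p, ?_, ht⟩, fun ⟨e, hs, ht⟩ =>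
    ⟨sourceEquiv e, hs, ?_⟩⟩
  · rwa [show edgeSource (sourceEquiv.symm p) = p from sourceEquiv.apply_symm_apply p]
  · rwa [Equiv.trans_apply, Equiv.symm_apply_apply]

theorem edge_expansion_iff {s : Entries m n ⊕ ChainNode A} {t : ChainNode A ⊕ Exits m n} :
    A.expansion.E s t ↔ (∃ y z, ChainStep y z ∧ s = Sum.inr y ∧ t = Sum.inl z) ∨
      ∃ s' t', ∃ h : A.E s' t', s = departure s' t' h ∧ t = arrival s' t' h := by
  rw [edge_expansion_iff_exists]
  constructor
  · rintro ⟨⟨⟨s', t'⟩, h⟩ | ⟨x, k⟩ | ⟨x, k⟩, rfl, rfl⟩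
    · refine Or.inr ⟨s', t', h, ?_, ?_⟩
      · cases s' <;> rfl
      · cases t' <;> rfl
    · rw [targetNode_chainIn]
      refine Or.inl ?_
      cases k using Fin.cases with
      | zero => exact ⟨_, _, .start x, rfl, rfl⟩
      | succ j => exact ⟨_, _, .merge x j, rfl, rfl⟩
    · rw [targetNode_chainOut]
      refine Or.inl ?_
      cases k using Fin.cases with
      | zero => exact ⟨_, _, .prio x, rfl, rfl⟩
      | succ j => exact ⟨_, _, .player x j, rfl, rfl⟩
  · rintro (⟨_, _, x | ⟨x, j⟩ | x | ⟨x, j⟩, rfl, rfl⟩ | ⟨s', t', h, rfl, rfl⟩)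
    · exact ⟨Sum.inr (Sum.inl ⟨x, 0⟩), rfl, targetNode_chainIn x 0⟩
    · exact ⟨Sum.inr (Sum.inl ⟨x, j.succ⟩), rfl, targetNode_chainIn x _⟩
    · exact ⟨Sum.inr (Sum.inr ⟨x, 0⟩), rfl, targetNode_chainOut x 0⟩
    · exact ⟨Sum.inr (Sum.inr ⟨x, j.succ⟩), rfl, targetNode_chainOut x _⟩
    · refine ⟨Sum.inl ⟨(s', t'), h⟩, ?_, ?_⟩
      · cases s' <;> rfl
      · cases t' <;> rfl

end ChainNode

variable {A}

namespace StrategyGraph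

variable {T : Set (Exits m n × Fin (M + 1))} {i : Entries m n}

section Expand

variable (S : StrategyGraph.{u, w} A T i)

/-- The node `c` of `S` can be simulated at a position of the expansion. In the outgoing half of the
chain of a position of Player 0, an edge that `S` can follow must still be ahead. -/
def Tracks (c : S.Node) : A.expansion.Position → Prop
  | Sum.inl (Sum.inl e) => S.pos c = Sum.inl (Sum.inl e)
  | Sum.inl (Sum.inr (start _)) => False
  | Sum.inl (Sum.inr (.merge x _)) => S.pos c = Sum.inl (Sum.inr x)
  | Sum.inl (Sum.inr (.prio x)) => S.pos c = Sum.inl (Sum.inr x)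
  | Sum.inl (Sum.inr (player x j)) => S.pos c = Sum.inl (Sum.inr x) ∧
      (x ∈ A.V₀ → ∃ k ≥ j, ∃ d, S.step c d ∧ S.pos d = A.toPosition ((A.outEdge x).symm k))
  | Sum.inl (Sum.inr (lose x)) => S.pos c = Sum.inl (Sum.inr x) ∧ x ∉ A.V₀
  | Sum.inr o => S.pos c = Sum.inr o

/-- The position lies in the outgoing half of a chain, where the priority has been met. -/
def IsOutgoing : A.expansion.Position → Prop
  | Sum.inl (Sum.inr (player _ _)) => True
  | Sum.inl (Sum.inr (lose _)) => True
  | _ => False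

/-- The steps of the strategy graph on the expansion that simulates `S`. -/
inductive ExpandStep : S.Node × A.expansion.Position → S.Node × A.expansion.Position → Prop
  | chain (c : S.Node) {y z : ChainNode A} (h : ChainStep y z) :
      ExpandStep (c, Sum.inl (Sum.inr y)) (c, Sum.inl (Sum.inr z))
  | cross {c d : S.Node} (hcd : S.step c d) {s : Entries m n ⊕ A.V} {t : A.V ⊕ Exits m n}
      (hst : A.E s t) (hs : S.pos c = Sum.inl s) (ht : S.pos d = A.toPosition t) :
      ExpandStep (c, Sum.inl (departure s t hst)) (d, A.expansion.toPosition (arrival s t hst))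

variable {S}

theorem tracks_chainIn {c : S.Node} {x : A.V} (k : Fin (A.inDegree x + 1)) :
    S.Tracks c (Sum.inl (Sum.inr (chainIn x k))) ↔ S.pos c = Sum.inl (Sum.inr x) := by
  refine Fin.lastCases ?_ (fun j => ?_) k <;> simp [Tracks]

theorem tracks_chainOut {c : S.Node} {x : A.V} (k : Fin (A.outDegree x + 1)) :
    S.Tracks c (Sum.inl (Sum.inr (chainOut x k))) ↔ S.pos c = Sum.inl (Sum.inr x) ∧
      (x ∈ A.V₀ → ∃ j, k ≤ Fin.castSucc j ∧
        ∃ d, S.step c d ∧ S.pos d = A.toPosition ((A.outEdge x).symm j)) := by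
  refine Fin.lastCases ?_ (fun j => ?_) k
  · simp [Tracks, Fin.last_le_iff, Fin.castSucc_ne_last]
  · simp [Tracks]

theorem tracks_arrival {d : S.Node} {s : Entries m n ⊕ A.V} {t : A.V ⊕ Exits m n} (h : A.E s t)
    (ht : S.pos d = A.toPosition t) : S.Tracks d (A.expansion.toPosition (arrival s t h)) := by
  cases t <;> exact ht

theorem pos_of_tracks_departure {c : S.Node} {s : Entries m n ⊕ A.V} {t : A.V ⊕ Exits m n}
    {h : A.E s t} (hc : S.Tracks c (Sum.inl (departure s t h))) : S.pos c = Sum.inl s := by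
  cases s
  exacts [hc, hc.1]

theorem not_isOutgoing_chainIn {x : A.V} (k : Fin (A.inDegree x + 1)) :
    ¬ IsOutgoing (Sum.inl (Sum.inr (chainIn x k))) := by
  refine Fin.lastCases ?_ (fun j => ?_) k <;> simp [IsOutgoing]

theorem isOutgoing_chainOut {x : A.V} (k : Fin (A.outDegree x + 1)) :
    IsOutgoing (Sum.inl (Sum.inr (chainOut x k))) := by
  refine Fin.lastCases ?_ (fun j => ?_) k <;> simp [IsOutgoing]

theorem not_isOutgoing_arrival {s : Entries m n ⊕ A.V} {t : A.V ⊕ Exits m n} (h : A.E s t) :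
    ¬ IsOutgoing (A.expansion.toPosition (arrival s t h)) := by
  cases t <;> exact id

variable (S) in
open Classical in
/-- The largest priority met before a position of the expansion, for a play that corresponds to a
play of `A` ending at the node `c`. -/
noncomputable def expandAcc (c : S.Node) (q : A.expansion.Position) : Fin (M + 1) :=
  if IsOutgoing q then S.acc c ⊔ A.posPrio (S.pos c) else S.acc c

theorem expandAcc_of_isOutgoing {c : S.Node} {q : A.expansion.Position} (hq : IsOutgoing q) :
    S.expandAcc c q = S.acc c ⊔ A.posPrio (S.pos c) :=
  if_pos hq

theorem expandAcc_of_not {c : S.Node} {q : A.expansion.Position} (hq : ¬ IsOutgoing q) :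
    S.expandAcc c q = S.acc c :=
  if_neg hq

namespace ExpandStep

theorem move {a b : S.Node × A.expansion.Position} (h : S.ExpandStep a b) :
    A.expansion.Move a.2 b.2 := by
  cases h with
  | chain c h => exact ⟨_, _, edge_expansion_iff.2 (Or.inl ⟨_, _, h, rfl, rfl⟩), rfl, rfl⟩
  | cross hcd hst hs ht =>
    exact ⟨_, _, edge_expansion_iff.2 (Or.inr ⟨_, _, hst, rfl, rfl⟩), rfl, rfl⟩

theorem acc_eq {a b : S.Node × A.expansion.Position} (h : S.ExpandStep a b)
    (ha : S.Tracks a.1 a.2) :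
    S.expandAcc b.1 b.2 = S.expandAcc a.1 a.2 ⊔ A.expansion.posPrio a.2 := by
  cases h with
  | chain c h =>
    cases h with
    | start x => exact ha.elim
    | merge x j => simp [expandAcc_of_not (not_isOutgoing_chainIn j.succ),
        expandAcc_of_not (q := Sum.inl (Sum.inr (.merge x j))) id, posPrio, priority]
    | prio x =>
      have hpos : S.pos c = Sum.inl (Sum.inr x) := ha
      simp [expandAcc_of_isOutgoing (isOutgoing_chainOut 0),
        expandAcc_of_not (q := Sum.inl (Sum.inr (.prio x))) id, hpos, posPrio, priority]
    | player x j => simp [expandAcc_of_isOutgoing (isOutgoing_chainOut j.succ),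
        expandAcc_of_isOutgoing (q := Sum.inl (Sum.inr (.player x j))) trivial, posPrio, priority]
  | @cross c d hcd s t hst hs ht =>
    rw [expandAcc_of_not (not_isOutgoing_arrival hst), S.acc_of_step hcd, hs]
    cases s with
    | inl e =>
      have hin := expandAcc_of_not (S := S) (c := c) (q := Sum.inl (Sum.inl e)) id
      simp [departure, hin, posPrio]
    | inr x =>
      have hout := expandAcc_of_isOutgoing (S := S) (c := c)
        (q := Sum.inl (Sum.inr (.player x (A.outEdge x ⟨t, hst⟩)))) trivial
      simp [departure, hout, hs, posPrio, priority]

end ExpandStep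

theorem exists_expandStep_of_zero {c : S.Node} {q : A.expansion.Position} (hc : S.Tracks c q)
    (hq : q ∈ A.expansion.zeroPositions) :
    ∃ b : S.Node × A.expansion.Position, S.Tracks b.1 b.2 ∧ S.ExpandStep (c, q) b := by
  obtain ⟨y, hy, rfl⟩ := hq
  cases y with
  | start x | merge x j | prio x => exact hy.elim
  | lose x => exact absurd hy hc.2
  | player x j =>
    obtain ⟨hpos, hahead⟩ := hc
    obtain ⟨k, hjk, d, hcd, hd⟩ := hahead hy
    rcases hjk.eq_or_lt with rfl | hlt
    · have hstep := ExpandStep.cross hcd ((A.outEdge x).symm j).2 hpos hd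
      simp only [departure, Subtype.coe_eta, Equiv.apply_symm_apply] at hstep
      exact ⟨(d, _), tracks_arrival _ hd, hstep⟩
    · exact ⟨(c, _), (tracks_chainOut _).2
        ⟨hpos, fun _ => ⟨k, Fin.succ_le_castSucc_iff.2 hlt, d, hcd, hd⟩⟩, .chain c (.player x j)⟩

theorem exists_expandStep_of_move {c : S.Node} {q q' : A.expansion.Position} (hc : S.Tracks c q)
    (hq : q ∉ A.expansion.zeroPositions) (hqq' : A.expansion.Move q q') :
    ∃ b : S.Node × A.expansion.Position,
      S.Tracks b.1 b.2 ∧ S.ExpandStep (c, q) b ∧ b.2 = q' := by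
  obtain ⟨_, _, hE, rfl, rfl⟩ := hqq'
  obtain ⟨y, z, hyz, rfl, rfl⟩ | ⟨s, t, hst, rfl, rfl⟩ := edge_expansion_iff.1 hE
  · refine ⟨(c, _), ?_, .chain c hyz, rfl⟩
    cases hyz with
    | start x => exact hc.elim
    | merge x j => exact (tracks_chainIn _).2 hc
    | prio x =>
      refine (tracks_chainOut _).2 ⟨hc, fun hx => ?_⟩
      obtain ⟨d, hcd⟩ := S.exists_step_of_zero (c := c) ⟨x, hx, hc.symm⟩
      obtain ⟨s, t, hst, hs, ht⟩ := S.move_of_step hcd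
      obtain rfl : s = Sum.inr x := Sum.inl_injective (hs.symm.trans hc)
      exact ⟨A.outEdge x ⟨t, hst⟩, Fin.zero_le _, d, hcd, by simpa using ht⟩
    | player x j => exact (tracks_chainOut _).2 ⟨hc.1, fun hx => absurd ⟨_, hx, rfl⟩ hq⟩
  · have hs := pos_of_tracks_departure hc
    have hzero : S.pos c ∉ A.zeroPositions := by
      rw [hs]
      rintro ⟨x, hx, hxs⟩
      obtain rfl := Sum.inl_injective hxs
      exact hq ⟨_, hx, rfl⟩
    obtain ⟨d, hcd, hd⟩ := S.exists_step_of_move hzero (q := A.toPosition t) ⟨s, t, hst, hs, rfl⟩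
    exact ⟨(d, _), tracks_arrival hst hd, .cross hcd hst hs hd, rfl⟩

theorem exists_eq_prio_of_posPrio_ne_zero {q : A.expansion.Position}
    (hq : A.expansion.posPrio q ≠ 0) : ∃ x, q = Sum.inl (Sum.inr (.prio x)) := by
  rcases q with (e | y) | o
  · exact absurd rfl hq
  · cases y with
    | prio x => exact ⟨x, rfl⟩
    | _ => exact absurd rfl hq
  · exact absurd rfl hq

/-- What is known about the nodes visited by a simulation that has left the node `a` at its
priority position and has met no priority above `k`. -/
def ExpandInvariant (k : Fin (M + 1)) (a : S.Node) (b : S.Node × A.expansion.Position) : Prop :=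
  (IsOutgoing b.2 → Relation.ReflTransGen (StepLE S.step (fun c => A.posPrio (S.pos c)) k) a b.1 ∧
    A.posPrio (S.pos b.1) ≤ k) ∧
  (¬ IsOutgoing b.2 → Relation.TransGen (StepLE S.step (fun c => A.posPrio (S.pos c)) k) a b.1)

theorem ExpandInvariant.step {k : Fin (M + 1)} {a : S.Node} {b d : S.Node × A.expansion.Position}
    (hb : ExpandInvariant k a b) (htracks : S.Tracks b.1 b.2) (hstep : S.ExpandStep b d)
    (hle : A.expansion.posPrio b.2 ≤ k) : ExpandInvariant k a d := by
  cases hstep with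
  | chain c h =>
    cases h with
    | start x => exact htracks.elim
    | merge x j =>
      exact ⟨fun h => absurd h (not_isOutgoing_chainIn _), fun _ => hb.2 id⟩
    | prio x =>
      have hpos : S.pos c = Sum.inl (Sum.inr x) := htracks
      refine ⟨fun _ => ⟨(hb.2 id).to_reflTransGen, ?_⟩,
        fun h => absurd (isOutgoing_chainOut _) h⟩
      rw [hpos]
      exact hle
    | player x j =>
      exact ⟨fun _ => hb.1 trivial, fun h => absurd (isOutgoing_chainOut _) h⟩
  | @cross c d hcd s t hst hs ht =>
    refine ⟨fun h => absurd h (not_isOutgoing_arrival _), fun _ => ?_⟩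
    cases s with
    | inl e => exact (hb.2 id).tail ⟨hcd, by simp [hs, posPrio]⟩
    | inr x => exact .tail' (hb.1 trivial).1 ⟨hcd, (hb.1 trivial).2⟩

theorem ExpandInvariant.of_expandStep_prio {k : Fin (M + 1)} {a : S.Node} {x : A.V}
    {b : S.Node × A.expansion.Position} (hpos : S.pos a = Sum.inl (Sum.inr x))
    (hstep : S.ExpandStep (a, Sum.inl (Sum.inr (.prio x))) b) (hle : A.prio x ≤ k) :
    ExpandInvariant k a b := by
  generalize hq : (a, (Sum.inl (Sum.inr (.prio x)) : A.expansion.Position)) = c at hstep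
  cases hstep with
  | chain c h =>
    cases h <;> cases hq
    refine ⟨fun _ => ⟨.refl, ?_⟩, fun h => absurd (isOutgoing_chainOut _) h⟩
    rw [hpos]
    exact hle
  | @cross c d hcd s t => cases s <;> cases hq

theorem satisfiesParity_expandStep : SatisfiesParity
    (fun a b : {a : S.Node × A.expansion.Position // S.Tracks a.1 a.2} => S.ExpandStep a.1 b.1)
    (fun a => A.expansion.posPrio a.1.2) := by
  refine S.parity.of_descends (fun a => a.1.1) ?_
  rintro k hk ⟨⟨a, q⟩, hta⟩ b ⟨ha, hb, hab⟩
  have hk0 : k ≠ 0 := by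
    rintro rfl
    simp at hk
  obtain ⟨x, rfl⟩ := exists_eq_prio_of_posPrio_ne_zero (ha ▸ hk0)
  have hposa : S.pos a = Sum.inl (Sum.inr x) := hta
  have hinv : ExpandInvariant k a b.1 := by
    clear hb
    induction hab with
    | single h => exact .of_expandStep_prio hposa h.1 h.2
    | @tail c d _ hcd ih => exact ih.step c.2 hcd.1 hcd.2
  obtain ⟨⟨b, q⟩, htb⟩ := b
  obtain ⟨y, rfl⟩ := exists_eq_prio_of_posPrio_ne_zero (hb ▸ hk0)
  have hposb : S.pos b = Sum.inl (Sum.inr y) := htb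
  exact ⟨(congrArg A.posPrio hposa).trans ha, (congrArg A.posPrio hposb).trans hb, hinv.2 id⟩

variable (S) in
/-- The strategy graph on the expansion that simulates `S`. -/
noncomputable def expand : StrategyGraph A.expansion T i where
  Node := {a : S.Node × A.expansion.Position // S.Tracks a.1 a.2}
  root := ⟨(S.root, Sum.inl (Sum.inl i)), S.pos_root⟩
  pos a := a.1.2
  acc a := S.expandAcc a.1.1 a.1.2
  step a b := S.ExpandStep a.1 b.1
  pos_root := rfl
  acc_root := (expandAcc_of_not id).trans S.acc_root
  move_of_step h := h.move
  acc_of_step {a _} h := h.acc_eq a.2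
  exists_step_of_zero {a} h :=
    have ⟨b, hb, hab⟩ := exists_expandStep_of_zero a.2 h
    ⟨⟨b, hb⟩, hab⟩
  exists_step_of_move {a _} h hq :=
    have ⟨b, hb, hab, hbq⟩ := exists_expandStep_of_move a.2 h hq
    ⟨⟨b, hb⟩, hab, hbq⟩
  mem_of_exit {a o} h := by
    obtain ⟨⟨c, q⟩, hc⟩ := a
    obtain rfl : q = Sum.inr o := h
    rw [expandAcc_of_not id]
    exact S.mem_of_exit hc
  parity := satisfiesParity_expandStep

end Expand

section Contract

variable (S : StrategyGraph.{u, w} A.expansion T i)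

variable (A) in
/-- The position of the expansion at which a play stands when it visits a position of `A`. -/
def embed : A.Position → A.expansion.Position :=
  Sum.map (Sum.map id ChainNode.prio) id

/-- A step at which no priority above `0` is met. -/
def Silent (c d : S.Node) : Prop :=
  S.step c d ∧ A.expansion.posPrio (S.pos c) = 0

variable {S}

theorem posPrio_embed (p : A.Position) : A.expansion.posPrio (embed A p) = A.posPrio p := by
  rcases p with (e | x) | o <;> rfl

theorem acc_eq_of_silent {c d : S.Node} (h : Relation.ReflTransGen S.Silent c d) :
    S.acc d = S.acc c := by
  induction h with
  | refl => rfl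
  | tail _ h ih => rw [S.acc_of_step h.1, h.2, ih, max_eq_left (Fin.zero_le _)]

theorem exists_step_of_chainStep {c : S.Node} {y z : ChainNode A} (hyz : ChainStep y z)
    (hc : S.pos c = Sum.inl (Sum.inr y)) (hy : ¬ y.IsZero) :
    ∃ d, S.step c d ∧ S.pos d = Sum.inl (Sum.inr z) := by
  refine S.exists_step_of_move ?_
    ⟨_, _, edge_expansion_iff.2 (Or.inl ⟨y, z, hyz, rfl, rfl⟩), hc, rfl⟩
  rw [hc]
  rintro ⟨_, hy', h⟩
  cases h
  exact hy hy'

theorem exists_silent_of_chainIn {x : A.V} (k : Fin (A.inDegree x + 1)) {c : S.Node}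
    (hc : S.pos c = Sum.inl (Sum.inr (chainIn x k))) :
    ∃ d, Relation.ReflTransGen S.Silent c d ∧ S.pos d = Sum.inl (Sum.inr (.prio x)) := by
  induction k using Fin.reverseInduction generalizing c with
  | last => exact ⟨c, .refl, by simpa using hc⟩
  | cast j ih =>
    rw [chainIn_castSucc] at hc
    obtain ⟨c', hcc', hc'⟩ := exists_step_of_chainStep (.merge x j) hc id
    obtain ⟨d, hd, hpos⟩ := ih hc'
    exact ⟨d, .head ⟨hcc', hc ▸ rfl⟩ hd, hpos⟩

theorem exists_silent_of_arrival {c : S.Node} {s : Entries m n ⊕ A.V} {t : A.V ⊕ Exits m n}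
    {h : A.E s t} (hc : S.pos c = A.expansion.toPosition (arrival s t h)) :
    ∃ d, Relation.ReflTransGen S.Silent c d ∧ S.pos d = embed A (A.toPosition t) := by
  cases t with
  | inl x =>
    refine exists_silent_of_chainIn (Fin.castSucc (A.inEdge x ⟨s, h⟩)) ?_
    rwa [chainIn_castSucc]
  | inr o => exact ⟨c, .refl, hc⟩

theorem exists_silent_of_zero {x : A.V} (hx : x ∈ A.V₀) (k : Fin (A.outDegree x + 1)) {c : S.Node}
    (hc : S.pos c = Sum.inl (Sum.inr (chainOut x k))) :
    ∃ t, A.E (Sum.inr x) t ∧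
      ∃ d, Relation.ReflTransGen S.Silent c d ∧ S.pos d = embed A (A.toPosition t) := by
  induction k using Fin.reverseInduction generalizing c with
  | last =>
    rw [chainOut_last] at hc
    obtain ⟨d, hcd⟩ := S.exists_step_of_zero (c := c) ⟨.lose x, hx, hc.symm⟩
    obtain ⟨s, t, hE, hs, -⟩ := S.move_of_step hcd
    obtain rfl := Sum.inl_injective (hs.symm.trans hc)
    obtain ⟨y, z, hyz, hy, -⟩ | ⟨s, t, hst, hs, -⟩ := edge_expansion_iff.1 hE
    · cases hyz <;> cases hy
    · cases s <;> cases hs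
  | cast j ih =>
    rw [chainOut_castSucc] at hc
    obtain ⟨c', hcc'⟩ := S.exists_step_of_zero (c := c) ⟨.player x j, hx, hc.symm⟩
    have hsilent : S.Silent c c' := ⟨hcc', hc ▸ rfl⟩
    obtain ⟨s, t, hE, hs, ht⟩ := S.move_of_step hcc'
    obtain rfl := Sum.inl_injective (hs.symm.trans hc)
    obtain ⟨y, z, hyz, hy, rfl⟩ | ⟨s, t, hst, hs, rfl⟩ := edge_expansion_iff.1 hE
    · cases hyz <;> cases hy
      obtain ⟨t, hxt, d, hd, hpos⟩ := ih ht
      exact ⟨t, hxt, d, hd.head hsilent, hpos⟩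
    · cases s <;> cases hs
      obtain ⟨d, hd, hpos⟩ := exists_silent_of_arrival ht
      exact ⟨t, hst, d, hd.head hsilent, hpos⟩

theorem exists_silent_chainOut {x : A.V} (hx : x ∉ A.V₀) {c : S.Node}
    (hc : S.pos c = Sum.inl (Sum.inr (chainOut x 0))) (k : Fin (A.outDegree x + 1)) :
    ∃ d, Relation.ReflTransGen S.Silent c d ∧ S.pos d = Sum.inl (Sum.inr (chainOut x k)) := by
  induction k using Fin.induction with
  | zero => exact ⟨c, .refl, hc⟩
  | succ j ih =>
    obtain ⟨d, hcd, hd⟩ := ih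
    rw [chainOut_castSucc] at hd
    obtain ⟨d', hdd', hd'⟩ := exists_step_of_chainStep (.player x j) hd hx
    exact ⟨d', hcd.tail ⟨hdd', hd ▸ rfl⟩, hd'⟩

theorem exists_step_silent_of_departure {c : S.Node} {s : Entries m n ⊕ A.V} {t : A.V ⊕ Exits m n}
    (h : A.E s t) (hc : S.pos c = Sum.inl (departure s t h))
    (hzero : S.pos c ∉ A.expansion.zeroPositions) :
    ∃ c', S.step c c' ∧
      ∃ d, Relation.ReflTransGen S.Silent c' d ∧ S.pos d = embed A (A.toPosition t) := by
  obtain ⟨c', hcc', hc'⟩ := S.exists_step_of_move hzero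
    ⟨_, _, edge_expansion_iff.2 (Or.inr ⟨s, t, h, rfl, rfl⟩), hc, rfl⟩
  exact ⟨c', hcc', exists_silent_of_arrival hc'⟩

variable (S) in
/-- The steps between visits of positions of `A`: a step of `S` followed by silent ones. -/
def ContractStep (a b : S.Node × A.Position) : Prop :=
  A.Move a.2 b.2 ∧ ∃ c, S.step a.1 c ∧ Relation.ReflTransGen S.Silent c b.1

theorem exists_contractStep_of_zero {c : S.Node} {p : A.Position} (hc : S.pos c = embed A p)
    (hp : p ∈ A.zeroPositions) :
    ∃ b : S.Node × A.Position, S.pos b.1 = embed A b.2 ∧ S.ContractStep (c, p) b := by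
  obtain ⟨x, hx, rfl⟩ := hp
  obtain ⟨c', hcc', hc'⟩ := exists_step_of_chainStep (.prio x) hc id
  obtain ⟨t, hxt, d, hd, hpos⟩ := exists_silent_of_zero hx 0 hc'
  exact ⟨(d, _), hpos, ⟨_, _, hxt, rfl, rfl⟩, c', hcc', hd⟩

theorem exists_contractStep_of_move {c : S.Node} {p q : A.Position} (hc : S.pos c = embed A p)
    (hp : p ∉ A.zeroPositions) (hpq : A.Move p q) :
    ∃ d, S.pos d = embed A q ∧ S.ContractStep (c, p) (d, q) := by
  obtain ⟨s, t, hst, rfl, rfl⟩ := hpq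
  have hmove : A.Move (Sum.inl s) (A.toPosition t) := ⟨s, t, hst, rfl, rfl⟩
  rcases s with e | x
  · have hzero : S.pos c ∉ A.expansion.zeroPositions := by
      rw [hc]
      rintro ⟨y, -, hy⟩
      cases hy
    obtain ⟨c', hcc', d, hd, hpos⟩ := exists_step_silent_of_departure hst hc hzero
    exact ⟨d, hpos, hmove, c', hcc', hd⟩
  · have hx : x ∉ A.V₀ := fun hx => hp ⟨x, hx, rfl⟩
    obtain ⟨c₁, hcc₁, hc₁⟩ := exists_step_of_chainStep (.prio x) hc id
    obtain ⟨c₂, hc₁₂, hc₂⟩ :=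
      exists_silent_chainOut hx hc₁ (Fin.castSucc (A.outEdge x ⟨t, hst⟩))
    rw [chainOut_castSucc] at hc₂
    have hzero : S.pos c₂ ∉ A.expansion.zeroPositions := by
      rw [hc₂]
      rintro ⟨y, hy, hyx⟩
      cases hyx
      exact hx hy
    obtain ⟨c₃, hc₂₃, d, hd, hpos⟩ := exists_step_silent_of_departure hst hc₂ hzero
    exact ⟨d, hpos, hmove, c₁, hcc₁, hc₁₂.trans (hd.head ⟨hc₂₃, hc₂ ▸ rfl⟩)⟩

theorem satisfiesParity_contractStep : SatisfiesParity
    (fun a b : {a : S.Node × A.Position // S.pos a.1 = embed A a.2} => S.ContractStep a.1 b.1)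
    (fun a => A.posPrio a.1.2) := by
  have hprio (a : {a : S.Node × A.Position // S.pos a.1 = embed A a.2}) :
      A.expansion.posPrio (S.pos a.1.1) = A.posPrio a.1.2 := by
    rw [a.2, posPrio_embed]
  refine S.parity.of_descends (fun a => a.1.1) fun k _ a b ⟨ha, hb, hab⟩ =>
    ⟨(hprio a).trans ha, (hprio b).trans hb, Relation.TransGen.lift' (fun a => a.1.1) ?_ a b hab⟩
  rintro a b ⟨⟨-, c, hac, hcb⟩, hle⟩
  exact .head' ⟨hac, (hprio a).trans_le hle⟩
    (Relation.ReflTransGen.mono (fun _ _ h => ⟨h.1, h.2.trans_le k.zero_le⟩) _ _ hcb)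

variable (S) in
/-- The strategy graph on `A` obtained by observing `S` at the positions of `A`. -/
def contract : StrategyGraph A T i where
  Node := {a : S.Node × A.Position // S.pos a.1 = embed A a.2}
  root := ⟨(S.root, Sum.inl (Sum.inl i)), S.pos_root⟩
  pos a := a.1.2
  acc a := S.acc a.1.1
  step a b := S.ContractStep a.1 b.1
  pos_root := rfl
  acc_root := S.acc_root
  move_of_step h := h.1
  acc_of_step {a _} h := by
    obtain ⟨-, c, hac, hcb⟩ := h
    rw [acc_eq_of_silent hcb, S.acc_of_step hac, a.2, posPrio_embed]
  exists_step_of_zero {a} h :=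
    have ⟨b, hb, hab⟩ := exists_contractStep_of_zero a.2 h
    ⟨⟨b, hb⟩, hab⟩
  exists_step_of_move {a q} h hq :=
    have ⟨d, hd, had⟩ := exists_contractStep_of_move a.2 h hq
    ⟨⟨(d, q), hd⟩, had, rfl⟩
  mem_of_exit {a o} h := S.mem_of_exit (a.2.trans (congrArg (embed A) h))
  parity := satisfiesParity_contractStep

end Contract

end StrategyGraph

variable (A) in
theorem expansion_equivalent : Equivalent A.expansion A :=
  Set.ext fun _ => (mem_semantics_iff (A := A.expansion)).trans <| .trans
    ⟨fun ⟨S⟩ => ⟨S.contract⟩, fun ⟨S⟩ => ⟨S.expand⟩⟩ mem_semantics_iff.symm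

end OpenParityGame

/-! ### Edges of composites and products -/

section Feedback

variable {S T H : Type*} {R : S ⊕ H → T ⊕ H → Prop}

theorem eq_of_hidden_path {K : H → T} (hK : ∀ h y, R (Sum.inr h) y → Sum.elim id K y = K h)
    {h h' : H} {t : T} (hpath : Relation.ReflTransGen (fun a b => R (Sum.inr a) (Sum.inr b)) h h')
    (ht : R (Sum.inr h') (Sum.inl t)) : K h = t := by
  induction hpath using Relation.ReflTransGen.head_induction_on with
  | refl => exact (hK _ _ ht).symm
  | head hab _ ih => exact (hK _ _ hab).symm.trans ih

/-- A hidden path that starts at an edge from the outside cannot run into a cycle. As a source may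
have several outgoing edges, uniqueness is applied with the edges themselves as sources. -/
theorem exists_hidden_path [Finite H] (hout : ∀ h, ∃! x, R (Sum.inr h) x)
    (hin : ∀ h, ∃! x, R x (Sum.inr h)) {s : S} {h : H} (hs : R (Sum.inl s) (Sum.inr h)) :
    ∃ h' t, Relation.ReflTransGen (fun a b => R (Sum.inr a) (Sum.inr b)) h h' ∧
      R (Sum.inr h') (Sum.inl t) := by
  let R' : {p : S × (T ⊕ H) // R (Sum.inl p.1) p.2} ⊕ H → T ⊕ H → Prop :=
    fun x y => Sum.elim (fun p => y = p.1.2) (fun k => R (Sum.inr k) y) x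
  have hin' (k : H) : ∃! x, R' x (Sum.inr k) := by
    obtain ⟨s' | k', hx, hu⟩ := hin k
    · refine ⟨Sum.inl ⟨(s', Sum.inr k), hx⟩, rfl, ?_⟩
      rintro (⟨⟨s'', y⟩, hy⟩ | k'') hx'
      · obtain rfl : Sum.inr k = y := hx'
        cases hu _ hy
        rfl
      · cases hu _ hx'
    · refine ⟨Sum.inr k', hx, ?_⟩
      rintro (⟨⟨s'', y⟩, hy⟩ | k'') hx'
      · obtain rfl : Sum.inr k = y := hx'
        cases hu _ hy
      · exact congrArg Sum.inr (Sum.inr_injective (hu _ hx'))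
  obtain ⟨t, ht | ⟨k, h', hk, hpath, ht⟩, -⟩ :=
    feedback_existsUnique R' ⟨(s, Sum.inr h), hs⟩ ⟨_, rfl, fun _ h => h⟩ hout hin'
  · cases ht
  · cases hk
    exact ⟨h', t, hpath, ht⟩

theorem feedback_iff_of_invariant [Finite H] (hout : ∀ h, ∃! x, R (Sum.inr h) x)
    (hin : ∀ h, ∃! x, R x (Sum.inr h)) {K : H → T}
    (hK : ∀ h y, R (Sum.inr h) y → Sum.elim id K y = K h) (s : S) (t : T) :
    feedback R s t ↔ ∃ y, R (Sum.inl s) y ∧ Sum.elim id K y = t := by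
  constructor
  · rintro (ht | ⟨h, h', hs, hpath, ht⟩)
    · exact ⟨_, ht, rfl⟩
    · exact ⟨_, hs, eq_of_hidden_path hK hpath ht⟩
  · rintro ⟨y | h, hy, rfl⟩
    · exact Or.inl hy
    · obtain ⟨h', t, hpath, ht⟩ := exists_hidden_path hout hin hy
      obtain rfl := eq_of_hidden_path hK hpath ht
      exact Or.inr ⟨h, h', hy, hpath, ht⟩

end Feedback

namespace OpenParityGame

variable {M : ℕ} {m n o : Obj}

/-- The targets of the edges out of a source. -/
def targets (A : OpenParityGame.{u} M m n) (s : Entries m n ⊕ A.V) : Set (A.V ⊕ Exits m n) :=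
  {t | A.E s t}

theorem targets_entry (A : OpenParityGame.{u} M m n) (e : Entries m n) :
    A.targets (Sum.inl e) = {A.entryTarget e} :=
  Set.ext fun t => (A.entryTarget_eq_iff e t).symm.trans eq_comm

theorem entryTarget_eq_of_targets {M' : ℕ} {m' n' : Obj} {A : OpenParityGame.{u} M m n}
    {B : OpenParityGame.{v} M' m' n'} {e e'} {g : B.V ⊕ Exits m' n' → A.V ⊕ Exits m n}
    (h : A.targets (Sum.inl e) = g '' B.targets (Sum.inl e')) :
    A.entryTarget e = g (B.entryTarget e') := by
  rwa [targets_entry, targets_entry, Set.image_singleton, Set.singleton_eq_singleton_iff] at h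

theorem targets_cast {m' n' : Obj} (hm : m = m') (hn : n = n') (A : OpenParityGame.{u} M m n) :
    ∃ φ : A.V ≃ (A.cast hm hn).V, (∀ x, φ x ∈ (A.cast hm hn).V₀ ↔ x ∈ A.V₀) ∧
      (∀ x, (A.cast hm hn).prio (φ x) = A.prio x) ∧
      ∀ s, (A.cast hm hn).targets
          (Sum.map (Sum.map (finCongr (by rw [hm])) (finCongr (by rw [hn]))) φ s) =
        Sum.map φ (Sum.map (finCongr (by rw [hm])) (finCongr (by rw [hn]))) '' A.targets s := by
  subst hm hn
  refine ⟨Equiv.refl _, fun _ => Iff.rfl, fun _ => rfl, fun s => ?_⟩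
  change A.targets (Sum.map (Sum.map id id) id s) = Sum.map id (Sum.map id id) '' A.targets s
  simpa only [Sum.map_id_id, id] using (Set.image_id' _).symm

section Comp

variable {A : OpenParityGame.{u} M m n} {B : OpenParityGame.{u} M n o}

theorem compEdge_srcLeft_iff {a t} :
    compEdge A B (compSrcLeft A B a) t ↔ ∃ y, A.E a y ∧ compTgtLeft A B y = t := by
  constructor
  · rintro (⟨a', y, hE, ha, ht⟩ | ⟨b, y, -, hb, -⟩)
    · cases compSrcLeft_injective A B ha
      exact ⟨y, hE, ht⟩
    · exact absurd hb.symm (compSrc_ne A B _ _)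
  · rintro ⟨y, hE, ht⟩
    exact Or.inl ⟨a, y, hE, rfl, ht⟩

theorem compEdge_srcRight_iff {b t} :
    compEdge A B (compSrcRight A B b) t ↔ ∃ y, B.E b y ∧ compTgtRight A B y = t := by
  constructor
  · rintro (⟨a, y, -, ha, -⟩ | ⟨b', y, hE, hb, ht⟩)
    · exact absurd ha (compSrc_ne A B _ _)
    · cases compSrcRight_injective A B hb
      exact ⟨y, hE, ht⟩
  · rintro ⟨y, hE, ht⟩
    exact Or.inr ⟨b, y, hE, rfl, ht⟩

/-- The target in the composite of a target of `B`, where `back j` is the target that one reaches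
through the right-to-left wire `j`. -/
def rightTarget (back : Fin n.2 → (A.V ⊕ B.V) ⊕ Exits m o) :
    B.V ⊕ Exits n o → (A.V ⊕ B.V) ⊕ Exits m o :=
  Sum.elim (Sum.inl ∘ Sum.inr) (Sum.elim back (Sum.inr ∘ Sum.inr))

/-- The target in the composite of a target of `A`, given the targets that one reaches through the
right-to-left wires. -/
noncomputable def leftTarget (back : Fin n.2 → (A.V ⊕ B.V) ⊕ Exits m o) :
    A.V ⊕ Exits m n → (A.V ⊕ B.V) ⊕ Exits m o :=
  Sum.elim (Sum.inl ∘ Sum.inl) (Sum.elim (Sum.inr ∘ Sum.inl)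
    fun i => rightTarget back (B.entryTarget (Sum.inl i)))

variable {back : Fin n.2 → (A.V ⊕ B.V) ⊕ Exits m o}

theorem comp_edge_iff (hback : ∀ j, leftTarget back (A.entryTarget (Sum.inr j)) = back j) {s t} :
    (A.comp B).E s t ↔ ∃ y, compEdge A B (Sum.inl s) y ∧
      Sum.elim id (Sum.elim (fun i => rightTarget back (B.entryTarget (Sum.inl i))) back) y =
        t := by
  refine feedback_iff_of_invariant (compEdge_hidden_out A B) (compEdge_hidden_in A B) ?_ s t
  rintro (i | j) y h
  · obtain ⟨t, ht, rfl⟩ := (compEdge_srcRight_iff (b := Sum.inl (Sum.inl i))).1 h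
    change _ = rightTarget back (B.entryTarget (Sum.inl i))
    rw [(B.entryTarget_eq_iff _ t).2 ht]
    rcases t with x | j | k <;> rfl
  · obtain ⟨t, ht, rfl⟩ := (compEdge_srcLeft_iff (a := Sum.inl (Sum.inr j))).1 h
    refine Eq.trans ?_ (hback j)
    rw [(A.entryTarget_eq_iff _ t).2 ht]
    rcases t with x | j | k <;> rfl

theorem targets_comp_left (hback : ∀ j, leftTarget back (A.entryTarget (Sum.inr j)) = back j)
    {a s} (ha : compSrcLeft A B a = Sum.inl s) :
    (A.comp B).targets s = leftTarget back '' A.targets a := by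
  ext t
  refine (comp_edge_iff hback).trans ?_
  rw [← ha]
  simp only [compEdge_srcLeft_iff]
  constructor
  · rintro ⟨_, ⟨x | j | i, hE, rfl⟩, ht⟩ <;> exact ⟨_, hE, ht⟩
  · rintro ⟨x | j | i, hE, ht⟩ <;> exact ⟨_, ⟨_, hE, rfl⟩, ht⟩

theorem targets_comp_right (hback : ∀ j, leftTarget back (A.entryTarget (Sum.inr j)) = back j)
    {b s} (hb : compSrcRight A B b = Sum.inl s) :
    (A.comp B).targets s = rightTarget back '' B.targets b := by
  ext t
  refine (comp_edge_iff hback).trans ?_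
  rw [← hb]
  simp only [compEdge_srcRight_iff]
  constructor
  · rintro ⟨_, ⟨x | j | i, hE, rfl⟩, ht⟩ <;> exact ⟨_, hE, ht⟩
  · rintro ⟨x | j | i, hE, ht⟩ <;> exact ⟨_, ⟨_, hE, rfl⟩, ht⟩

theorem targets_comp_pass (hback : ∀ j, leftTarget back (A.entryTarget (Sum.inr j)) = back j)
    {i k} (hi : A.entryTarget (Sum.inl i) = Sum.inr (Sum.inr k)) :
    (A.comp B).targets (Sum.inl (Sum.inl i)) =
      rightTarget back '' B.targets (Sum.inl (Sum.inl k)) := by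
  refine (targets_comp_left hback (a := Sum.inl (Sum.inl i)) rfl).trans ?_
  rw [targets_entry, targets_entry, Set.image_singleton, Set.image_singleton, hi]
  rfl

theorem entryTarget_comp_right {i k r} (hA : A.entryTarget (Sum.inl i) = Sum.inr (Sum.inr k))
    (hB : B.entryTarget (Sum.inl k) = Sum.inr (Sum.inr r)) :
    (A.comp B).entryTarget (Sum.inl i) = Sum.inr (Sum.inr r) := by
  rw [entryTarget_eq_iff] at hA hB ⊢
  exact Or.inr ⟨Sum.inl k, Sum.inl k, Or.inl ⟨_, _, hA, rfl, rfl⟩, .refl,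
    Or.inr ⟨_, _, hB, rfl, rfl⟩⟩

theorem entryTarget_comp_left {j k l} (hB : B.entryTarget (Sum.inr j) = Sum.inr (Sum.inl k))
    (hA : A.entryTarget (Sum.inr k) = Sum.inr (Sum.inl l)) :
    (A.comp B).entryTarget (Sum.inr j) = Sum.inr (Sum.inl l) := by
  rw [entryTarget_eq_iff] at hA hB ⊢
  exact Or.inr ⟨Sum.inr k, Sum.inr k, Or.inr ⟨_, _, hB, rfl, rfl⟩, .refl,
    Or.inl ⟨_, _, hA, rfl, rfl⟩⟩

theorem entryTarget_comp_turn {i k l j} (hA : A.entryTarget (Sum.inl i) = Sum.inr (Sum.inr k))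
    (hB : B.entryTarget (Sum.inl k) = Sum.inr (Sum.inl l))
    (hA' : A.entryTarget (Sum.inr l) = Sum.inr (Sum.inl j)) :
    (A.comp B).entryTarget (Sum.inl i) = Sum.inr (Sum.inl j) := by
  rw [entryTarget_eq_iff] at hA hB hA' ⊢
  exact Or.inr ⟨Sum.inl k, Sum.inr l, Or.inl ⟨_, _, hA, rfl, rfl⟩,
    .single (Or.inr ⟨_, _, hB, rfl, rfl⟩), Or.inl ⟨_, _, hA', rfl, rfl⟩⟩

theorem entryTarget_comp_direct {i j} (hA : A.entryTarget (Sum.inl i) = Sum.inr (Sum.inl j)) :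
    (A.comp B).entryTarget (Sum.inl i) = Sum.inr (Sum.inl j) := by
  rw [entryTarget_eq_iff] at hA ⊢
  exact Or.inl (Or.inl ⟨_, _, hA, rfl, rfl⟩)

end Comp

section Tensor

variable {m₁ n₁ m₂ n₂ : Obj} {A : OpenParityGame.{u} M m₁ n₁} {B : OpenParityGame.{u} M m₂ n₂}

theorem targets_tensor_left {a s} (ha : tensorSrcLeft A B a = s) :
    (A.tensor B).targets s = tensorTgtLeft A B '' A.targets a := by
  subst ha
  ext t
  constructor
  · rintro (⟨a', y, hE, ha, ht⟩ | ⟨b, y, -, hb, -⟩)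
    · cases tensorSrcLeft_injective A B ha
      exact ⟨y, hE, ht⟩
    · exact absurd hb.symm (tensorSrc_ne A B _ _)
  · rintro ⟨y, hE, ht⟩
    exact Or.inl ⟨a, y, hE, rfl, ht⟩

theorem targets_tensor_right {b s} (hb : tensorSrcRight A B b = s) :
    (A.tensor B).targets s = tensorTgtRight A B '' B.targets b := by
  subst hb
  ext t
  constructor
  · rintro (⟨a, y, -, ha, -⟩ | ⟨b', y, hE, hb, ht⟩)
    · exact absurd ha (tensorSrc_ne A B _ _)
    · cases tensorSrcRight_injective A B hb
      exact ⟨y, hE, ht⟩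
  · rintro ⟨y, hE, ht⟩
    exact Or.inr ⟨b, y, hE, rfl, ht⟩

end Tensor

end OpenParityGame

/-! ### Wires of diagrams -/

/-- The wires of direction `c` in the interpretation of a word. -/
abbrev Wires (c : Dir) (v : List Dir) : Type :=
  match c with
  | .right => Fin (interp v).1
  | .left => Fin (interp v).2

namespace Wires

/-- The wires of a concatenation: those of the first word precede those of the second. -/
def append (c : Dir) (v w : List Dir) : Wires c v ⊕ Wires c w ≃ Wires c (v ++ w) :=
  match c with
  | .right => finSumFinEquiv.trans (finCongr (by rw [interp_append]; rfl))
  | .left => finSumFinEquiv.trans (finCongr (by rw [interp_append]; rfl))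

/-- The single wire of a word of length one. -/
def single (c : Dir) : Wires c [c] :=
  match c with
  | .right => (0 : Fin 1)
  | .left => (0 : Fin 1)

theorem eq_single {c : Dir} (i : Wires c [c]) : i = single c := by
  cases c <;> exact Subsingleton.elim (α := Fin 1) _ _

theorem append_nil_inr (c : Dir) (v : List Dir) (i : Wires c v) :
    append c [] v (Sum.inr i) = i := by
  cases c <;> exact Fin.ext (Nat.zero_add _)

theorem append_append_fst (c a b : Dir) (v : List Dir) (i) :
    append c ([a] ++ [b]) v (Sum.inl (append c [a] [b] (Sum.inl i))) =
      append c [a] ([b] ++ v) (Sum.inl i) := by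
  cases c <;> exact Fin.ext rfl

theorem append_append_snd (c a b : Dir) (v : List Dir) (i) :
    append c ([a] ++ [b]) v (Sum.inl (append c [a] [b] (Sum.inr i))) =
      append c [a] ([b] ++ v) (Sum.inr (append c [b] v (Sum.inl i))) := by
  cases c <;> exact Fin.ext rfl

theorem append_append_trd (c a b : Dir) (v : List Dir) (i) :
    append c ([a] ++ [b]) v (Sum.inr i) =
      append c [a] ([b] ++ v) (Sum.inr (append c [b] v (Sum.inr i))) := by
  cases c
  · refine Fin.ext (.trans ?_ (Nat.add_assoc (interp [a]).1 (interp [b]).1 i.val))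
    exact congrArg (·.1 + i.val) (interp_append [a] [b])
  · refine Fin.ext (.trans ?_ (Nat.add_assoc (interp [a]).2 (interp [b]).2 i.val))
    exact congrArg (·.2 + i.val) (interp_append [a] [b])

end Wires

namespace Diagram

open OpenParityGame

variable {M : ℕ}

/-- The map on sources given by maps on wires and on internal positions. -/
def sourceMap {v w v' w' : List Dir} {V V' : Type*} (f : ∀ a, Wires a v → Wires a v')
    (g : ∀ a, Wires a w → Wires a w') (ν : V → V') :
    Entries (interp v) (interp w) ⊕ V → Entries (interp v') (interp w') ⊕ V' :=
  Sum.map (Sum.map (f .right) (g .left)) ν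

/-- The map on targets given by maps on wires and on internal positions. -/
def targetMap {v w v' w' : List Dir} {V V' : Type*} (f : ∀ a, Wires a v → Wires a v')
    (g : ∀ a, Wires a w → Wires a w') (ν : V → V') :
    V ⊕ Exits (interp v) (interp w) → V' ⊕ Exits (interp v') (interp w') :=
  Sum.map ν (Sum.map (f .left) (g .right))

theorem exists_tensor_equiv {v₁ w₁ v₂ w₂ : List Dir} (c : Diagram M v₁ w₁) (d : Diagram M v₂ w₂) :
    ∃ φ : c.sem.V ⊕ d.sem.V ≃ (c.tensor d).sem.V,
      (∀ x, φ x ∈ (c.tensor d).sem.V₀ ↔ Sum.elim (· ∈ c.sem.V₀) (· ∈ d.sem.V₀) x) ∧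
      (∀ x, (c.tensor d).sem.prio (φ x) = Sum.elim c.sem.prio d.sem.prio x) ∧
      (∀ s, (c.tensor d).sem.targets (sourceMap (fun a => Wires.append a v₁ v₂ ∘ Sum.inl)
          (fun a => Wires.append a w₁ w₂ ∘ Sum.inl) (φ ∘ Sum.inl) s) =
        targetMap (fun a => Wires.append a v₁ v₂ ∘ Sum.inl)
          (fun a => Wires.append a w₁ w₂ ∘ Sum.inl) (φ ∘ Sum.inl) '' c.sem.targets s) ∧
      ∀ s, (c.tensor d).sem.targets (sourceMap (fun a => Wires.append a v₁ v₂ ∘ Sum.inr)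
          (fun a => Wires.append a w₁ w₂ ∘ Sum.inr) (φ ∘ Sum.inr) s) =
        targetMap (fun a => Wires.append a v₁ v₂ ∘ Sum.inr)
          (fun a => Wires.append a w₁ w₂ ∘ Sum.inr) (φ ∘ Sum.inr) '' d.sem.targets s := by
  obtain ⟨φ, hV₀, hprio, htargets⟩ := targets_cast (interp_append v₁ v₂).symm
    (interp_append w₁ w₂).symm (c.sem.tensor d.sem)
  refine ⟨φ, hV₀, hprio, fun s => ?_, fun s => ?_⟩
  · refine (Eq.trans ?_ (htargets (tensorSrcLeft c.sem d.sem s))).trans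
      ((congrArg _ (targets_tensor_left rfl)).trans ((Set.image_image _ _ _).trans ?_))
    · rcases s with (i | j) | x <;> rfl
    · refine Set.image_congr fun t _ => ?_
      rcases t with x | j | i <;> rfl
  · refine (Eq.trans ?_ (htargets (tensorSrcRight c.sem d.sem s))).trans
      ((congrArg _ (targets_tensor_right rfl)).trans ((Set.image_image _ _ _).trans ?_))
    · rcases s with (i | j) | x <;> rfl
    · refine Set.image_congr fun t _ => ?_
      rcases t with x | j | i <;> rfl

theorem entryTarget_tensor_fst {v₁ w₁ v₂ w₂ : List Dir} {c : Diagram M v₁ w₁} {e o}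
    (d : Diagram M v₂ w₂) (h : c.sem.entryTarget e = Sum.inr o) :
    (c.tensor d).sem.entryTarget (Sum.map (Wires.append .right v₁ v₂ ∘ Sum.inl)
        (Wires.append .left w₁ w₂ ∘ Sum.inl) e) =
      Sum.inr (Sum.map (Wires.append .left v₁ v₂ ∘ Sum.inl)
        (Wires.append .right w₁ w₂ ∘ Sum.inl) o) := by
  obtain ⟨φ, -, -, hfst, -⟩ := exists_tensor_equiv c d
  exact (entryTarget_eq_of_targets (hfst (Sum.inl e))).trans (congrArg _ h)

theorem entryTarget_tensor_snd {v₁ w₁ v₂ w₂ : List Dir} {d : Diagram M v₂ w₂} {e o}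
    (c : Diagram M v₁ w₁) (h : d.sem.entryTarget e = Sum.inr o) :
    (c.tensor d).sem.entryTarget (Sum.map (Wires.append .right v₁ v₂ ∘ Sum.inr)
        (Wires.append .left w₁ w₂ ∘ Sum.inr) e) =
      Sum.inr (Sum.map (Wires.append .left v₁ v₂ ∘ Sum.inr)
        (Wires.append .right w₁ w₂ ∘ Sum.inr) o) := by
  obtain ⟨φ, -, -, -, hsnd⟩ := exists_tensor_equiv c d
  exact (entryTarget_eq_of_targets (hsnd (Sum.inl e))).trans (congrArg _ h)

instance isEmpty_id (v : List Dir) : IsEmpty (Diagram.id (M := M) v).sem.V :=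
  inferInstanceAs (IsEmpty Empty)

instance isEmpty_swap (v w : List Dir) : IsEmpty (swap (M := M) v w).sem.V := by
  obtain ⟨φ, -⟩ := targets_cast (interp_append v w).symm (interp_append w v).symm
    (swapGame M (interp v) (interp w))
  exact φ.isEmpty_congr.1 (inferInstanceAs (IsEmpty Empty))

instance isEmpty_comp {u v w : List Dir} (c : Diagram M u v) (d : Diagram M v w)
    [IsEmpty c.sem.V] [IsEmpty d.sem.V] : IsEmpty (c.comp d).sem.V :=
  inferInstanceAs (IsEmpty (c.sem.V ⊕ d.sem.V))

instance isEmpty_tensor {v₁ w₁ v₂ w₂ : List Dir} (c : Diagram M v₁ w₁) (d : Diagram M v₂ w₂)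
    [IsEmpty c.sem.V] [IsEmpty d.sem.V] : IsEmpty (c.tensor d).sem.V := by
  obtain ⟨φ, -⟩ := exists_tensor_equiv c d
  exact φ.isEmpty_congr.1 inferInstance

/-- The diagram `X` joins the wire `i` of its domain directly to the wire `j` of its codomain, in
the direction `c` of these wires. -/
def Joins {v w : List Dir} (X : Diagram M v w) (c : Dir) (i : Wires c v) (j : Wires c w) : Prop :=
  match c with
  | .right => X.sem.entryTarget (Sum.inl i) = Sum.inr (Sum.inr j)
  | .left => X.sem.entryTarget (Sum.inr j) = Sum.inr (Sum.inl i)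

theorem joins_id (v : List Dir) (c : Dir) (i : Wires c v) :
    (Diagram.id (M := M) v).Joins c i i := by
  cases c <;> exact (entryTarget_eq_iff _ _ _).2 rfl

theorem Joins.comp {u v w : List Dir} {X : Diagram M u v} {Y : Diagram M v w} {c : Dir} {i j k}
    (hX : X.Joins c i j) (hY : Y.Joins c j k) : (X.comp Y).Joins c i k := by
  cases c
  · exact entryTarget_comp_right hX hY
  · exact entryTarget_comp_left hY hX

theorem joins_swap (v w : List Dir) (c : Dir) (i : Wires c v ⊕ Wires c w) :
    (swap (M := M) v w).Joins c (Wires.append c v w i) (Wires.append c w v i.swap) := by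
  obtain ⟨φ, -, -, htargets⟩ := targets_cast (interp_append v w).symm (interp_append w v).symm
    (swapGame M (interp v) (interp w))
  cases c
  · refine (entryTarget_eq_iff _ _ _).2 ((htargets (Sum.inl (Sum.inl (finSumFinEquiv i)))).ge
      ⟨Sum.inr (Sum.inr (finSumFinEquiv i.swap)), congrArg Sum.inr ?_, rfl⟩)
    rcases i with i | i
    · exact finAddFlip_apply_castAdd _ _
    · exact finAddFlip_apply_natAdd _ _
  · refine (entryTarget_eq_iff _ _ _).2 ((htargets (Sum.inl (Sum.inr (finSumFinEquiv i.swap)))).ge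
      ⟨Sum.inr (Sum.inl (finSumFinEquiv i)), congrArg Sum.inl ?_, rfl⟩)
    rcases i with i | i
    · exact finAddFlip_apply_natAdd _ _
    · exact finAddFlip_apply_castAdd _ _

theorem Joins.tensor_fst {v₁ w₁ v₂ w₂ : List Dir} {X : Diagram M v₁ w₁} {c : Dir} {i j}
    (hX : X.Joins c i j) (Y : Diagram M v₂ w₂) :
    (X.tensor Y).Joins c (Wires.append c v₁ v₂ (Sum.inl i))
      (Wires.append c w₁ w₂ (Sum.inl j)) := by
  cases c <;> exact entryTarget_tensor_fst Y hX

theorem Joins.tensor_snd {v₁ w₁ v₂ w₂ : List Dir} {Y : Diagram M v₂ w₂} {c : Dir} {i j}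
    (hY : Y.Joins c i j) (X : Diagram M v₁ w₁) :
    (X.tensor Y).Joins c (Wires.append c v₁ v₂ (Sum.inr i))
      (Wires.append c w₁ w₂ (Sum.inr j)) := by
  cases c <;> exact entryTarget_tensor_snd X hY

/-- Some diagram without internal positions realizes the bijections `ρ` of the wires of two
words. -/
def IsPerm (M : ℕ) (v v' : List Dir) (ρ : ∀ c, Wires c v ≃ Wires c v') : Prop :=
  ∃ X : Diagram M v v', IsEmpty X.sem.V ∧ ∀ c i, X.Joins c i (ρ c i)

theorem IsPerm.refl (v : List Dir) : IsPerm M v v fun _ => Equiv.refl _ :=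
  ⟨Diagram.id v, inferInstance, joins_id v⟩

theorem IsPerm.trans {v v' v'' : List Dir} {ρ ρ'} (h : IsPerm M v v' ρ)
    (h' : IsPerm M v' v'' ρ') : IsPerm M v v'' fun c => (ρ c).trans (ρ' c) := by
  obtain ⟨X, _, hX⟩ := h
  obtain ⟨X', _, hX'⟩ := h'
  exact ⟨X.comp X', inferInstance, fun c i => (hX c i).comp (hX' c _)⟩

theorem IsPerm.swap (v w : List Dir) : IsPerm M (v ++ w) (w ++ v) fun c =>
    (Wires.append c v w).symm.trans ((Equiv.sumComm _ _).trans (Wires.append c w v)) := by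
  refine ⟨Diagram.swap v w, inferInstance, fun c i => ?_⟩
  obtain ⟨i, rfl⟩ := (Wires.append c v w).surjective i
  simpa using joins_swap v w c i

theorem IsPerm.tensor {v v' w w' : List Dir} {ρ ρ'} (h : IsPerm M v v' ρ)
    (h' : IsPerm M w w' ρ') : IsPerm M (v ++ w) (v' ++ w') fun c =>
    (Wires.append c v w).symm.trans (((ρ c).sumCongr (ρ' c)).trans (Wires.append c v' w')) := by
  obtain ⟨X, _, hX⟩ := h
  obtain ⟨X', _, hX'⟩ := h'
  refine ⟨X.tensor X', inferInstance, fun c i => ?_⟩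
  obtain ⟨i | i, rfl⟩ := (Wires.append c v w).surjective i
  · simpa using (hX c i).tensor_fst X'
  · simpa using (hX' c i).tensor_snd X

theorem exists_perm_front {c : Dir} {v : List Dir} (r : Wires c v) : ∃ v' ρ,
    IsPerm M v ([c] ++ v') ρ ∧ ρ c r = Wires.append c [c] v' (Sum.inl (Wires.single c)) := by
  induction v with
  | nil => cases c <;> exact r.elim0
  | cons a v ih =>
    obtain ⟨r | r, rfl⟩ := (Wires.append c [a] v).surjective r
    · obtain rfl : a = c := by
        cases a <;> cases c <;> first | rfl | exact Fin.elim0 r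
      exact ⟨v, _, IsPerm.refl _,
        congrArg (fun i => Wires.append a [a] v (Sum.inl i)) (Wires.eq_single r)⟩
    · obtain ⟨v', ρ, hρ, hr⟩ := ih r
      refine ⟨[a] ++ v', _, ((IsPerm.refl [a]).tensor hρ).trans
        ((IsPerm.swap [a] [c]).tensor (IsPerm.refl v')), ?_⟩
      simp only [Equiv.trans_apply, Equiv.symm_apply_apply, Equiv.sumCongr_apply, Sum.map_inr, hr]
      refine (congrArg _ (congrArg _ (congrArg _ (Wires.append_append_snd c a c v' _).symm))).trans
        (Eq.trans ?_ (Wires.append_append_fst c c a v' _))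
      simp

theorem exists_perm_cap {v : List Dir} (l : Wires .left v) (r : Wires .right v) : ∃ v' ρ,
    IsPerm M v ([.left, .right] ++ v') ρ ∧
      ρ .left l = Wires.append .left [.left, .right] v' (Sum.inl (0 : Fin 1)) ∧
      ρ .right r = Wires.append .right [.left, .right] v' (Sum.inl (0 : Fin 1)) := by
  obtain ⟨v₁, ρ, hρ, hl⟩ := exists_perm_front (M := M) l
  obtain ⟨r' | r', hr'⟩ := (Wires.append .right [.left] v₁).surjective (ρ .right r)
  · exact Fin.elim0 r'
  obtain ⟨v₂, ρ', hρ', hr⟩ := exists_perm_front (M := M) r'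
  refine ⟨v₂, _, hρ.trans ((IsPerm.refl [.left]).tensor hρ'), ?_, ?_⟩
  · simp only [Equiv.trans_apply, hl, Equiv.symm_apply_apply]
    exact (Wires.append_append_fst .left .left .right v₂ _).symm
  · simp only [Equiv.trans_apply, ← hr', Equiv.symm_apply_apply, Equiv.sumCongr_apply,
      Sum.map_inr, hr]
    exact (Wires.append_append_snd .right .left .right v₂ _).symm

/-- Some diagram without internal positions joins the left-to-right wires of `v` to its
right-to-left wires as prescribed by `f`. -/
def IsMatching (M : ℕ) (v : List Dir) (f : Wires .right v → Wires .left v) : Prop :=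
  ∃ X : Diagram M v [], IsEmpty X.sem.V ∧
    ∀ i, X.sem.entryTarget (Sum.inl i) = Sum.inr (Sum.inl (f i))

theorem IsPerm.isMatching {v v' : List Dir} {ρ} (h : IsPerm M v v' ρ)
    {f : Wires .right v → Wires .left v}
    (h' : IsMatching M v' (ρ .left ∘ f ∘ (ρ .right).symm)) : IsMatching M v f := by
  obtain ⟨X, _, hX⟩ := h
  obtain ⟨Y, _, hY⟩ := h'
  refine ⟨X.comp Y, inferInstance, fun i => ?_⟩
  have hturn := hY (ρ .right i)
  simp only [Function.comp_apply, Equiv.symm_apply_apply] at hturn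
  exact entryTarget_comp_turn (hX .right i) hturn (hX .left (f i))

theorem isMatching_cap {v : List Dir} {f : Wires .right ([.left, .right] ++ v) →
    Wires .left ([.left, .right] ++ v)} {g : Wires .right v → Wires .left v}
    (hcap : f (Wires.append .right [.left, .right] v (Sum.inl (0 : Fin 1))) =
      Wires.append .left [.left, .right] v (Sum.inl (0 : Fin 1)))
    (hf : ∀ i, f (Wires.append .right [.left, .right] v (Sum.inr i)) =
      Wires.append .left [.left, .right] v (Sum.inr (g i)))
    (hg : IsMatching M v g) : IsMatching M ([.left, .right] ++ v) f := by
  obtain ⟨Y, _, hY⟩ := hg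
  let C : Diagram M [.left, .right] [] := gen .cap
  have _ : IsEmpty C.sem.V := inferInstanceAs (IsEmpty Empty)
  refine ⟨(C.tensor (Diagram.id v)).comp Y, inferInstance, fun i => ?_⟩
  obtain ⟨i | i, rfl⟩ := (Wires.append .right [.left, .right] v).surjective i
  · obtain rfl : i = (0 : Fin 1) := Subsingleton.elim (α := Fin 1) _ _
    rw [hcap]
    have hC : C.sem.entryTarget (Sum.inl (0 : Fin 1)) = Sum.inr (Sum.inl (0 : Fin 1)) :=
      (entryTarget_eq_iff _ _ _).2 rfl
    exact entryTarget_comp_direct (entryTarget_tensor_fst (Diagram.id v) hC)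
  · rw [hf]
    refine entryTarget_comp_turn ((joins_id v .right i).tensor_snd C) ?_
      ((joins_id v .left (g i)).tensor_snd C)
    rw [Wires.append_nil_inr, Wires.append_nil_inr]
    exact hY i

theorem eq_nil_of_interp {v : List Dir} (hfst : (interp v).1 = 0) (hsnd : (interp v).2 = 0) :
    v = [] := by
  match v with
  | [] => rfl
  | .right :: v => exact absurd hfst (by change 1 + (interp v).1 ≠ 0; omega)
  | .left :: v => exact absurd hsnd (by change 1 + (interp v).2 ≠ 0; omega)

theorem isMatching_of_injective {k : ℕ} {v : List Dir} (hright : (interp v).1 = k)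
    (hleft : (interp v).2 = k) {f : Wires .right v → Wires .left v} (hf : f.Injective) :
    IsMatching M v f := by
  induction k generalizing v with
  | zero =>
    obtain rfl := eq_nil_of_interp hright hleft
    exact ⟨Diagram.id [], inferInstance, fun i => i.elim0⟩
  | succ k ih =>
    let r : Wires .right v := ⟨0, by omega⟩
    obtain ⟨v', ρ, hρ, hl, hr⟩ := exists_perm_cap (M := M) (f r) r
    refine hρ.isMatching ?_
    set f' := ρ .left ∘ f ∘ (ρ .right).symm with hf'
    have hinj : f'.Injective := (ρ .left).injective.comp (hf.comp (ρ .right).symm.injective)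
    have hcap : f' (Wires.append .right [.left, .right] v' (Sum.inl (0 : Fin 1))) =
        Wires.append .left [.left, .right] v' (Sum.inl (0 : Fin 1)) := by
      rw [← hr, ← hl, hf', Function.comp_apply, Function.comp_apply, Equiv.symm_apply_apply]
    have hrest : ∀ i, ∃ j, Wires.append .left [.left, .right] v' (Sum.inr j) =
        f' (Wires.append .right [.left, .right] v' (Sum.inr i)) := by
      intro i
      obtain ⟨j | j, hj⟩ := (Wires.append .left [.left, .right] v').surjective
        (f' (Wires.append .right [.left, .right] v' (Sum.inr i)))
      · obtain rfl : j = (0 : Fin 1) := Subsingleton.elim (α := Fin 1) _ _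
        cases (Wires.append .right _ v').injective (hinj (hcap.trans hj))
      · exact ⟨j, hj⟩
    choose g hg using hrest
    refine isMatching_cap hcap (fun i => (hg i).symm) (ih ?_ ?_ fun i i' hi => ?_)
    · have hcard := Fin.equiv_iff_eq.1 ⟨ρ .right⟩
      have hcons : (interp ([.left, .right] ++ v')).1 = 0 + (1 + (interp v').1) := rfl
      omega
    · have hcard := Fin.equiv_iff_eq.1 ⟨ρ .left⟩
      have hcons : (interp ([.left, .right] ++ v')).2 = 1 + (0 + (interp v').2) := rfl
      omega
    · exact Sum.inr_injective ((Wires.append .right _ v').injective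
        (hinj ((hg i).symm.trans ((congrArg _ (congrArg _ hi)).trans (hg i')))))

end Diagram

open OpenParityGame
open ParityGames.Diagram hiding id

variable {M : ℕ}

section Attach

variable {u v w : List Dir}

/-- The diagram `Y` with the initial wires `u` of its domain connected to `C`. -/
def Diagram.attach (C : Diagram M [] u) (Y : Diagram M (u ++ v) w) : Diagram M v w :=
  (C.tensor (Diagram.id v)).comp Y

/-- The target in `attach C Y` of a target of `Y`, where `back j` is the target that one reaches
through the right-to-left wire `j` between `C` and `Y`. -/
def attachRight {V W : Type*} (back : Wires .left u → (V ⊕ W) ⊕ Exits (interp v) (interp w)) :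
    W ⊕ Exits (interp (u ++ v)) (interp w) → (V ⊕ W) ⊕ Exits (interp v) (interp w) :=
  Sum.elim (Sum.inl ∘ Sum.inr) (Sum.elim
    (Sum.elim back (Sum.inr ∘ Sum.inl) ∘ (Wires.append .left u v).symm) (Sum.inr ∘ Sum.inr))

/-- The target in `attach C Y` of a target of `C`, given the targets that one reaches through the
right-to-left wires between `C` and `Y`. -/
noncomputable def attachLeft {V : Type*} (Y : Diagram M (u ++ v) w)
    (back : Wires .left u → (V ⊕ Y.sem.V) ⊕ Exits (interp v) (interp w)) :
    V ⊕ Exits (interp []) (interp u) → (V ⊕ Y.sem.V) ⊕ Exits (interp v) (interp w) :=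
  Sum.elim (Sum.inl ∘ Sum.inl) (Sum.elim Fin.elim0 fun i =>
    attachRight back (Y.sem.entryTarget (Sum.inl (Wires.append .right u v (Sum.inl i)))))

@[simp]
theorem attachRight_back {V W : Type*}
    (back : Wires .left u → (V ⊕ W) ⊕ Exits (interp v) (interp w)) (j) :
    attachRight back (Sum.inr (Sum.inl (Wires.append .left u v (Sum.inl j)))) = back j := by
  simp [attachRight]

@[simp]
theorem attachRight_left {V W : Type*}
    (back : Wires .left u → (V ⊕ W) ⊕ Exits (interp v) (interp w)) (j) :
    attachRight back (Sum.inr (Sum.inl (Wires.append .left u v (Sum.inr j)))) =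
      Sum.inr (Sum.inl j) := by
  simp [attachRight]

theorem exists_tensor_id_equiv (C : Diagram M [] u) (v : List Dir) :
    ∃ ψ : C.sem.V ≃ (C.tensor (Diagram.id v)).sem.V,
      (∀ x, ψ x ∈ (C.tensor (Diagram.id v)).sem.V₀ ↔ x ∈ C.sem.V₀) ∧
      (∀ x, (C.tensor (Diagram.id v)).sem.prio (ψ x) = C.sem.prio x) ∧
      (∀ x, (C.tensor (Diagram.id v)).sem.targets (Sum.inr (ψ x)) =
        Sum.map ψ (Sum.map Fin.elim0 (Wires.append .right u v ∘ Sum.inl)) ''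
          C.sem.targets (Sum.inr x)) ∧
      (∀ j, (C.tensor (Diagram.id v)).sem.entryTarget
          (Sum.inr (Wires.append .left u v (Sum.inl j))) =
        Sum.map ψ (Sum.map Fin.elim0 (Wires.append .right u v ∘ Sum.inl))
          (C.sem.entryTarget (Sum.inr j))) ∧
      ∀ c i, (C.tensor (Diagram.id v)).Joins c i (Wires.append c u v (Sum.inr i)) := by
  obtain ⟨ψ, hV₀, hprio, hfst, -⟩ := exists_tensor_equiv C (Diagram.id v)
  have _ : IsEmpty (Diagram.id (M := M) v).sem.V := inferInstance
  have helim : Wires.append .left [] v ∘ Sum.inl = Fin.elim0 := funext fun i => i.elim0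
  rw [targetMap, helim] at hfst
  refine ⟨(Equiv.sumEmpty _ _).symm.trans ψ, fun x => hV₀ (Sum.inl x), fun x => hprio (Sum.inl x),
    fun x => hfst (Sum.inr x), fun j =>
      entryTarget_eq_of_targets (hfst (Sum.inl (Sum.inr j))), fun c i => ?_⟩
  have := (joins_id (M := M) v c i).tensor_snd C
  rwa [Wires.append_nil_inr] at this

theorem exists_attach_equiv (C : Diagram M [] u) (Y : Diagram M (u ++ v) w) :
    ∃ φ : C.sem.V ⊕ Y.sem.V ≃ (C.attach Y).sem.V,
      (∀ x, φ x ∈ (C.attach Y).sem.V₀ ↔ Sum.elim (· ∈ C.sem.V₀) (· ∈ Y.sem.V₀) x) ∧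
      (∀ x, (C.attach Y).sem.prio (φ x) = Sum.elim C.sem.prio Y.sem.prio x) ∧
      ∀ back, (∀ j, attachLeft Y back (C.sem.entryTarget (Sum.inr j)) = back j) →
        (∀ x, (C.attach Y).sem.targets (Sum.inr (φ (Sum.inl x))) =
          Sum.map φ id '' (attachLeft Y back '' C.sem.targets (Sum.inr x))) ∧
        ∀ s, (C.attach Y).sem.targets (Sum.map id (φ ∘ Sum.inr) s) =
          Sum.map φ id '' (attachRight back '' Y.sem.targets
            (Sum.map (Sum.map (Wires.append .right u v ∘ Sum.inr) id) id s)) := by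
  obtain ⟨ψ, hV₀, hprio, hψ, hentry, hjoins⟩ := exists_tensor_id_equiv C v
  let X : Diagram M v (u ++ v) := C.tensor (Diagram.id v)
  let φ : C.sem.V ⊕ Y.sem.V ≃ X.sem.V ⊕ Y.sem.V := ψ.sumCongr (Equiv.refl _)
  refine ⟨φ, ?_, ?_, fun back hback => ?_⟩
  · rintro (x | y)
    exacts [hV₀ x, Iff.rfl]
  · rintro (x | y)
    exacts [hprio x, rfl]
  let back' : Wires .left (u ++ v) → (X.sem.V ⊕ Y.sem.V) ⊕ Exits (interp v) (interp w) :=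
    Sum.elim (Sum.map φ id ∘ back) (Sum.inr ∘ Sum.inl) ∘ (Wires.append .left u v).symm
  have hright (t) : rightTarget (A := X.sem) (B := Y.sem) back' t =
      Sum.map φ id (attachRight back t) := by
    rcases t with y | j | i
    · rfl
    · obtain ⟨j | j, rfl⟩ := (Wires.append .left u v).surjective j <;>
        simp [rightTarget, attachRight, back']
    · rfl
  have hleft (t) : leftTarget (A := X.sem) (B := Y.sem) back'
      (Sum.map ψ (Sum.map Fin.elim0 (Wires.append .right u v ∘ Sum.inl)) t) =
        Sum.map φ id (attachLeft Y back t) := by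
    rcases t with x | j | i
    exacts [rfl, j.elim0, hright _]
  have hback' (j) : leftTarget (A := X.sem) (B := Y.sem) back' (X.sem.entryTarget (Sum.inr j)) =
      back' j := by
    obtain ⟨j | j, rfl⟩ := (Wires.append .left u v).surjective j
    · refine (congrArg _ (hentry j)).trans ((hleft _).trans ?_)
      simp [hback, back']
    · refine (congrArg _ (hjoins .left j)).trans ?_
      simp [leftTarget, back']
  simp only [Set.image_image]
  refine ⟨fun x => ?_, fun s => Eq.trans ?_ (Set.image_congr fun t _ => hright t)⟩
  · exact (targets_comp_left hback' (a := Sum.inr (ψ x)) rfl).trans ((congrArg _ (hψ x)).trans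
      ((Set.image_image _ _ _).trans (Set.image_congr fun t _ => hleft t)))
  · rcases s with (i | j) | y
    · exact targets_comp_pass hback' (hjoins .right i)
    · exact targets_comp_right hback' (b := Sum.inl (Sum.inr j)) rfl
    · exact targets_comp_right hback' (b := Sum.inr y) rfl

end Attach

/-! ### Games realized by diagrams -/

/-- Some diagram `v → w` is interpreted, up to renaming its internal positions, by the game with
these owners, priorities and edges. -/
def Realizable {V : Type*} (v w : List Dir) (own : Set V) (pr : V → Fin (M + 1))
    (E : Entries (interp v) (interp w) ⊕ V → V ⊕ Exits (interp v) (interp w) → Prop) : Prop :=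
  ∃ d : Diagram M v w, ∃ κ : d.sem.V ≃ V, (∀ x, x ∈ d.sem.V₀ ↔ κ x ∈ own) ∧
    (∀ x, d.sem.prio x = pr (κ x)) ∧ Relation.Map d.sem.E (Sum.map id κ) (Sum.map κ id) = E

theorem edge_eq_map {m n m' n' : Obj} {A : OpenParityGame.{u} M m n}
    {B : OpenParityGame.{v} M m' n'} {f : Entries m' n' ⊕ B.V → Entries m n ⊕ A.V}
    {g : B.V ⊕ Exits m' n' → A.V ⊕ Exits m n} (hf : f.Surjective)
    (h : ∀ s, A.targets (f s) = g '' B.targets s) : A.E = Relation.Map B.E f g := by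
  ext s t
  constructor
  · obtain ⟨s, rfl⟩ := hf s
    intro hst
    obtain ⟨t', ht', rfl⟩ := (h s).le hst
    exact ⟨s, t', ht', rfl, rfl⟩
  · rintro ⟨s, t, hst, rfl, rfl⟩
    exact (h s).ge ⟨t, hst, rfl⟩

/-! ### Bending wires -/

section BendEquiv

variable {A B C A' P Q : Type*}

/-- Moving a block of wires from one end of an interface to the other. -/
def bendEquiv (e : A ⊕ B ≃ P) (e' : A' ⊕ C ≃ Q) (δ : A ≃ A') : P ⊕ C ≃ B ⊕ Q :=
  (e.symm.sumCongr (Equiv.refl C)).trans <| ((Equiv.sumComm A B).sumCongr (Equiv.refl C)).trans <|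
    (Equiv.sumAssoc B A C).trans <| (Equiv.refl B).sumCongr <|
      (δ.sumCongr (Equiv.refl C)).trans e'

variable (e : A ⊕ B ≃ P) (e' : A' ⊕ C ≃ Q) (δ : A ≃ A')

@[simp]
theorem bendEquiv_moved (a : A) :
    bendEquiv e e' δ (Sum.inl (e (Sum.inl a))) = Sum.inr (e' (Sum.inl (δ a))) := by
  simp [bendEquiv]

@[simp]
theorem bendEquiv_left (b : B) : bendEquiv e e' δ (Sum.inl (e (Sum.inr b))) = Sum.inl b := by
  simp [bendEquiv]

@[simp]
theorem bendEquiv_right (c : C) : bendEquiv e e' δ (Sum.inr c) = Sum.inr (e' (Sum.inr c)) := by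
  simp [bendEquiv]

end BendEquiv

/-- The opposite direction. -/
def dual : Dir → Dir
  | .right => .left
  | .left => .right

/-- Bending a wire reverses its direction. -/
def dualWires (a c : Dir) : Wires a [dual c] ≃ Wires (dual a) [c] :=
  match a, c with
  | .right, .right | .left, .left => Equiv.refl (Fin 0)
  | .right, .left | .left, .right => Equiv.refl (Fin 1)

/-- The entries of a diagram `dual c :: v → w` as those of the diagram `v → c :: w` obtained by
bending a wire. -/
def bendEntries (c : Dir) (v w : List Dir) :
    Entries (interp ([dual c] ++ v)) (interp w) ≃ Entries (interp v) (interp ([c] ++ w)) :=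
  bendEquiv (Wires.append .right [dual c] v) (Wires.append .left [c] w) (dualWires .right c)

/-- The exits of a diagram `dual c :: v → w` as those of the diagram `v → c :: w` obtained by
bending a wire. -/
def bendExits (c : Dir) (v w : List Dir) :
    Exits (interp ([dual c] ++ v)) (interp w) ≃ Exits (interp v) (interp ([c] ++ w)) :=
  bendEquiv (Wires.append .left [dual c] v) (Wires.append .right [c] w) (dualWires .left c)

/-- The diagram `C` creates a wire of direction `c` and a wire of the opposite direction that are
joined to each other. -/
structure IsCup {c : Dir} (C : Diagram M [] ([c] ++ [dual c])) : Prop where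
  isEmpty : IsEmpty C.sem.V
  entryTarget_fst (k) : C.sem.entryTarget
      (Sum.inr (Wires.append .left [c] [dual c] (Sum.inl (dualWires .right c k)))) =
    Sum.inr (Sum.inr (Wires.append .right [c] [dual c] (Sum.inr k)))
  entryTarget_snd (k) : C.sem.entryTarget
      (Sum.inr (Wires.append .left [c] [dual c] (Sum.inr k))) =
    Sum.inr (Sum.inr (Wires.append .right [c] [dual c] (Sum.inl (dualWires .left c k))))

theorem exists_isCup (M : ℕ) (c : Dir) : ∃ C : Diagram M [] ([c] ++ [dual c]), IsCup C := by
  have exit_unique (C : Diagram M [] ([c] ++ [dual c])) (hC : IsEmpty C.sem.V) (e i) :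
      C.sem.entryTarget e = Sum.inr (Sum.inr i) := by
    rcases C.sem.entryTarget e with x | k | i'
    · exact hC.elim x
    · exact k.elim0
    · cases c <;> exact congrArg (Sum.inr ∘ Sum.inr) (Subsingleton.elim (α := Fin 1) _ _)
  have hcup : IsEmpty (gen (M := M) .cup).sem.V := inferInstanceAs (IsEmpty Empty)
  obtain ⟨C, hC⟩ : ∃ C : Diagram M [] ([c] ++ [dual c]), IsEmpty C.sem.V := by
    cases c
    · exact ⟨gen .cup, hcup⟩
    · exact ⟨(gen .cup).comp (swap [.right] [.left]),
        isEmpty_comp (gen .cup) (swap [.right] [.left])⟩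
  exact ⟨C, hC, fun k => exit_unique C hC _ _, fun k => exit_unique C hC _ _⟩

section Bend

variable {c : Dir} {v w : List Dir}

/-- The diagram `d` with a wire added in front, arranged so that a cup can join this wire to the
first wire of `d`. -/
def Diagram.besideWire (d : Diagram M ([dual c] ++ v) w) :
    Diagram M (([c] ++ [dual c]) ++ v) ([c] ++ w) :=
  (Diagram.id [c]).tensor d

theorem exists_besideWire_equiv (d : Diagram M ([dual c] ++ v) w) :
    ∃ ψ : d.sem.V ≃ d.besideWire.sem.V,
      (∀ x, ψ x ∈ d.besideWire.sem.V₀ ↔ x ∈ d.sem.V₀) ∧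
      (∀ x, d.besideWire.sem.prio (ψ x) = d.sem.prio x) ∧
      ∀ s, d.besideWire.sem.targets (sourceMap
          (fun a => Wires.append a [c] ([dual c] ++ v) ∘ Sum.inr)
          (fun a => Wires.append a [c] w ∘ Sum.inr) ψ s) =
        targetMap (fun a => Wires.append a [c] ([dual c] ++ v) ∘ Sum.inr)
          (fun a => Wires.append a [c] w ∘ Sum.inr) ψ '' d.sem.targets s := by
  obtain ⟨ψ, hV₀, hprio, -, hsnd⟩ := exists_tensor_equiv (Diagram.id (M := M) [c]) d
  exact ⟨(Equiv.emptySum (Diagram.id (M := M) [c]).sem.V _).symm.trans ψ,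
    fun x => hV₀ (Sum.inr x), fun x => hprio (Sum.inr x), hsnd⟩

/-- The target reached through each of the bent wires. -/
noncomputable def bendBack {V : Type*} (d : Diagram M ([dual c] ++ v) w) (ν : d.sem.V → V) :
    Wires .left ([c] ++ [dual c]) → V ⊕ Exits (interp v) (interp ([c] ++ w)) :=
  Sum.elim (fun k => Sum.map ν (bendExits c v w) (d.sem.entryTarget
      (Sum.inl (Wires.append .right [dual c] v (Sum.inl ((dualWires .right c).symm k))))))
    (fun k => Sum.inr (Sum.inr (Wires.append .right [c] w (Sum.inl (dualWires .left c k))))) ∘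
      (Wires.append .left [c] [dual c]).symm

theorem bendBack_inl {V : Type*} (d : Diagram M ([dual c] ++ v) w) (ν : d.sem.V → V) (k) :
    bendBack d ν (Wires.append .left [c] [dual c] (Sum.inl (dualWires .right c k))) =
      Sum.map ν (bendExits c v w)
        (d.sem.entryTarget (Sum.inl (Wires.append .right [dual c] v (Sum.inl k)))) := by
  refine (congrArg (Sum.elim _ _) (Equiv.symm_apply_apply _ _)).trans ?_
  exact congrArg (fun k => Sum.map ν (bendExits c v w) (d.sem.entryTarget
    (Sum.inl (Wires.append .right [dual c] v (Sum.inl k))))) (Equiv.symm_apply_apply _ k)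

theorem bendBack_inr {V : Type*} (d : Diagram M ([dual c] ++ v) w) (ν : d.sem.V → V) (k) :
    bendBack d ν (Wires.append .left [c] [dual c] (Sum.inr k)) =
      Sum.inr (Sum.inr (Wires.append .right [c] w (Sum.inl (dualWires .left c k)))) :=
  congrArg (Sum.elim _ _) (Equiv.symm_apply_apply _ _)

theorem attachRight_append_fst {V W : Type*} {a b : Dir}
    (back : Wires .left ([a] ++ [b]) → (V ⊕ W) ⊕ Exits (interp v) (interp w)) (i) :
    attachRight back (Sum.inr (Sum.inl (Wires.append .left [a] ([b] ++ v) (Sum.inl i)))) =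
      back (Wires.append .left [a] [b] (Sum.inl i)) := by
  have h := attachRight_back (v := v) back (Wires.append .left [a] [b] (Sum.inl i))
  exact Wires.append_append_fst .left a b v i ▸ h

theorem attachRight_append_snd {V W : Type*} {a b : Dir}
    (back : Wires .left ([a] ++ [b]) → (V ⊕ W) ⊕ Exits (interp v) (interp w)) (i) :
    attachRight back (Sum.inr (Sum.inl (Wires.append .left [a] ([b] ++ v)
        (Sum.inr (Wires.append .left [b] v (Sum.inl i)))))) =
      back (Wires.append .left [a] [b] (Sum.inr i)) := by
  have h := attachRight_back (v := v) back (Wires.append .left [a] [b] (Sum.inr i))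
  exact Wires.append_append_snd .left a b v i ▸ h

theorem attachRight_append_trd {V W : Type*} {a b : Dir}
    (back : Wires .left ([a] ++ [b]) → (V ⊕ W) ⊕ Exits (interp v) (interp w)) (j) :
    attachRight back (Sum.inr (Sum.inl (Wires.append .left [a] ([b] ++ v)
        (Sum.inr (Wires.append .left [b] v (Sum.inr j)))))) = Sum.inr (Sum.inl j) := by
  have h := attachRight_left (v := v) back j
  exact Wires.append_append_trd .left a b v j ▸ h

theorem attachRight_bendBack_fst {V W : Type*} (d : Diagram M ([dual c] ++ v) w)
    (ν : d.sem.V → V ⊕ W) (k) :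
    attachRight (bendBack d ν) (Sum.inr (Sum.inl
        (Wires.append .left [c] ([dual c] ++ v) (Sum.inl (dualWires .right c k))))) =
      Sum.map ν (bendExits c v w)
        (d.sem.entryTarget (Sum.inl (Wires.append .right [dual c] v (Sum.inl k)))) :=
  (attachRight_append_fst _ _).trans (bendBack_inl d ν k)

theorem attachRight_bendBack_snd {V W : Type*} (d : Diagram M ([dual c] ++ v) w)
    (ν : d.sem.V → W) (t) :
    attachRight (V := V) (bendBack d (Sum.inr ∘ ν))
        (Diagram.targetMap (fun a => Wires.append a [c] ([dual c] ++ v) ∘ Sum.inr)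
          (fun a => Wires.append a [c] w ∘ Sum.inr) ν t) =
      Sum.map (Sum.inr ∘ ν) (bendExits c v w) t := by
  rcases t with x | j | i
  · rfl
  · obtain ⟨k | j, rfl⟩ := (Wires.append .left [dual c] v).surjective j
    · refine (attachRight_append_snd _ k).trans ((bendBack_inr d _ k).trans ?_)
      exact congrArg Sum.inr (bendEquiv_moved _ _ _ k).symm
    · refine (attachRight_append_trd _ j).trans ?_
      exact congrArg Sum.inr (bendEquiv_left _ _ _ j).symm
  · exact congrArg Sum.inr (bendEquiv_right (Wires.append .left [dual c] v) _ _ i).symm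

theorem attachLeft_bendBack {C : Diagram M [] ([c] ++ [dual c])} (hC : IsCup C)
    {d : Diagram M ([dual c] ++ v) w} {ψ : d.sem.V → d.besideWire.sem.V}
    (hψ : ∀ s, d.besideWire.sem.targets (sourceMap
        (fun a => Wires.append a [c] ([dual c] ++ v) ∘ Sum.inr)
        (fun a => Wires.append a [c] w ∘ Sum.inr) ψ s) =
      targetMap (fun a => Wires.append a [c] ([dual c] ++ v) ∘ Sum.inr)
        (fun a => Wires.append a [c] w ∘ Sum.inr) ψ '' d.sem.targets s) (j) :
    attachLeft d.besideWire (bendBack d (Sum.inr ∘ ψ)) (C.sem.entryTarget (Sum.inr j)) =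
      bendBack d (Sum.inr ∘ ψ) j := by
  let back := bendBack (V := C.sem.V ⊕ d.besideWire.sem.V) d (Sum.inr ∘ ψ)
  obtain ⟨k | k, rfl⟩ := (Wires.append .left [c] [dual c]).surjective j
  · obtain ⟨k, rfl⟩ := (dualWires .right c).surjective k
    have := (congrArg (attachRight back) (entryTarget_eq_of_targets (hψ (Sum.inl (Sum.inl
      (Wires.append .right [dual c] v (Sum.inl k))))))).trans (attachRight_bendBack_snd d ψ _)
    refine (congrArg _ (hC.entryTarget_fst k)).trans
      (Eq.trans ?_ (this.trans (bendBack_inl d _ k).symm))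
    exact congrArg (fun i => attachRight back (d.besideWire.sem.entryTarget (Sum.inl i)))
      (Wires.append_append_snd .right c (dual c) v k)
  · have := (joins_id (M := M) [c] .right (dualWires .left c k)).tensor_fst d
    refine (congrArg _ (hC.entryTarget_snd k)).trans (Eq.trans ?_
      ((congrArg (attachRight back) this).trans (bendBack_inr d _ k).symm))
    exact congrArg (fun i => attachRight back (d.besideWire.sem.entryTarget (Sum.inl i)))
      (Wires.append_append_fst .right c (dual c) v (dualWires .left c k))

theorem image_attachRight_bendBack {V : Type*} {d : Diagram M ([dual c] ++ v) w}
    {ψ : d.sem.V → d.besideWire.sem.V}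
    (hψ : ∀ s, d.besideWire.sem.targets (sourceMap
        (fun a => Wires.append a [c] ([dual c] ++ v) ∘ Sum.inr)
        (fun a => Wires.append a [c] w ∘ Sum.inr) ψ s) =
      targetMap (fun a => Wires.append a [c] ([dual c] ++ v) ∘ Sum.inr)
        (fun a => Wires.append a [c] w ∘ Sum.inr) ψ '' d.sem.targets s) (s) :
    attachRight (V := V) (bendBack d (Sum.inr ∘ ψ)) '' d.besideWire.sem.targets
        (Sum.map (Sum.map (Wires.append .right ([c] ++ [dual c]) v ∘ Sum.inr) id) id
          (Sum.map (bendEntries c v w) ψ s)) =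
      Sum.map (Sum.inr ∘ ψ) (bendExits c v w) '' d.sem.targets s := by
  let source : Entries (interp v) (interp ([c] ++ w)) →
      Entries (interp (([c] ++ [dual c]) ++ v)) (interp ([c] ++ w)) ⊕ d.besideWire.sem.V :=
    Sum.inl ∘ Sum.map (Wires.append .right ([c] ++ [dual c]) v ∘ Sum.inr) id
  have himage {s'} (hs : s' = sourceMap (fun a => Wires.append a [c] ([dual c] ++ v) ∘ Sum.inr)
      (fun a => Wires.append a [c] w ∘ Sum.inr) ψ s) :
      attachRight (V := V) (bendBack d (Sum.inr ∘ ψ)) '' d.besideWire.sem.targets s' =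
        Sum.map (Sum.inr ∘ ψ) (bendExits c v w) '' d.sem.targets s := by
    rw [hs]
    exact (congrArg _ (hψ s)).trans ((Set.image_image _ _ _).trans
      (Set.image_congr fun t _ => attachRight_bendBack_snd d ψ t))
  rcases s with (i | j) | y
  · obtain ⟨k | i, rfl⟩ := (Wires.append .right [dual c] v).surjective i
    · have hjoins := (joins_id (M := M) [c] .left (dualWires .right c k)).tensor_fst d
      have htargets := (d.besideWire.sem.targets_entry _).trans (congrArg _ hjoins)
      refine (congrArg (_ '' d.besideWire.sem.targets ·)
        (congrArg source (bendEquiv_moved _ _ _ k))).trans ?_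
      refine (congrArg _ htargets).trans (Set.image_singleton.trans ?_)
      refine Eq.trans ?_ ((congrArg _ (d.sem.targets_entry _)).trans Set.image_singleton).symm
      exact congrArg _ (attachRight_bendBack_fst d _ k)
    · refine himage ((congrArg source (bendEquiv_left _ _ _ i)).trans ?_)
      exact congrArg (Sum.inl ∘ Sum.inl) (Wires.append_append_trd .right c (dual c) v i)
  · exact himage (congrArg source (bendEquiv_right _ _ _ j))
  · exact himage rfl

theorem exists_bend (d : Diagram M ([dual c] ++ v) w) :
    ∃ D : Diagram M v ([c] ++ w), ∃ ρ : d.sem.V ≃ D.sem.V,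
      (∀ x, ρ x ∈ D.sem.V₀ ↔ x ∈ d.sem.V₀) ∧ (∀ x, D.sem.prio (ρ x) = d.sem.prio x) ∧
      ∀ s, D.sem.targets (Sum.map (bendEntries c v w) ρ s) =
        Sum.map ρ (bendExits c v w) '' d.sem.targets s := by
  obtain ⟨C, hC⟩ := exists_isCup M c
  obtain ⟨ψ, hV₀, hprio, hψ⟩ := exists_besideWire_equiv d
  obtain ⟨φ, hφV₀, hφprio, hφ⟩ := exists_attach_equiv C d.besideWire
  have _ : IsEmpty C.sem.V := hC.isEmpty
  let ρ := ψ.trans ((Equiv.emptySum C.sem.V d.besideWire.sem.V).symm.trans φ)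
  refine ⟨C.attach d.besideWire, ρ, fun x => (hφV₀ _).trans (hV₀ _),
    fun x => (hφprio _).trans (hprio _), fun s => ?_⟩
  have htargets := (hφ _ (attachLeft_bendBack hC hψ)).2 (Sum.map (bendEntries c v w) ψ s)
  rw [image_attachRight_bendBack hψ, Set.image_image] at htargets
  refine Eq.trans ?_ (htargets.trans (Set.image_congr fun t _ => ?_))
  · rcases s with e | y <;> rfl
  · rcases t with x | o <;> rfl

theorem Realizable.bend {V : Type*} {own : Set V} {pr : V → Fin (M + 1)} {E}
    (h : Realizable ([dual c] ++ v) w own pr E) :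
    Realizable v ([c] ++ w) own pr (Relation.Map E
      (Sum.map (bendEntries c v w) id) (Sum.map id (bendExits c v w))) := by
  obtain ⟨d, κ, hown, hpr, rfl⟩ := h
  obtain ⟨D, ρ, hV₀, hprio, htargets⟩ := exists_bend d
  have hE : D.sem.E = Relation.Map d.sem.E (Sum.map (bendEntries c v w) ρ)
      (Sum.map ρ (bendExits c v w)) :=
    edge_eq_map ((bendEntries c v w).sumCongr ρ).surjective htargets
  refine ⟨D, ρ.symm.trans κ, fun x => ?_, fun x => ?_, ?_⟩
  · rw [Equiv.trans_apply, ← hown, ← hV₀, ρ.apply_symm_apply]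
  · rw [Equiv.trans_apply, ← hpr, ← hprio, ρ.apply_symm_apply]
  · rw [hE, Relation.map_map, Relation.map_map]
    simp only [Sum.map_comp_map, Equiv.coe_trans, Function.comp_assoc, Equiv.symm_comp_self,
      Function.comp_id, Function.id_comp]

end Bend

/-! ### Single positions -/

section Node

variable {v w : List Dir}

/-- The edges of a game with a single internal position joined to the whole interface. -/
def nodeEdge {I O : Type*} : I ⊕ Unit → Unit ⊕ O → Prop
  | Sum.inl _, Sum.inl _ => True
  | Sum.inr _, Sum.inr _ => True
  | _, _ => False

/-- Some diagram `v → w` has a single internal position, of priority `p` and joined to the whole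
interface, which belongs to Player `0` iff `own` holds. -/
def NodeRealizable (v w : List Dir) (own : Prop) (p : Fin (M + 1)) : Prop :=
  Realizable v w {_x : Unit | own} (fun _ => p) nodeEdge

theorem map_nodeEdge {I O I' O' : Type*} (e : I ≃ I') (e' : O ≃ O') :
    Relation.Map nodeEdge (Sum.map e id) (Sum.map id e') = nodeEdge := by
  ext s t
  obtain ⟨s, rfl⟩ := (e.sumCongr (Equiv.refl Unit)).surjective s
  obtain ⟨t, rfl⟩ := ((Equiv.refl Unit).sumCongr e').surjective t
  refine (Relation.map_apply_apply (e.sumCongr (Equiv.refl Unit)).injective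
    ((Equiv.refl Unit).sumCongr e').injective _ s t).trans ?_
  rcases s with s | s <;> rcases t with t | t <;> rfl

theorem nodeRealizable_gen (g : Generator M v w) {own : Prop} {p : Fin (M + 1)} (κ : g.sem.V ≃ Unit)
    (hown : ∀ x, x ∈ g.sem.V₀ ↔ own) (hprio : ∀ x, g.sem.prio x = p)
    (hE : ∀ s t, g.sem.E s t ↔ nodeEdge (Sum.map id κ s) (Sum.map κ id t)) :
    NodeRealizable v w own p := by
  refine ⟨gen g, κ, hown, hprio, ?_⟩
  ext s t
  obtain ⟨s, rfl⟩ := ((Equiv.refl _).sumCongr κ).surjective s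
  obtain ⟨t, rfl⟩ := (κ.sumCongr (Equiv.refl _)).surjective t
  exact (Relation.map_apply_apply ((Equiv.refl _).sumCongr κ).injective
    (κ.sumCongr (Equiv.refl _)).injective _ s t).trans (hE s t)

theorem NodeRealizable.bend {c : Dir} {own : Prop} {p : Fin (M + 1)}
    (h : NodeRealizable ([dual c] ++ v) w own p) : NodeRealizable v ([c] ++ w) own p := by
  have := Realizable.bend h
  rwa [map_nodeEdge] at this

theorem node_edge_iff {own : Set Unit} {p : Fin (M + 1)} {a b : ℕ} (s t) :
    (node own p a b).E s t ↔
      nodeEdge (Sum.map id (Equiv.refl Unit) s) (Sum.map (Equiv.refl Unit) id t) := by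
  rcases s with s | s <;> rcases t with t | t <;> rfl

theorem nodeRealizable_start : NodeRealizable [] [.right] False (0 : Fin (M + 1)) :=
  nodeRealizable_gen .start (Equiv.refl Unit) (fun _ => Iff.rfl) (fun _ => rfl) node_edge_iff

theorem nodeRealizable_merge :
    NodeRealizable [] [.left, .left, .right] False (0 : Fin (M + 1)) :=
  .bend (c := .left) (.bend (c := .left) (nodeRealizable_gen .merge (Equiv.refl Unit)
    (fun _ => Iff.rfl) (fun _ => rfl) node_edge_iff))

theorem nodeRealizable_priority (p : Fin (M + 1)) :
    NodeRealizable [] [.left, .right] False p :=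
  .bend (c := .left) (nodeRealizable_gen (.priority p) (Equiv.refl Unit) (fun _ => Iff.rfl)
    (fun _ => rfl) node_edge_iff)

theorem nodeRealizable_player (own : Prop) :
    NodeRealizable [] [.left, .right, .right] own (0 : Fin (M + 1)) := by
  refine .bend (c := .left) ?_
  by_cases h : own
  · exact nodeRealizable_gen .player0 (Equiv.refl Unit) (fun _ => iff_of_true trivial h)
      (fun _ => rfl) node_edge_iff
  · exact nodeRealizable_gen .player1 (Equiv.refl Unit) (fun _ => iff_of_false (fun hx => hx) h)
      (fun _ => rfl) node_edge_iff

theorem nodeRealizable_lose (own : Prop) :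
    NodeRealizable [] [.left] own (0 : Fin (M + 1)) := by
  refine .bend (c := .left) ?_
  by_cases h : own
  · exact nodeRealizable_gen .lose0 (Equiv.refl Unit) (fun _ => iff_of_true trivial h)
      (fun _ => rfl) node_edge_iff
  · exact nodeRealizable_gen .lose1 (Equiv.refl Unit) (fun _ => iff_of_false (fun hx => hx) h)
      (fun _ => rfl) node_edge_iff

theorem NodeRealizable.exists_diagram {own : Prop} {p : Fin (M + 1)}
    (h : NodeRealizable v w own p) :
    ∃ N : Diagram M v w, Nonempty (N.sem.V ≃ Unit) ∧ (∀ x, x ∈ N.sem.V₀ ↔ own) ∧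
      (∀ x, N.sem.prio x = p) ∧ (∀ e x, N.sem.entryTarget e = Sum.inl x) ∧
      ∀ x, N.sem.targets (Sum.inr x) = Set.range Sum.inr := by
  obtain ⟨N, κ, hV₀, hprio, hE⟩ := h
  have edge_iff (s t) : N.sem.E s t ↔ nodeEdge (Sum.map id κ s) (Sum.map κ id t) := by
    rw [← hE]
    exact (Relation.map_apply_apply ((Equiv.refl _).sumCongr κ).injective
      (κ.sumCongr (Equiv.refl _)).injective _ s t).symm
  refine ⟨N, ⟨κ⟩, hV₀, hprio, fun e x => (entryTarget_eq_iff _ _ _).2 ((edge_iff _ _).2 trivial),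
    fun x => Set.ext fun t => (edge_iff _ _).trans ?_⟩
  rcases t with y | o
  · exact iff_of_false (fun h => h) (by simp)
  · exact iff_of_true trivial ⟨o, rfl⟩

end Node

/-! ### Plugging a position into a diagram -/

section Plug

variable {u v : List Dir} {V : Type*}

/-- The wires `u` of the sources of a diagram `u ++ v → []` are attached to a new position
`none`. -/
def plugSource (u v : List Dir) :
    Entries (interp (u ++ v)) (interp []) ⊕ V → Entries (interp v) (interp []) ⊕ Option V :=
  Sum.elim (Sum.elim (Sum.elim (fun _ => Sum.inr none) (Sum.inl ∘ Sum.inl) ∘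
    (Wires.append .right u v).symm) (Sum.inl ∘ Sum.inr)) (Sum.inr ∘ some)

/-- The wires `u` of the targets of a diagram `u ++ v → []` are attached to a new position
`none`. -/
def plugTarget (u v : List Dir) :
    V ⊕ Exits (interp (u ++ v)) (interp []) → Option V ⊕ Exits (interp v) (interp []) :=
  Sum.elim (Sum.inl ∘ some) (Sum.elim (Sum.elim (fun _ => Sum.inl none) (Sum.inr ∘ Sum.inl) ∘
    (Wires.append .left u v).symm) (Sum.inr ∘ Sum.inr))

theorem exists_plug_targets {own : Prop} {p : Fin (M + 1)} (hN : NodeRealizable [] u own p)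
    (d : Diagram M (u ++ v) []) :
    ∃ (D : Diagram M v []) (ρ : Option d.sem.V ≃ D.sem.V),
      (∀ x, ρ x ∈ D.sem.V₀ ↔ x.elim own (· ∈ d.sem.V₀)) ∧
      (∀ x, D.sem.prio (ρ x) = x.elim p d.sem.prio) ∧
      D.sem.targets (Sum.inr (ρ none)) = Set.range (fun i => Sum.map ρ id (plugTarget u v
        (d.sem.entryTarget (Sum.inl (Wires.append .right u v (Sum.inl i)))))) ∧
      ∀ s, D.sem.targets (Sum.map id (ρ ∘ some) s) = (fun t => Sum.map ρ id (plugTarget u v t)) ''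
        d.sem.targets (Sum.map (Sum.map (Wires.append .right u v ∘ Sum.inr) id) id s) := by
  obtain ⟨N, ⟨κ⟩, hown, hp, hentry, htargets⟩ := hN.exists_diagram
  obtain ⟨φ, hV₀, hprio, hφ⟩ := exists_attach_equiv N d
  obtain ⟨hleft, hright⟩ := hφ (fun _ => Sum.inl (Sum.inl (κ.symm ())))
    fun j => congrArg _ (hentry _ _)
  let ρ : Option d.sem.V ≃ (N.attach d).sem.V :=
    ((Equiv.optionEquivSumPUnit _).trans (Equiv.sumComm _ _)).trans
      ((κ.symm.sumCongr (Equiv.refl _)).trans φ)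
  have map_attachRight (t) : Sum.map φ id (attachRight (fun _ => Sum.inl (Sum.inl (κ.symm ()))) t) =
      Sum.map ρ id (plugTarget u v t) := by
    rcases t with y | j | i
    · rfl
    · obtain ⟨j | j, rfl⟩ := (Wires.append .left u v).surjective j <;>
        simp [plugTarget, attachRight, ρ]
    · rfl
  refine ⟨N.attach d, ρ, ?_, ?_, (hleft _).trans ?_, fun s => (hright s).trans
    ((Set.image_image _ _ _).trans (Set.image_congr fun t _ => map_attachRight t))⟩
  · rintro (_ | x)
    exacts [(hV₀ _).trans (hown _), hV₀ _]
  · rintro (_ | x)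
    exacts [(hprio _).trans (hp _), hprio _]
  · rw [htargets]
    ext t
    constructor
    · rintro ⟨_, ⟨_, ⟨j | i, rfl⟩, rfl⟩, rfl⟩
      exacts [j.elim0, ⟨i, (map_attachRight _).symm⟩]
    · rintro ⟨i, rfl⟩
      exact ⟨_, ⟨_, ⟨Sum.inr i, rfl⟩, rfl⟩, map_attachRight _⟩

theorem exists_plug {own : Prop} {p : Fin (M + 1)} (hN : NodeRealizable [] u own p)
    (d : Diagram M (u ++ v) []) :
    ∃ (D : Diagram M v []) (ρ : Option d.sem.V ≃ D.sem.V),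
      (∀ x, ρ x ∈ D.sem.V₀ ↔ x.elim own (· ∈ d.sem.V₀)) ∧
      (∀ x, D.sem.prio (ρ x) = x.elim p d.sem.prio) ∧
      D.sem.E = Relation.Map d.sem.E (Sum.map id ρ ∘ plugSource u v)
        (Sum.map ρ id ∘ plugTarget u v) := by
  obtain ⟨D, ρ, hV₀, hprio, hnone, hsome⟩ := exists_plug_targets hN d
  refine ⟨D, ρ, hV₀, hprio, ?_⟩
  ext s t
  constructor
  · intro h
    rcases s with (i | j) | x
    · obtain ⟨t', ht', rfl⟩ := (hsome (Sum.inl (Sum.inl i))).le h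
      exact ⟨_, t', ht', by simp [plugSource], rfl⟩
    · exact j.elim0
    · obtain ⟨_ | x, rfl⟩ := ρ.surjective x
      · obtain ⟨i, rfl⟩ := hnone.le h
        exact ⟨_, _, (entryTarget_eq_iff _ _ _).1 rfl, by simp [plugSource], rfl⟩
      · obtain ⟨t', ht', rfl⟩ := (hsome (Sum.inr x)).le h
        exact ⟨_, t', ht', rfl, rfl⟩
  · rintro ⟨(k | j) | x, t', ht', rfl, rfl⟩
    · obtain ⟨k | i, rfl⟩ := (Wires.append .right u v).surjective k
      · obtain rfl := (entryTarget_eq_iff _ _ _).2 ht'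
        simp only [Function.comp_apply, plugSource, Sum.elim_inl, Equiv.symm_apply_apply,
          Sum.map_inr]
        exact hnone.ge ⟨k, rfl⟩
      · simp only [Function.comp_apply, plugSource, Sum.elim_inl, Equiv.symm_apply_apply,
          Sum.elim_inr, Sum.map_inl]
        exact (hsome (Sum.inl (Sum.inl i))).ge ⟨t', ht', rfl⟩
    · exact j.elim0
    · exact (hsome (Sum.inr x)).ge ⟨t', ht', rfl⟩

theorem Realizable.plug {own : Set (Option V)} {pr : Option V → Fin (M + 1)} {E}
    (hN : NodeRealizable [] u (none ∈ own) (pr none))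
    (h : Realizable (u ++ v) [] {x | some x ∈ own} (fun x => pr (some x)) E) :
    Realizable v [] own pr (Relation.Map E (plugSource u v) (plugTarget u v)) := by
  obtain ⟨d, κ, hown, hpr, rfl⟩ := h
  obtain ⟨D, ρ, hV₀, hprio, hE⟩ := exists_plug hN d
  refine ⟨D, ρ.symm.trans (Equiv.optionCongr κ), fun x => ?_, fun x => ?_, ?_⟩
  · obtain ⟨_ | x, rfl⟩ := ρ.surjective x
    · simp [hV₀]
    · simpa [hV₀] using hown x
  · obtain ⟨_ | x, rfl⟩ := ρ.surjective x
    · simp [hprio]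
    · simpa [hprio] using hpr x
  · rw [hE, Relation.map_map, Relation.map_map]
    congr 1 <;> funext s
    · rcases s with (k | j) | x
      · obtain ⟨k | i, rfl⟩ := (Wires.append .right u v).surjective k <;> simp [plugSource]
      · rfl
      · simp [plugSource]
    · rcases s with x | j | i
      · simp [plugTarget]
      · obtain ⟨k | j, rfl⟩ := (Wires.append .left u v).surjective j <;> simp [plugTarget]
      · rfl

end Plug

/-! ### Nets of positions -/

theorem map_netEdge {I O V I' O' V' : Type*} {out inn : V → Type*} {out' inn' : V' → Type*}
    (φ : I ⊕ (Σ x, out x) ≃ O ⊕ (Σ x, inn x)) (α : I' ⊕ (Σ x, out' x) ≃ I ⊕ (Σ x, out x))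
    (β : O' ⊕ (Σ x, inn' x) ≃ O ⊕ (Σ x, inn x)) {f : I' ⊕ V' → I ⊕ V} {g : V' ⊕ O' → V ⊕ O}
    (hf : ∀ p, f (Sum.map id Sigma.fst p) = Sum.map id Sigma.fst (α p))
    (hg : ∀ q, g (Sum.elim Sum.inr (Sum.inl ∘ Sigma.fst) q) =
      Sum.elim Sum.inr (Sum.inl ∘ Sigma.fst) (β q)) :
    Relation.Map (netEdge (α.trans (φ.trans β.symm))) f g = netEdge φ := by
  ext s t
  constructor
  · rintro ⟨_, _, ⟨p, rfl, rfl⟩, rfl, rfl⟩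
    exact ⟨α p, (hf p).symm, by simp [hg]⟩
  · rintro ⟨p, rfl, rfl⟩
    exact ⟨_, _, ⟨α.symm p, rfl, rfl⟩, by simp [hf], by simp [hg]⟩

section Absorb

variable {V P B C : Type*} {f : Option V → Type*}

/-- The ports of the position `none` are regarded as part of the interface. -/
def absorb (e : f none ⊕ B ≃ P) :
    (P ⊕ C) ⊕ (Σ x : V, f (some x)) ≃ (B ⊕ C) ⊕ (Σ x : Option V, f x) where
  toFun
    | Sum.inl (Sum.inl p) => Sum.elim (fun a => Sum.inr ⟨none, a⟩) (Sum.inl ∘ Sum.inl) (e.symm p)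
    | Sum.inl (Sum.inr c) => Sum.inl (Sum.inr c)
    | Sum.inr ⟨x, k⟩ => Sum.inr ⟨some x, k⟩
  invFun
    | Sum.inl (Sum.inl b) => Sum.inl (Sum.inl (e (Sum.inr b)))
    | Sum.inl (Sum.inr c) => Sum.inl (Sum.inr c)
    | Sum.inr ⟨none, a⟩ => Sum.inl (Sum.inl (e (Sum.inl a)))
    | Sum.inr ⟨some x, k⟩ => Sum.inr ⟨x, k⟩
  left_inv := by
    rintro ((p | c) | ⟨x, k⟩)
    · obtain ⟨a | b, rfl⟩ := e.surjective p <;> simp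
    · rfl
    · rfl
  right_inv := by
    rintro ((b | c) | ⟨x | x, k⟩) <;> simp

end Absorb

theorem plugSource_absorb {V : Type*} {f : Option V → Type*} {u v : List Dir}
    (e : f none ≃ Wires .right u) (p) :
    plugSource u v (Sum.map id Sigma.fst p) = Sum.map id Sigma.fst
      (absorb (f := f) ((e.sumCongr (Equiv.refl _)).trans (Wires.append .right u v)) p) := by
  rcases p with (k | j) | x
  · obtain ⟨k | i, rfl⟩ := (Wires.append .right u v).surjective k <;> simp [plugSource, absorb]
  · rfl
  · rfl

theorem plugTarget_absorb {V : Type*} {f : Option V → Type*} {u v : List Dir}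
    (e : f none ≃ Wires .left u) (q) :
    plugTarget u v (Sum.elim Sum.inr (Sum.inl ∘ Sigma.fst) q) =
      Sum.elim Sum.inr (Sum.inl ∘ Sigma.fst)
        (absorb (f := f) ((e.sumCongr (Equiv.refl _)).trans (Wires.append .left u v)) q) := by
  rcases q with (k | j) | x
  · obtain ⟨k | i, rfl⟩ := (Wires.append .left u v).surjective k <;> simp [plugTarget, absorb]
  · rfl
  · rfl

/-- Some single position with owner `own` and priority `p` has its output ports indexed by `out` and
its input ports indexed by `inn`, and is realized by a diagram `[] → u` whose wires are these
ports. -/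
def PortsRealizable (out inn : Type) (own : Prop) (p : Fin (M + 1)) : Prop :=
  ∃ u : List Dir, Nonempty (out ≃ Wires .right u) ∧ Nonempty (inn ≃ Wires .left u) ∧
    NodeRealizable [] u own p

theorem Realizable.of_equiv {V W : Type*} {v w : List Dir} (e : V ≃ W) {own : Set W}
    {pr : W → Fin (M + 1)} {E} (h : Realizable v w (e ⁻¹' own) (pr ∘ e) E) :
    Realizable v w own pr (Relation.Map E (Sum.map id e) (Sum.map e id)) := by
  obtain ⟨d, κ, hown, hpr, rfl⟩ := h
  refine ⟨d, κ.trans e, hown, hpr, ?_⟩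
  rw [Relation.map_map]
  simp only [Sum.map_comp_map, Equiv.coe_trans, Function.id_comp]

theorem realizable_net_of_isEmpty {V : Type*} [IsEmpty V] {out inn : V → Type} {own : Set V}
    {pr : V → Fin (M + 1)} {v : List Dir}
    (φ : Entries (interp v) (interp []) ⊕ (Σ x, out x) ≃
      Exits (interp v) (interp []) ⊕ (Σ x, inn x)) :
    Realizable v [] own pr (netEdge φ) := by
  have : IsEmpty (Fin (interp []).2) := inferInstanceAs (IsEmpty (Fin 0))
  have : IsEmpty (Fin (interp []).1) := inferInstanceAs (IsEmpty (Fin 0))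
  let f : Wires .right v ≃ Wires .left v :=
    ((Equiv.sumEmpty _ _).symm.trans (Equiv.sumEmpty _ _).symm).trans
      (φ.trans ((Equiv.sumEmpty _ _).trans (Equiv.sumEmpty _ _)))
  have hf (i) : φ (Sum.inl (Sum.inl i)) = Sum.inl (Sum.inl (f i)) := by
    rcases hq : φ (Sum.inl (Sum.inl i)) with (j | j) | j
    · simp [f, hq]
    · exact isEmptyElim j
    · exact isEmptyElim j.1
  obtain ⟨X, hX, hE⟩ := isMatching_of_injective (M := M) rfl (Fin.equiv_iff_eq.1 ⟨f.symm⟩)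
    f.injective
  refine ⟨X, Equiv.equivOfIsEmpty _ _, isEmptyElim, isEmptyElim, ?_⟩
  ext s t
  constructor
  · rintro ⟨(i | j) | x, t, hst, rfl, rfl⟩
    · obtain rfl := (hE i).symm.trans ((entryTarget_eq_iff _ _ _).2 hst)
      exact ⟨Sum.inl (Sum.inl i), rfl, by rw [hf]; rfl⟩
    · exact isEmptyElim j
    · exact isEmptyElim x
  · rintro ⟨(i | j) | p, rfl, rfl⟩
    · exact ⟨Sum.inl (Sum.inl i), _, (entryTarget_eq_iff _ _ _).1 (hE i), rfl, by rw [hf]; rfl⟩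
    · exact isEmptyElim j
    · exact isEmptyElim p.1

theorem realizable_net_option {V : Type*} {out inn : Option V → Type} {own : Set (Option V)}
    {pr : Option V → Fin (M + 1)}
    (hnode : PortsRealizable (out none) (inn none) (none ∈ own) (pr none))
    (h : ∀ {v : List Dir} (φ : Entries (interp v) (interp []) ⊕ (Σ x, out (some x)) ≃
      Exits (interp v) (interp []) ⊕ (Σ x, inn (some x))),
      Realizable v [] {x | some x ∈ own} (fun x => pr (some x)) (netEdge φ)) {v : List Dir}
    (φ : Entries (interp v) (interp []) ⊕ (Σ x, out x) ≃
      Exits (interp v) (interp []) ⊕ (Σ x, inn x)) :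
    Realizable v [] own pr (netEdge φ) := by
  obtain ⟨u, ⟨eout⟩, ⟨einn⟩, hN⟩ := hnode
  rw [← map_netEdge φ _ _ (plugSource_absorb eout) (plugTarget_absorb einn)]
  exact .plug hN (h _)

theorem realizable_net_nil (V : Type u) [Finite V] (out inn : V → Type) (own : Set V)
    (pr : V → Fin (M + 1)) (hnode : ∀ x, PortsRealizable (out x) (inn x) (x ∈ own) (pr x))
    {v : List Dir} (φ : Entries (interp v) (interp []) ⊕ (Σ x, out x) ≃
      Exits (interp v) (interp []) ⊕ (Σ x, inn x)) :
    Realizable v [] own pr (netEdge φ) := by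
  revert out inn own pr v
  apply Finite.induction_empty_option (α := V)
  · intro V W e ih out inn own pr hnode v φ
    rw [← map_netEdge φ ((Equiv.refl _).sumCongr (Equiv.sigmaCongrLeft e))
      ((Equiv.refl _).sumCongr (Equiv.sigmaCongrLeft e)) (f := Sum.map id e) (g := Sum.map e id)
      (by rintro (p | p) <;> rfl) (by rintro (q | q) <;> rfl)]
    exact .of_equiv e (ih _ _ _ _ (fun x => hnode (e x)) _)
  · exact fun _ _ _ _ _ => realizable_net_of_isEmpty
  · exact fun ih _ _ _ _ hnode _ =>
      realizable_net_option (hnode none) (ih _ _ _ _ fun x => hnode (some x))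

theorem realizable_net {V : Type u} [Finite V] {out inn : V → Type} {own : Set V}
    {pr : V → Fin (M + 1)} (hnode : ∀ x, PortsRealizable (out x) (inn x) (x ∈ own) (pr x))
    {v w : List Dir} (φ : Entries (interp v) (interp w) ⊕ (Σ x, out x) ≃
      Exits (interp v) (interp w) ⊕ (Σ x, inn x)) :
    Realizable v w own pr (netEdge φ) := by
  induction w generalizing v with
  | nil => exact realizable_net_nil V out inn own pr hnode φ
  | cons c w ih =>
    rw [← map_netEdge φ ((bendEntries c v w).sumCongr (Equiv.refl _))
      ((bendExits c v w).sumCongr (Equiv.refl _)) (f := Sum.map (bendEntries c v w) id)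
      (g := Sum.map id (bendExits c v w)) (by rintro (p | p) <;> rfl)
      (by rintro (q | q) <;> rfl)]
    exact Realizable.bend (ih _)

/-! ### Universality -/

theorem portsRealizable_chainNode {m n : Obj} {A : OpenParityGame.{u} M m n} (x : ChainNode A) :
    PortsRealizable x.Out x.In x.IsZero x.priority := by
  rcases x with x | ⟨x, j⟩ | x | ⟨x, j⟩ | x
  · exact ⟨[.right], ⟨finOneEquiv.symm⟩, ⟨Equiv.equivOfIsEmpty Empty (Fin 0)⟩, nodeRealizable_start⟩
  · exact ⟨[.left, .left, .right], ⟨finOneEquiv.symm⟩, ⟨finTwoEquiv.symm⟩, nodeRealizable_merge⟩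
  · exact ⟨[.left, .right], ⟨finOneEquiv.symm⟩, ⟨finOneEquiv.symm⟩, nodeRealizable_priority _⟩
  · exact ⟨[.left, .right, .right], ⟨finTwoEquiv.symm⟩, ⟨finOneEquiv.symm⟩, nodeRealizable_player _⟩
  · exact ⟨[.left], ⟨Equiv.equivOfIsEmpty Empty (Fin 0)⟩, ⟨finOneEquiv.symm⟩, nodeRealizable_lose _⟩

theorem exists_iso_expansion {v w : List Dir} (A : OpenParityGame.{u} M (interp v) (interp w)) :
    ∃ d : Diagram M v w, Nonempty (Iso d.sem A.expansion) := by
  obtain ⟨d, κ, hown, hpr, hE⟩ := realizable_net (own := {y : ChainNode A | y.IsZero})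
    portsRealizable_chainNode (ChainNode.sourceEquiv.symm.trans ChainNode.targetEquiv)
  refine ⟨d, κ, fun x => (hown x).symm, fun x => (hpr x).symm, fun s t => ?_⟩
  change netEdge _ _ _ ↔ _
  rw [← hE]
  exact Relation.map_apply_apply ((Equiv.refl _).sumCongr κ).injective
    (κ.sumCongr (Equiv.refl _)).injective _ s t

end ParityGames

theorem mainTheorem3_general (M : ℕ) {v w : List Dir}
    (A : OpenParityGame.{u} M (interp v) (interp w)) :
    ∃ d : Diagram M v w, OpenParityGame.Equivalent d.sem A := by
  obtain ⟨d, ⟨φ⟩⟩ := exists_iso_expansion A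
  exact ⟨d, φ.equivalent.trans A.expansion_equivalent⟩

theorem mainTheorem3 (M : ℕ) (hM : 2 ≤ M) (m n : Obj) (A : OpenParityGame.{u} M m n)
    (v w : List Dir) (hv : interp v = m) (hw : interp w = n) :
    ∃ d : Diagram M v w, OpenParityGame.Equivalent (d.sem.cast hv hw) A := by
  subst hv hw
  exact mainTheorem3_general M A
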